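/- Let $Y$ be a non-empty closed (compact, without boundary) smooth $n$-manifold with a Riemannian metric $g$, let $E\to Y$ be a smooth $U(m)$ complex vector bundle of rank $m$, and let $\pi:Y\times S^1\to Y$ be the projection, where $S^1=\mathbb R/2\pi\mathbb Z$ has coordinate $t$ and $Y\times S^1$ carries the metric $g+dt^2$. All connections and gauges are smooth and unitary. Gauges act on connections by $\phi(A)=A+\phi^{-1}d_A\phi$. *Definitions.* For $M=Y$ or $M=Y\times S^1$ and $F=E$ or $F=\pi^*E$, let $\Lambda_{F,M}$ be the set of gauge equivalence classes of connections on $F\to M$ with the distance $d([A_1],[A_2])=\inf_{\phi}\|A_1-\phi(A_2)\|$, where $\phi$ runs over all gauges and $\|\cdot\|=\sup_{p\in M}|\cdot|$ is the sup norm (from the metric of $M$ and the standard norm of complex matrices). The stabilizer of a connection $A$ is $\Gamma_A=\{\phi \text{ a gauge}: d_A\phi=0\}$, and $A$ is irreducible if $\Gamma_A=\mathrm{Center}(U(m))$ (constant central gauges); $\Lambda^{irred}_{E,Y}\subset\Lambda_{E,Y}$ is the subset of irreducible classes. For a group $G$ of gauges on $E$, $CON(G)$ is the set of its conjugacy classes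 with the distance $d([a],[b])=\inf_{g\in G}\|a-gbg^{-1}\|$. For a connection $B$ on $E$, a $B$-admissible gauge is a smooth gauge $u$ on $\pi^*E\to Y\times[0,2\pi]$ with $u(0)=Id$, $u(2\pi)\in\Gamma_B$, and such that $u^{-1}\frac{\partial u}{\partial t}$ restricted to $Y\times(0,2\pi)$ extends to a smooth section over $Y\times S^1$. A connection $A$ on $\pi^*E\to Y\times S^1$ is iso-trivial if $A=u(B)$ on $Y\times (0,2\pi)$ for some connection $B$ on $E$ and some $B$-admissible $u$. Let $\mathfrak M\subset\Lambda_{\pi^*E,Y\times S^1}$ be the set of classes of iso-trivial connections, $\mathfrak M^{irred}$ the set of classes of irreducible iso-trivial connections, and $\rho:\mathfrak M\to\Lambda_{E,Y}$, $\rho([A])=[A(0)]$, the restriction to $Y\times\{0\}$. **Proposition.** 1. For every connection $B$ on $E$, every element of $\rho^{-1}([B])$ has the form $[u(B)]$ with a $B$-admissible gauge $u$, and $\tau_B:\rho^{-1}([B])\to CON(\Gamma_B)$, $[u(B)]\mapsto[u(2\pi)]$, is a well-defined homeomorphism. 2. The map $\tau:\mathfrak M^{irred}\to \mathrm{Center}(U(m))\times\Lambda^{irred}_{E,Y}$,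 $[u(B)]\mapsto(u(2\pi),[B])$ (for every connection $B$ on $E$ and every $B$-admissible $u$ with $u(B)$ irreducible), is well defined and is a homeomorphism. -/

import Mathlib

open scoped Manifold ContDiff ENNReal

set_option linter.unusedSectionVars false

noncomputable section

section MatrixCalculus

variable {E H M : Type*} [NormedAddCommGroup E] [NormedSpace ℝ E] [TopologicalSpace H]
  [TopologicalSpace M] [ChartedSpace H M] {m : ℕ}

/-- Complex `m × m` matrices. -/
abbrev Mat (m : ℕ) := Matrix (Fin m) (Fin m) ℂ

/-- A matrix-valued function is smooth on `s` if all its entries are. -/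
def SmoothMatOn (I : ModelWithCorners ℝ E H) (f : M → Mat m) (s : Set M) : Prop :=
  ∀ a b, ContMDiffOn I 𝓘(ℝ, ℂ) ∞ (fun x => f x a b) s

/-- The (entrywise) differential `df` of a matrix-valued function at `x`, a matrix-valued linear
form on the tangent space at `x`. -/
def dMat (I : ModelWithCorners ℝ E H) (f : M → Mat m) (x : M) :
    TangentSpace I x →ₗ[ℝ] Mat m where
  toFun v := Matrix.of fun a b => (mfderiv I 𝓘(ℝ, ℂ) (fun y => f y a b) x v : ℂ)
  map_add' v w := by ext a b; exact map_add (mfderiv I 𝓘(ℝ, ℂ) (fun y => f y a b) x) v w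
  map_smul' c v := by ext a b; exact map_smul (mfderiv I 𝓘(ℝ, ℂ) (fun y => f y a b) x) c v

/-- A matrix-valued `1`-form `α` is smooth on `s` if `(x, v) ↦ α_x(v)` is a smooth function on the
part of the tangent bundle lying over `s`. -/
def SmoothFormOn (I : ModelWithCorners ℝ E H) [IsManifold I 1 M]
    (α : ∀ x : M, TangentSpace I x →ₗ[ℝ] Mat m) (s : Set M) : Prop :=
  ∀ a b, ContMDiffOn I.tangent 𝓘(ℝ, ℂ) ∞ (fun p : TangentBundle I M => α p.proj p.snd a b)
    (Bundle.TotalSpace.proj ⁻¹' s)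

lemma mul_contMDiffOn_aux {E' H' M' : Type*} [NormedAddCommGroup E'] [NormedSpace ℝ E']
    [TopologicalSpace H'] [TopologicalSpace M'] [ChartedSpace H' M']
    {I : ModelWithCorners ℝ E' H'} {f g : M' → Mat m} {s : Set M'}
    (hf : ∀ a b, ContMDiffOn I 𝓘(ℝ, ℂ) ∞ (fun x => f x a b) s)
    (hg : ∀ a b, ContMDiffOn I 𝓘(ℝ, ℂ) ∞ (fun x => g x a b) s) (a b : Fin m) :
    ContMDiffOn I 𝓘(ℝ, ℂ) ∞ (fun x => (f x * g x) a b) s := by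
  simp only [Matrix.mul_apply]
  exact contMDiffOn_finsetSum fun c _ =>
    (contDiff_mul (𝕜 := ℝ) (𝔸 := ℂ)).contMDiff.comp_contMDiffOn ((hf a c).prodMk_space (hg c b))

variable {I : ModelWithCorners ℝ E H}

lemma SmoothMatOn.mul {f g : M → Mat m} {s : Set M} (hf : SmoothMatOn I f s)
    (hg : SmoothMatOn I g s) : SmoothMatOn I (fun x => f x * g x) s :=
  mul_contMDiffOn_aux hf hg

lemma SmoothMatOn.star {f : M → Mat m} {s : Set M} (hf : SmoothMatOn I f s) :
    SmoothMatOn I (fun x => star (f x)) s := by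
  have h : ContMDiff 𝓘(ℝ, ℂ) 𝓘(ℝ, ℂ) ∞ (Complex.conjCLE : ℂ → ℂ) :=
    (Complex.conjCLE : ℂ ≃L[ℝ] ℂ).contDiff.contMDiff
  exact fun a b => h.comp_contMDiffOn (hf b a)

lemma SmoothMatOn.mono {f : M → Mat m} {s t : Set M} (hf : SmoothMatOn I f s) (h : t ⊆ s) :
    SmoothMatOn I f t := fun a b => (hf a b).mono h

lemma SmoothMatOn.congr {f g : M → Mat m} {s : Set M} (hf : SmoothMatOn I f s)
    (h : ∀ x ∈ s, g x = f x) : SmoothMatOn I g s := fun a b =>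
  (hf a b).congr fun x hx => by rw [h x hx]

lemma smoothMatOn_const (c : Mat m) (s : Set M) : SmoothMatOn I (fun _ => c) s :=
  fun _ _ => contMDiffOn_const

lemma SmoothMatOn.mdiff {f : M → Mat m} {s : Set M} (hf : SmoothMatOn I f s) (hs : IsOpen s)
    {x : M} (hx : x ∈ s) (a b : Fin m) : MDifferentiableAt I 𝓘(ℝ, ℂ) (fun x => f x a b) x :=
  ((hf a b).contMDiffAt (hs.mem_nhds hx)).mdifferentiableAt (by simp)

lemma dMat_congr {f g : M → Mat m} {s : Set M} (hs : IsOpen s) (h : ∀ x ∈ s, f x = g x) {x : M}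
    (hx : x ∈ s) (v : TangentSpace I x) : dMat I f x v = dMat I g x v := by
  ext a b
  have : (fun y => f y a b) =ᶠ[nhds x] (fun y => g y a b) := by
    filter_upwards [hs.mem_nhds hx] with y hy using by rw [h y hy]
  exact congrArg (fun L => (L v : ℂ))
    (this.mfderiv_eq (I := I) (I' := 𝓘(ℝ, ℂ)))

lemma dMat_const (c : Mat m) (x : M) (v : TangentSpace I x) : dMat I (fun _ => c) x v = 0 := by
  ext a b
  change (mfderiv I 𝓘(ℝ, ℂ) (fun _ => c a b) x v : ℂ) = 0
  rw [mfderiv_const]; rfl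

lemma dMat_star {f : M → Mat m} {s : Set M} (hf : SmoothMatOn I f s) (hs : IsOpen s)
    {x : M} (hx : x ∈ s) (v : TangentSpace I x) :
    dMat I (fun y => star (f y)) x v = star (dMat I f x v) := by
  ext a b
  have h := (hf.mdiff hs hx b a).hasMFDerivAt
  have h1 : HasMFDerivAt 𝓘(ℝ, ℂ) 𝓘(ℝ, ℂ) (Complex.conjCLE : ℂ → ℂ) (f x b a)
      ((Complex.conjCLE : ℂ ≃L[ℝ] ℂ) : ℂ →L[ℝ] ℂ) :=
    (Complex.conjCLE : ℂ ≃L[ℝ] ℂ).hasFDerivAt.hasMFDerivAt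
  exact congrArg (fun L => (L v : ℂ)) (h1.comp x h).mfderiv

lemma dMat_mul {f g : M → Mat m} {s : Set M} (hf : SmoothMatOn I f s) (hg : SmoothMatOn I g s)
    (hs : IsOpen s) {x : M} (hx : x ∈ s) (v : TangentSpace I x) :
    dMat I (fun y => f y * g y) x v = dMat I f x v * g x + f x * dMat I g x v := by
  ext a b
  let F : Fin m → TangentSpace I x →L[ℝ] ℂ := fun c => mfderiv I 𝓘(ℝ, ℂ) (fun y => f y a c) x
  let G : Fin m → TangentSpace I x →L[ℝ] ℂ := fun c => mfderiv I 𝓘(ℝ, ℂ) (fun y => g y c b) x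
  have h : HasMFDerivAt I 𝓘(ℝ, ℂ) (∑ c, (fun y => f y a c) * (fun y => g y c b)) x
      (∑ c, (f x a c • G c + g x c b • F c)) :=
    HasMFDerivAt.sum (I := I) (z := x) (t := Finset.univ)
      (f := fun c : Fin m => (fun y => f y a c) * (fun y => g y c b))
      (fun c _ => ((hf.mdiff hs hx a c).hasMFDerivAt).mul ((hg.mdiff hs hx c b).hasMFDerivAt))
  have e : (fun y => (f y * g y) a b) = ∑ c, (fun y => f y a c) * (fun y => g y c b) := by
    ext y; simp [Matrix.mul_apply]
  have h2 : (mfderiv I 𝓘(ℝ, ℂ) (fun y => (f y * g y) a b) x v : ℂ) =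
      (∑ c, (f x a c • G c + g x c b • F c)) v := by
    rw [e]; exact congrArg (fun L : TangentSpace I x →L[ℝ] ℂ => L v) h.mfderiv
  refine h2.trans ?_
  have h3 : (dMat I f x v * g x + f x * dMat I g x v) a b =
      ∑ c, (F c v * g x c b + f x a c * G c v) := by
    simp only [Matrix.add_apply, Matrix.mul_apply, Finset.sum_add_distrib]; rfl
  rw [h3, _root_.sum_apply]
  refine Finset.sum_congr rfl fun c _ => ?_
  refine (add_comm _ _).trans ?_
  exact congrArg (· + f x a c * G c v) (mul_comm (g x c b) (F c v))

lemma SmoothMatOn.dMat [IsManifold I ∞ M] {f : M → Mat m} {s : Set M} (hf : SmoothMatOn I f s)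
    (hs : IsOpen s) : SmoothFormOn I (dMat I f) s := by
  intro a b
  have h := (hf a b).contMDiffOn_tangentMapWithin (m := ∞) (by simp) hs.uniqueMDiffOn
  have h2 := (contMDiff_snd_tangentBundle_modelSpace ℂ 𝓘(ℝ, ℂ) (n := ∞)).comp_contMDiffOn h
  refine h2.congr fun p hp => ?_
  change (mfderiv I 𝓘(ℝ, ℂ) (fun y => f y a b) p.proj p.snd : ℂ) =
    (mfderivWithin I 𝓘(ℝ, ℂ) (fun y => f y a b) s p.proj p.snd : ℂ)
  rw [mfderivWithin_of_mem_nhds (hs.mem_nhds hp)]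

lemma SmoothMatOn.comp_proj [IsManifold I ∞ M] {f : M → Mat m} {s : Set M}
    (hf : SmoothMatOn I f s) (a b : Fin m) :
    ContMDiffOn I.tangent 𝓘(ℝ, ℂ) ∞ (fun p : TangentBundle I M => f p.proj a b)
      (Bundle.TotalSpace.proj ⁻¹' s) :=
  (hf a b).comp (Bundle.contMDiff_proj (TangentSpace I)).contMDiffOn fun _ h => h

variable {E' H' N : Type*} [NormedAddCommGroup E'] [NormedSpace ℝ E'] [TopologicalSpace H']
  [TopologicalSpace N] [ChartedSpace H' N] {J : ModelWithCorners ℝ E' H'}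

lemma SmoothMatOn.comp {f : M → Mat m} {s : Set M} (hf : SmoothMatOn I f s) {k : N → M}
    (hk : ContMDiff J I ∞ k) : SmoothMatOn J (fun y => f (k y)) (k ⁻¹' s) := fun a b =>
  (hf a b).comp hk.contMDiffOn fun _ h => h

lemma dMat_comp {f : M → Mat m} {s : Set M} (hf : SmoothMatOn I f s) (hs : IsOpen s) {k : N → M}
    (hk : ContMDiff J I ∞ k) {y : N} (hy : k y ∈ s) (v : TangentSpace J y) :
    dMat J (fun y => f (k y)) y v = dMat I f (k y) (mfderiv J I k y v) := by
  ext a b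
  exact congrArg (fun L => (L v : ℂ))
    (mfderiv_comp y (hf.mdiff hs hy a b) (hk.mdifferentiableAt (by simp)))

/-- Pull-back of a matrix-valued linear form along `k` at the point `y`. -/
def pullForm (J : ModelWithCorners ℝ E' H') (I : ModelWithCorners ℝ E H) (k : N → M) (y : N)
    (α : TangentSpace I (k y) →ₗ[ℝ] Mat m) : TangentSpace J y →ₗ[ℝ] Mat m :=
  α ∘ₗ (mfderiv J I k y : TangentSpace J y →ₗ[ℝ] TangentSpace I (k y))

/-- The local formula for the action of a gauge on a connection form: if `w` is the local expression
of a unitary gauge and `α` the local connection form at `x`, this is `w⁻¹ α w + w⁻¹ dw` at `x`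
(with `w⁻¹ = w*`). -/
def gaugeForm (I : ModelWithCorners ℝ E H) (w : M → Mat m) (x : M)
    (α : TangentSpace I x →ₗ[ℝ] Mat m) : TangentSpace I x →ₗ[ℝ] Mat m :=
  LinearMap.mulLeft ℝ (star (w x)) ∘ₗ (LinearMap.mulRight ℝ (w x) ∘ₗ α + dMat I w x)

lemma gaugeForm_apply (w : M → Mat m) (x : M) (α : TangentSpace I x →ₗ[ℝ] Mat m)
    (v : TangentSpace I x) :
    gaugeForm I w x α v = star (w x) * (α v * w x + dMat I w x v) := rfl

end MatrixCalculus

/-- A smooth Hermitian vector bundle of rank `m` (a `U(m)`-bundle) over the manifold `M`, given by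
its defining trivializations over the open sets `baseSet i` and the `U(m)`-valued transition
functions between them. As in Mathlib's `VectorBundleCore`, a trivialization
`indexAt x` is singled out at each point `x`; it is used to identify the fibre at `x` with `ℂ^m`. -/
structure UnitaryBundle {E H : Type*} [NormedAddCommGroup E] [NormedSpace ℝ E]
    [TopologicalSpace H] (I : ModelWithCorners ℝ E H) (M : Type*) [TopologicalSpace M]
    [ChartedSpace H M] (m : ℕ) (ι : Type*) where
  baseSet : ι → Set M
  isOpen_baseSet : ∀ i, IsOpen (baseSet i)
  indexAt : M → ι
  mem_baseSet_at : ∀ x, x ∈ baseSet (indexAt x)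
  /-- `transition i j x` maps `j`-coordinates to `i`-coordinates. -/
  transition : ι → ι → M → Mat m
  transition_unitary : ∀ i j, ∀ x ∈ baseSet i ∩ baseSet j,
    transition i j x ∈ Matrix.unitaryGroup (Fin m) ℂ
  transition_smooth : ∀ i j, SmoothMatOn I (transition i j) (baseSet i ∩ baseSet j)
  transition_self : ∀ i, ∀ x ∈ baseSet i, transition i i x = 1
  transition_comp : ∀ i j k, ∀ x ∈ baseSet i ∩ baseSet j ∩ baseSet k,
    transition i j x * transition j k x = transition i k x

namespace UnitaryBundle

variable {E H M : Type*} [NormedAddCommGroup E] [NormedSpace ℝ E] [TopologicalSpace H]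
  [TopologicalSpace M] [ChartedSpace H M] {I : ModelWithCorners ℝ E H} {m : ℕ} {ι : Type*}
  {E' H' N : Type*} [NormedAddCommGroup E'] [NormedSpace ℝ E'] [TopologicalSpace H']
  [TopologicalSpace N] [ChartedSpace H' N] {J : ModelWithCorners ℝ E' H'}

/-- The pull-back bundle. -/
def pullback (P : UnitaryBundle I M m ι) (k : N → M) (hk : ContMDiff J I ∞ k) :
    UnitaryBundle J N m ι where
  baseSet i := k ⁻¹' P.baseSet i
  isOpen_baseSet i := (P.isOpen_baseSet i).preimage hk.continuous
  indexAt y := P.indexAt (k y)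
  mem_baseSet_at y := P.mem_baseSet_at (k y)
  transition i j y := P.transition i j (k y)
  transition_unitary i j y hy := P.transition_unitary i j (k y) hy
  transition_smooth i j := (P.transition_smooth i j).comp hk
  transition_self i y hy := P.transition_self i (k y) hy
  transition_comp i j l y hy := P.transition_comp i j l (k y) hy

section Sections

variable (P : UnitaryBundle I M m ι)

/-- A section `s` of `End E` is given at each point `x` by its matrix in the trivialization
`indexAt x`; this is its local expression in the trivialization `i`. -/
def rep (i : ι) (s : M → Mat m) (x : M) : Mat m :=
  P.transition i (P.indexAt x) x * s x * P.transition (P.indexAt x) i x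

/-- Smoothness on `S` of a section of `End E`: all local expressions are smooth. -/
def SmoothSectionOn (s : M → Mat m) (S : Set M) : Prop :=
  ∀ i, SmoothMatOn I (P.rep i s) (P.baseSet i ∩ S)

variable {P}

lemma trans_mul {i j : ι} {x : M} (hi : x ∈ P.baseSet i) (hj : x ∈ P.baseSet j) :
    P.transition i j x * P.transition j i x = 1 := by
  rw [P.transition_comp i j i x ⟨⟨hi, hj⟩, hi⟩, P.transition_self i x hi]

lemma star_trans {i j : ι} {x : M} (hi : x ∈ P.baseSet i) (hj : x ∈ P.baseSet j) :
    star (P.transition i j x) = P.transition j i x := by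
  have h := Matrix.mem_unitaryGroup_iff'.1 (P.transition_unitary i j x ⟨hi, hj⟩)
  calc star (P.transition i j x)
      = star (P.transition i j x) * (P.transition i j x * P.transition j i x) := by
        rw [trans_mul hi hj, mul_one]
    _ = P.transition j i x := by rw [← mul_assoc, h, one_mul]

lemma rep_one {i : ι} {x : M} (hx : x ∈ P.baseSet i) : P.rep i (fun _ => 1) x = 1 := by
  rw [rep, mul_one, trans_mul hx (P.mem_baseSet_at x)]

lemma rep_mul {i : ι} {x : M} (hx : x ∈ P.baseSet i) (s t : M → Mat m) :
    P.rep i (fun x => s x * t x) x = P.rep i s x * P.rep i t x := by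
  have h := trans_mul (P := P) (P.mem_baseSet_at x) hx
  simp only [rep]
  calc _ = P.transition i (P.indexAt x) x * s x * 1 * t x * P.transition (P.indexAt x) i x := by
        noncomm_ring
    _ = _ := by rw [← h]; noncomm_ring

lemma rep_star {i : ι} {x : M} (hx : x ∈ P.baseSet i) (s : M → Mat m) :
    P.rep i (fun x => star (s x)) x = star (P.rep i s x) := by
  simp only [rep, star_mul, star_trans hx (P.mem_baseSet_at x),
    star_trans (P.mem_baseSet_at x) hx, mul_assoc]

lemma rep_change {i j : ι} {x : M} (hi : x ∈ P.baseSet i) (hj : x ∈ P.baseSet j)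
    (s : M → Mat m) :
    P.rep j s x = P.transition j i x * P.rep i s x * P.transition i j x := by
  have h1 := P.transition_comp j i (P.indexAt x) x ⟨⟨hj, hi⟩, P.mem_baseSet_at x⟩
  have h2 := P.transition_comp (P.indexAt x) i j x ⟨⟨P.mem_baseSet_at x, hi⟩, hj⟩
  simp only [rep, ← h1, ← h2, mul_assoc]

lemma rep_self (s : M → Mat m) (x : M) : P.rep (P.indexAt x) s x = s x := by
  simp [rep, P.transition_self _ x (P.mem_baseSet_at x)]

variable (P) in
/-- The group `𝔊` of smooth `U(m)`-gauges: smooth unitary sections of `End E`. -/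
def gaugeGroup : Subgroup (M → Matrix.unitaryGroup (Fin m) ℂ) where
  carrier := {φ | P.SmoothSectionOn (fun x => (φ x : Mat m)) Set.univ}
  one_mem' _ := (smoothMatOn_const 1 _).congr fun _ hx => rep_one hx.1
  mul_mem' hφ hψ i := ((hφ i).mul (hψ i)).congr fun _ hx => rep_mul hx.1 _ _
  inv_mem' hφ i := (hφ i).star.congr fun _ hx => rep_star hx.1 _

/-- The section of `End E` underlying a gauge. -/
def val (φ : P.gaugeGroup) (x : M) : Mat m := (φ.1 x : Mat m)

/-- The local expression of a gauge. -/
def lrep (φ : P.gaugeGroup) (i : ι) : M → Mat m := P.rep i (val φ)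

lemma lrep_smooth (φ : P.gaugeGroup) (i : ι) : SmoothMatOn I (lrep φ i) (P.baseSet i) := by
  exact (φ.2 i).mono fun x hx => ⟨hx, trivial⟩

lemma lrep_one {i : ι} {x : M} (hx : x ∈ P.baseSet i) : lrep (1 : P.gaugeGroup) i x = 1 :=
  rep_one hx

lemma lrep_mul {i : ι} {x : M} (hx : x ∈ P.baseSet i) (φ ψ : P.gaugeGroup) :
    lrep (φ * ψ) i x = lrep φ i x * lrep ψ i x := rep_mul hx _ _

lemma lrep_inv {i : ι} {x : M} (hx : x ∈ P.baseSet i) (φ : P.gaugeGroup) :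
    lrep φ⁻¹ i x = star (lrep φ i x) := rep_star hx _

lemma star_mul_lrep {i : ι} {x : M} (hx : x ∈ P.baseSet i) (φ : P.gaugeGroup) :
    star (lrep φ i x) * lrep φ i x = 1 := by
  rw [← lrep_inv hx, ← lrep_mul hx, inv_mul_cancel, lrep_one hx]

lemma mul_star_lrep {i : ι} {x : M} (hx : x ∈ P.baseSet i) (φ : P.gaugeGroup) :
    lrep φ i x * star (lrep φ i x) = 1 := by
  rw [← lrep_inv hx, ← lrep_mul hx, mul_inv_cancel, lrep_one hx]

end Sections

/-- A smooth unitary connection on the bundle: a family of smooth `𝔲(m)`-valued local connection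
`1`-forms `A_i` on the sets `baseSet i` (extended by zero, so that a connection is determined by
its local forms) with `A_j = g_{ij}⁻¹ A_i g_{ij} + g_{ij}⁻¹ dg_{ij}` on overlaps. -/
@[ext]
structure Connection [IsManifold I ∞ M] (P : UnitaryBundle I M m ι) where
  form : ι → ∀ x : M, TangentSpace I x →ₗ[ℝ] Mat m
  form_off : ∀ i, ∀ x ∉ P.baseSet i, form i x = 0
  skew : ∀ i x v, star (form i x v) = - form i x v
  smooth : ∀ i, SmoothFormOn I (form i) (P.baseSet i)
  compat : ∀ i j, ∀ x ∈ P.baseSet i ∩ P.baseSet j, ∀ v,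
    form j x v = P.transition j i x * form i x v * P.transition i j x
      + P.transition j i x * dMat I (P.transition i j) x v

variable [IsManifold I ∞ M] [IsManifold J ∞ N] {P : UnitaryBundle I M m ι}

namespace Connection

open scoped Classical in
/-- The gauge action `φ(A) = A + φ⁻¹ d_A φ`; in each trivialization it is `φ⁻¹ A φ + φ⁻¹ dφ`. -/
def act (A : Connection P) (φ : P.gaugeGroup) : Connection P where
  form i x := if x ∈ P.baseSet i then gaugeForm I (lrep φ i) x (A.form i x) else 0
  form_off i x hx := if_neg hx
  skew i x v := by
    split_ifs with hx
    · have h0 : dMat I (fun y => star (lrep φ i y) * lrep φ i y) x v = 0 := by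
        rw [dMat_congr (g := fun _ => 1) (P.isOpen_baseSet i)
          (fun y hy => star_mul_lrep hy φ) hx, dMat_const]
      rw [dMat_mul (lrep_smooth φ i).star (lrep_smooth φ i) (P.isOpen_baseSet i) hx,
        dMat_star (lrep_smooth φ i) (P.isOpen_baseSet i) hx] at h0
      rw [gaugeForm_apply, star_mul, star_star, star_add, star_mul, A.skew, add_mul,
        eq_neg_of_add_eq_zero_left h0]
      noncomm_ring
    · simp
  smooth i := by
    have hw := lrep_smooth φ i
    have key := mul_contMDiffOn_aux (I := I.tangent) (hw.star.comp_proj)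
      (g := fun p : TangentBundle I M => A.form i p.proj p.snd * lrep φ i p.proj
        + dMat I (lrep φ i) p.proj p.snd)
      (fun a b => (mul_contMDiffOn_aux (I := I.tangent) (A.smooth i) hw.comp_proj a b).add
        (hw.dMat (P.isOpen_baseSet i) a b))
    intro a b
    refine (key a b).congr fun p hp => ?_
    have e : (if p.proj ∈ P.baseSet i then gaugeForm I (lrep φ i) p.proj (A.form i p.proj) else 0)
      = gaugeForm I (lrep φ i) p.proj (A.form i p.proj) := if_pos hp
    exact congrArg (fun L => L p.snd a b) e
  compat i j x hx v := by
    obtain ⟨hi, hj⟩ := hx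
    rw [if_pos hi, if_pos hj, gaugeForm_apply, gaugeForm_apply]
    set O := P.baseSet i ∩ P.baseSet j with hO
    have hOo : IsOpen O := (P.isOpen_baseSet i).inter (P.isOpen_baseSet j)
    have hk : SmoothMatOn I (P.transition i j) O := P.transition_smooth i j
    have hh : SmoothMatOn I (P.transition j i) O :=
      (P.transition_smooth j i).mono (by rw [hO, Set.inter_comm])
    have hw : SmoothMatOn I (lrep φ i) O := (lrep_smooth φ i).mono Set.inter_subset_left
    have hd : dMat I (lrep φ j) x v =
        (dMat I (P.transition j i) x v * lrep φ i x + P.transition j i x * dMat I (lrep φ i) x v)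
          * P.transition i j x
        + P.transition j i x * lrep φ i x * dMat I (P.transition i j) x v := by
      rw [dMat_congr (f := lrep φ j) (g := fun y => P.transition j i y * lrep φ i y * P.transition i j y) hOo
        (fun y hy => (rep_change hy.1 hy.2 (val φ) : lrep φ j y = _)) (show x ∈ O from ⟨hi, hj⟩),
        dMat_mul (hh.mul hw) hk hOo ⟨hi, hj⟩, dMat_mul hh hw hOo ⟨hi, hj⟩]
    have h0 : dMat I (P.transition i j) x v * P.transition j i x
        + P.transition i j x * dMat I (P.transition j i) x v = 0 := by
      rw [← dMat_mul hk hh hOo (show x ∈ O from ⟨hi, hj⟩),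
        dMat_congr (g := fun _ => 1) hOo (fun y hy => trans_mul hy.1 hy.2)
          (show x ∈ O from ⟨hi, hj⟩), dMat_const]
    have hwj : lrep φ j x = P.transition j i x * lrep φ i x * P.transition i j x :=
      rep_change hi hj _
    have hs : star (lrep φ j x) =
        P.transition j i x * star (lrep φ i x) * P.transition i j x := by
      rw [hwj, star_mul, star_mul, star_trans hi hj, star_trans hj hi, mul_assoc]
    rw [hd, hs, hwj, A.compat i j x ⟨hi, hj⟩]
    have h1 : P.transition i j x * P.transition j i x = 1 := trans_mul hi hj
    have h2 : star (lrep φ i x) * lrep φ i x = 1 := star_mul_lrep hi φ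
    generalize P.transition i j x = k at *
    generalize P.transition j i x = h at *
    generalize lrep φ i x = w at *
    generalize dMat I (P.transition i j) x v = dk at *
    generalize dMat I (P.transition j i) x v = dh at *
    generalize dMat I (lrep φ i) x v = dw at *
    generalize A.form i x v = α at *
    calc _ = h * star w * (k * h) * α * (k * h) * w * k
            + h * star w * (k * h) * dk * h * w * k + h * star w * (k * dh) * w * k
            + h * star w * (k * h) * dw * k + h * star w * (k * h) * w * dk := by noncomm_ring
      _ = h * star w * α * w * k + h * star w * (dk * h + k * dh) * w * k
            + h * star w * dw * k + h * (star w * w) * dk := by rw [h1]; noncomm_ring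
      _ = _ := by rw [h0, h2]; noncomm_ring

lemma act_form (A : Connection P) (φ : P.gaugeGroup) {i : ι} {x : M} (hx : x ∈ P.baseSet i) :
    (A.act φ).form i x = gaugeForm I (lrep φ i) x (A.form i x) := if_pos hx

lemma ext_on {A B : Connection P}
    (h : ∀ i, ∀ x ∈ P.baseSet i, ∀ v, A.form i x v = B.form i x v) : A = B := by
  ext i x v : 4
  by_cases hx : x ∈ P.baseSet i
  · exact h i x hx v
  · rw [A.form_off i x hx, B.form_off i x hx]

lemma act_one (A : Connection P) : A.act 1 = A := by
  refine ext_on fun i x hx v => ?_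
  rw [act_form _ _ hx, gaugeForm_apply, lrep_one hx,
    dMat_congr (g := fun _ => 1) (P.isOpen_baseSet i) (fun y hy => lrep_one hy) hx, dMat_const]
  simp

/-- The gauge action is a right action. -/
lemma act_act (A : Connection P) (φ ψ : P.gaugeGroup) : (A.act φ).act ψ = A.act (φ * ψ) := by
  refine ext_on fun i x hx v => ?_
  rw [act_form _ _ hx, act_form _ _ hx, gaugeForm_apply, gaugeForm_apply, act_form _ _ hx,
    gaugeForm_apply, lrep_mul hx,
    dMat_congr (P.isOpen_baseSet i) (fun y hy => lrep_mul hy φ ψ) hx,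
    dMat_mul (lrep_smooth φ i) (lrep_smooth ψ i) (P.isOpen_baseSet i) hx, star_mul]
  have h := star_mul_lrep hx φ
  calc _ = star (lrep ψ i x) * (star (lrep φ i x) * (A.form i x v * lrep φ i x
            + dMat I (lrep φ i) x v) * lrep ψ i x + 1 * dMat I (lrep ψ i) x v) := by
          noncomm_ring
    _ = _ := by rw [← h]; noncomm_ring

/-- The pull-back of a connection to the pull-back bundle. -/
def pullback (A : Connection P) (k : N → M) (hk : ContMDiff J I ∞ k) :
    Connection (P.pullback k hk) where
  form i y := pullForm J I k y (A.form i (k y))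
  form_off i y hy := by rw [A.form_off i (k y) hy]; rfl
  skew i y v := A.skew i (k y) _
  smooth i a b := by
    have h := (hk.contMDiff_tangentMap (m := ∞) (by simp)).contMDiffOn
      (s := Bundle.TotalSpace.proj ⁻¹' (k ⁻¹' P.baseSet i))
    exact (A.smooth i a b).comp h fun p hp => hp
  compat i j y hy v := by
    have h := A.compat i j (k y) hy (mfderiv J I k y v)
    refine h.trans ?_
    congr 2
    exact (dMat_comp (P.transition_smooth i j)
      ((P.isOpen_baseSet i).inter (P.isOpen_baseSet j)) hk hy v).symm

/-- The pull-back of a gauge. -/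
def _root_.UnitaryBundle.pullGauge (φ : P.gaugeGroup) (k : N → M) (hk : ContMDiff J I ∞ k) :
    (P.pullback k hk).gaugeGroup :=
  ⟨fun y => φ.1 (k y), fun i => (φ.2 i).comp hk⟩

lemma pullback_act (A : Connection P) (φ : P.gaugeGroup) (k : N → M) (hk : ContMDiff J I ∞ k) :
    (A.act φ).pullback k hk = (A.pullback k hk).act (pullGauge φ k hk) := by
  refine ext_on fun i y hy v => ?_
  have hy' : k y ∈ P.baseSet i := hy
  rw [act_form _ _ hy, gaugeForm_apply]
  change (A.act φ).form i (k y) (mfderiv J I k y v) = _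
  rw [act_form _ _ hy', gaugeForm_apply, ← dMat_comp (lrep_smooth φ i) (P.isOpen_baseSet i) hk hy']
  rfl

/-- The covariant derivative `d_A s` of a section `s` of `End E`, in the trivialization `i`:
`ds + [A_i, s]`. -/
def covD (A : Connection P) (s : M → Mat m) (i : ι) (x : M) (v : TangentSpace I x) : Mat m :=
  dMat I (P.rep i s) x v + (A.form i x v * P.rep i s x - P.rep i s x * A.form i x v)

/-- The stabilizer group `Γ_A = {φ ∈ 𝔊 | d_A φ = 0}`. -/
def stabilizer (A : Connection P) : Subgroup P.gaugeGroup where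
  carrier := {φ | ∀ i, ∀ x ∈ P.baseSet i, ∀ v, A.covD (val φ) i x v = 0}
  one_mem' i x hx v := by
    change dMat I (lrep (1 : P.gaugeGroup) i) x v + (A.form i x v * lrep (1 : P.gaugeGroup) i x
      - lrep (1 : P.gaugeGroup) i x * A.form i x v) = 0
    rw [dMat_congr (g := fun _ => 1) (P.isOpen_baseSet i) (fun y hy => lrep_one hy) hx,
      dMat_const, lrep_one hx]
    simp
  mul_mem' {φ ψ} hφ hψ i x hx v := by
    have h1 : dMat I (lrep φ i) x v + (A.form i x v * lrep φ i x - lrep φ i x * A.form i x v) = 0 :=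
      hφ i x hx v
    have h2 : dMat I (lrep ψ i) x v + (A.form i x v * lrep ψ i x - lrep ψ i x * A.form i x v) = 0 :=
      hψ i x hx v
    change dMat I (lrep (φ * ψ) i) x v + (A.form i x v * lrep (φ * ψ) i x
      - lrep (φ * ψ) i x * A.form i x v) = 0
    rw [dMat_congr (P.isOpen_baseSet i) (fun y hy => lrep_mul hy φ ψ) hx,
      dMat_mul (lrep_smooth φ i) (lrep_smooth ψ i) (P.isOpen_baseSet i) hx, lrep_mul hx,
      eq_neg_of_add_eq_zero_left h1, eq_neg_of_add_eq_zero_left h2]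
    noncomm_ring
  inv_mem' {φ} hφ i x hx v := by
    have h1 : dMat I (lrep φ i) x v + (A.form i x v * lrep φ i x - lrep φ i x * A.form i x v) = 0 :=
      hφ i x hx v
    change dMat I (lrep φ⁻¹ i) x v + (A.form i x v * lrep φ⁻¹ i x
      - lrep φ⁻¹ i x * A.form i x v) = 0
    rw [dMat_congr (P.isOpen_baseSet i) (fun y hy => lrep_inv hy φ) hx,
      dMat_star (lrep_smooth φ i) (P.isOpen_baseSet i) hx, lrep_inv hx,
      eq_neg_of_add_eq_zero_left h1]
    simp only [star_neg, star_sub, star_mul, A.skew]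
    noncomm_ring

/-- `A` is irreducible if `Γ_A = Center(U(m))`, i.e. if `Γ_A` consists exactly of the gauges which
are a constant central element of `U(m)`. -/
def Irreducible (A : Connection P) : Prop :=
  ∀ φ : P.gaugeGroup, φ ∈ A.stabilizer ↔
    ∃ c ∈ Subgroup.center (Matrix.unitaryGroup (Fin m) ℂ), ∀ x, φ.1 x = c

/-- Gauge equivalence of connections. -/
instance gaugeSetoid (P : UnitaryBundle I M m ι) : Setoid (Connection P) where
  r A B := ∃ φ : P.gaugeGroup, B = A.act φ
  iseqv :=
    { refl := fun A => ⟨1, A.act_one.symm⟩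
      symm := by
        rintro A B ⟨φ, rfl⟩
        exact ⟨φ⁻¹, by rw [act_act, mul_inv_cancel, act_one]⟩
      trans := by
        rintro A B C ⟨φ, rfl⟩ ⟨ψ, rfl⟩
        exact ⟨φ * ψ, A.act_act φ ψ⟩ }

end Connection

/-! ### Norms and distances -/

/-- The square of the standard (Frobenius) norm of a complex matrix. -/
def frobSq (a : Mat m) : ℝ := ∑ i, ∑ j, ‖a i j‖ ^ 2

lemma frobSq_eq_trace (a : Mat m) : (frobSq a : ℂ) = (star a * a).trace := by
  simp only [frobSq, Matrix.trace, Matrix.diag, Matrix.mul_apply, Matrix.star_apply]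
  rw [Finset.sum_comm]
  push_cast
  refine Finset.sum_congr rfl fun i _ => Finset.sum_congr rfl fun j _ => ?_
  rw [← Complex.conj_mul' (a j i)]; rfl

lemma frobSq_conj {a w : Mat m} (h : w * star w = 1) :
    frobSq (star w * a * w) = frobSq a := by
  have e : (frobSq (star w * a * w) : ℂ) = frobSq a := by
    rw [frobSq_eq_trace, frobSq_eq_trace]
    calc _ = (star w * (star a * (w * star w) * a * w)).trace := by
          congr 1; simp only [star_mul, star_star]; noncomm_ring
      _ = (star a * (w * star w) * a * (w * star w)).trace := by
          rw [Matrix.trace_mul_comm]; congr 1; noncomm_ring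
      _ = _ := by rw [h, mul_one, mul_one]
  exact_mod_cast e

lemma frobSq_neg (a : Mat m) : frobSq (-a) = frobSq a := by simp [frobSq]

lemma frobSq_zero : frobSq (0 : Mat m) = 0 := by simp [frobSq]

lemma sqrt_frobSq_add {k : ℕ} (a b : Fin k → Mat m) :
    √(∑ c, frobSq (a c + b c)) ≤ √(∑ c, frobSq (a c)) + √(∑ c, frobSq (b c)) := by
  have key : ∀ d : Fin k → Mat m, √(∑ c, frobSq (d c)) =
      ‖(WithLp.toLp 2 fun p : Fin k × Fin m × Fin m => d p.1 p.2.1 p.2.2 :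
        EuclideanSpace ℂ (Fin k × Fin m × Fin m))‖ := by
    intro d
    rw [EuclideanSpace.norm_eq]
    simp [frobSq, Fintype.sum_prod_type]
  rw [key, key, key]
  exact norm_add_le (WithLp.toLp 2 fun p : Fin k × Fin m × Fin m => a p.1 p.2.1 p.2.2 :
    EuclideanSpace ℂ (Fin k × Fin m × Fin m)) (WithLp.toLp 2 fun p => b p.1 p.2.1 p.2.2)

/-- The norm of a matrix-valued linear form `α` on `T_xM` induced by the standard norm on matrices
and the inner product `h x` on `T_xM`: it is `(∑_c |α(e_c)|²)^{1/2}` for any orthonormal frame `e`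
of `T_xM` (all frames give the same value, so that the supremum below is this value). -/
def formNorm (h : ∀ x : M, TangentSpace I x → TangentSpace I x → ℝ) (x : M)
    (α : TangentSpace I x →ₗ[ℝ] Mat m) : ℝ≥0∞ :=
  ⨆ (e : Fin (Module.finrank ℝ E) → TangentSpace I x)
    (_ : ∀ c d, h x (e c) (e d) = if c = d then 1 else 0),
    ENNReal.ofReal √(∑ c, frobSq (α (e c)))

variable (h : ∀ x : M, TangentSpace I x → TangentSpace I x → ℝ)

lemma formNorm_congr {x : M} {α β : TangentSpace I x →ₗ[ℝ] Mat m}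
    (H : ∀ v, frobSq (α v) = frobSq (β v)) : formNorm h x α = formNorm h x β := by
  simp only [formNorm, H]

lemma formNorm_add_le {x : M} (α β : TangentSpace I x →ₗ[ℝ] Mat m) :
    formNorm h x (α + β) ≤ formNorm h x α + formNorm h x β := by
  refine iSup₂_le fun e he => ?_
  have h1 : ∀ γ : TangentSpace I x →ₗ[ℝ] Mat m,
      ENNReal.ofReal √(∑ c, frobSq (γ (e c))) ≤ formNorm h x γ := fun γ => by
    rw [formNorm]; exact le_iSup₂_of_le e he le_rfl
  refine le_trans ?_ (add_le_add (h1 α) (h1 β))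
  rw [← ENNReal.ofReal_add (Real.sqrt_nonneg _) (Real.sqrt_nonneg _)]
  exact ENNReal.ofReal_le_ofReal (sqrt_frobSq_add (fun c => α (e c)) (fun c => β (e c)))

namespace Connection

/-- `‖A - B‖ = sup_x |A - B|` for two connections, measured in the metric `h`. As the difference
`A - B` is an `ad E`-valued form, its norm at `x` does not depend on the trivialization. (On a
compact manifold with a Riemannian metric the supremum is finite.) -/
def supDist (A B : Connection P) : ℝ≥0∞ :=
  ⨆ x, formNorm h x (A.form (P.indexAt x) x - B.form (P.indexAt x) x)

lemma supDist_self (A : Connection P) : supDist h A A = 0 := by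
  simp [supDist, formNorm, frobSq_zero]

lemma supDist_comm (A B : Connection P) : supDist h A B = supDist h B A := by
  refine iSup_congr fun x => formNorm_congr h fun v => ?_
  rw [← frobSq_neg, LinearMap.sub_apply, LinearMap.sub_apply, neg_sub]

lemma supDist_triangle (A B C : Connection P) :
    supDist h A C ≤ supDist h A B + supDist h B C := by
  refine iSup_le fun x => ?_
  rw [← sub_add_sub_cancel _ (B.form (P.indexAt x) x)]
  exact (formNorm_add_le h _ _).trans (add_le_add
    (le_iSup (fun x => formNorm h x (A.form (P.indexAt x) x - B.form (P.indexAt x) x)) x)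
    (le_iSup (fun x => formNorm h x (B.form (P.indexAt x) x - C.form (P.indexAt x) x)) x))

lemma supDist_act (A B : Connection P) (φ : P.gaugeGroup) :
    supDist h (A.act φ) (B.act φ) = supDist h A B := by
  refine iSup_congr fun x => formNorm_congr h fun v => ?_
  have hx := P.mem_baseSet_at x
  rw [← frobSq_conj (a := (A.form (P.indexAt x) x - B.form (P.indexAt x) x) v)
      (mul_star_lrep hx φ), act_form _ _ hx, act_form _ _ hx, LinearMap.sub_apply,
    LinearMap.sub_apply, gaugeForm_apply, gaugeForm_apply]
  congr 1
  noncomm_ring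

/-- `inf_φ ‖A - φ(B)‖` over all gauges `φ`. -/
def gaugeDist (A B : Connection P) : ℝ≥0∞ := ⨅ φ : P.gaugeGroup, supDist h A (B.act φ)

lemma gaugeDist_comm (A B : Connection P) : gaugeDist h A B = gaugeDist h B A := by
  have key : ∀ A B : Connection P, gaugeDist h A B ≤ gaugeDist h B A := fun A B =>
    le_iInf fun φ => (iInf_le _ φ⁻¹).trans_eq <| by
      rw [← supDist_act h A (B.act φ⁻¹) φ, act_act, inv_mul_cancel, act_one, supDist_comm]
  exact le_antisymm (key A B) (key B A)

lemma gaugeDist_triangle (A B C : Connection P) :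
    gaugeDist h A C ≤ gaugeDist h A B + gaugeDist h B C := by
  simp only [gaugeDist]
  rw [ENNReal.iInf_add]
  refine le_iInf fun φ => ?_
  rw [ENNReal.add_iInf]
  refine le_iInf fun ψ => (iInf_le _ (ψ * φ)).trans ?_
  rw [← act_act, ← supDist_act h B (C.act ψ) φ]
  exact supDist_triangle h _ _ _

lemma gaugeDist_act_right (A B : Connection P) (φ : P.gaugeGroup) :
    gaugeDist h A (B.act φ) = gaugeDist h A B := by
  simp only [gaugeDist, act_act]
  exact (Equiv.mulLeft φ).iInf_congr fun _ => rfl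

end Connection

/-- The space `Λ_{E,M}` of gauge equivalence classes of smooth `U(m)`-connections; `h` is the
metric of `M`, which is used to measure distances in it. -/
def Moduli (P : UnitaryBundle I M m ι)
    (_h : ∀ x : M, TangentSpace I x → TangentSpace I x → ℝ) :=
  Quotient (Connection.gaugeSetoid P)

/-- The gauge equivalence class `[A]`. -/
def Connection.cls (A : Connection P) : Moduli P h := Quotient.mk _ A

/-- The distance `d([A], [B]) = inf_φ ‖A - φ(B)‖` on the space of gauge equivalence classes; all
topological statements about this space refer to the topology of this distance. -/
instance (P : UnitaryBundle I M m ι) (h : ∀ x : M, TangentSpace I x → TangentSpace I x → ℝ) :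
    PseudoEMetricSpace (Moduli P h) where
  edist := Quotient.lift₂ (Connection.gaugeDist h) (by
    rintro A B _ _ ⟨φ, rfl⟩ ⟨ψ, rfl⟩
    rw [Connection.gaugeDist_act_right, Connection.gaugeDist_comm,
      Connection.gaugeDist_comm h (A.act φ), Connection.gaugeDist_act_right])
  edist_self := by
    rintro ⟨A⟩
    refine le_antisymm ((iInf_le _ 1).trans_eq ?_) zero_le
    rw [Connection.act_one, Connection.supDist_self]
  edist_comm := by
    rintro ⟨A⟩ ⟨B⟩
    exact Connection.gaugeDist_comm h A B
  edist_triangle := by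
    rintro ⟨A⟩ ⟨B⟩ ⟨C⟩
    exact Connection.gaugeDist_triangle h A B C

/-- The subset `Λ^{irred}` of irreducible classes. -/
def irredModuli (P : UnitaryBundle I M m ι)
    (h : ∀ x : M, TangentSpace I x → TangentSpace I x → ℝ) : Set (Moduli P h) :=
  {x | ∃ A : Connection P, A.Irreducible ∧ A.cls h = x}

/-! ### Conjugacy classes of groups of gauges -/

/-- `‖a - b‖ = sup_x |a(x) - b(x)|` for gauges `a`, `b`. -/
def gaugeNorm (a b : P.gaugeGroup) : ℝ≥0∞ := ⨆ x, ENNReal.ofReal √(frobSq (val a x - val b x))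

lemma gaugeNorm_comm (a b : P.gaugeGroup) : gaugeNorm a b = gaugeNorm b a := by
  refine iSup_congr fun x => ?_
  rw [← frobSq_neg, neg_sub]

lemma gaugeNorm_triangle (a b c : P.gaugeGroup) :
    gaugeNorm a c ≤ gaugeNorm a b + gaugeNorm b c := by
  refine iSup_le fun x => ?_
  have h := sqrt_frobSq_add (k := 1) (fun _ => val a x - val b x) (fun _ => val b x - val c x)
  simp only [sub_add_sub_cancel, Finset.univ_unique, Finset.sum_singleton] at h
  refine (ENNReal.ofReal_le_ofReal h).trans ?_
  rw [ENNReal.ofReal_add (Real.sqrt_nonneg _) (Real.sqrt_nonneg _)]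
  exact add_le_add (le_iSup (fun x => ENNReal.ofReal √(frobSq (val a x - val b x))) x)
    (le_iSup (fun x => ENNReal.ofReal √(frobSq (val b x - val c x))) x)

lemma gaugeNorm_conj (a b g : P.gaugeGroup) :
    gaugeNorm (g * a * g⁻¹) (g * b * g⁻¹) = gaugeNorm a b := by
  refine iSup_congr fun x => ?_
  have hg : star (val g x) * star (star (val g x)) = 1 := by
    rw [star_star]; exact Matrix.mem_unitaryGroup_iff'.1 (g.1 x).2
  rw [← frobSq_conj (a := val a x - val b x) hg]
  congr 3
  change val g x * val a x * star (val g x) - val g x * val b x * star (val g x) = _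
  rw [star_star]
  noncomm_ring

/-- The set `CON(G)` of conjugacy classes of a group `G` of gauges. -/
def Con (G : Subgroup P.gaugeGroup) := ConjClasses G

/-- The conjugacy class of an element of `G`. -/
def Con.mk {G : Subgroup P.gaugeGroup} (a : G) : Con G := ConjClasses.mk a

/-- `inf_{g ∈ G} ‖a - g b g⁻¹‖`. -/
def conjDist {G : Subgroup P.gaugeGroup} (a b : G) : ℝ≥0∞ :=
  ⨅ g : G, gaugeNorm (a : P.gaugeGroup) (g * b * g⁻¹ : G)

lemma conjDist_comm {G : Subgroup P.gaugeGroup} (a b : G) : conjDist a b = conjDist b a := by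
  have key : ∀ a b : G, conjDist a b ≤ conjDist b a := fun a b =>
    le_iInf fun g => (iInf_le _ g⁻¹).trans_eq <| by
      rw [← gaugeNorm_conj _ _ (g : P.gaugeGroup), gaugeNorm_comm]
      congr 1
      push_cast
      group
  exact le_antisymm (key a b) (key b a)

lemma conjDist_triangle {G : Subgroup P.gaugeGroup} (a b c : G) :
    conjDist a c ≤ conjDist a b + conjDist b c := by
  simp only [conjDist]
  rw [ENNReal.iInf_add]
  refine le_iInf fun g => ?_
  rw [ENNReal.add_iInf]
  refine le_iInf fun k => (iInf_le _ (g * k)).trans ?_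
  refine (gaugeNorm_triangle _ ((g * b * g⁻¹ : G) : P.gaugeGroup) _).trans_eq ?_
  congr 1
  rw [← gaugeNorm_conj (b : P.gaugeGroup) _ (g : P.gaugeGroup)]
  congr 1
  push_cast
  group

lemma conjDist_conj_right {G : Subgroup P.gaugeGroup} (a b g : G) :
    conjDist a (g * b * g⁻¹) = conjDist a b := by
  simp only [conjDist]
  exact (Equiv.mulRight g).iInf_congr fun k => by
    congr 2
    simp only [Equiv.coe_mulRight]
    group

/-- The distance `d([a], [b]) = inf_{g ∈ G} ‖a - g b g⁻¹‖` on `CON(G)`; topological statements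
about `CON(G)` refer to the topology of this distance. -/
instance (G : Subgroup P.gaugeGroup) : PseudoEMetricSpace (Con G) where
  edist := Quotient.lift₂ (s₁ := IsConj.setoid G) (s₂ := IsConj.setoid G) conjDist (by
    rintro a b a' b' ha hb
    obtain ⟨g, rfl⟩ := isConj_iff.1 (show IsConj a a' from ha)
    obtain ⟨k, rfl⟩ := isConj_iff.1 (show IsConj b b' from hb)
    rw [conjDist_conj_right, conjDist_comm, conjDist_comm (g * a * g⁻¹), conjDist_conj_right])
  edist_self := by
    rintro ⟨a⟩
    refine le_antisymm ((iInf_le _ 1).trans_eq ?_) zero_le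
    simp [gaugeNorm, frobSq_zero]
  edist_comm := by
    rintro ⟨a⟩ ⟨b⟩
    exact conjDist_comm a b
  edist_triangle := by
    rintro ⟨a⟩ ⟨b⟩ ⟨c⟩
    exact conjDist_triangle a b c

/-! ### Iso-trivial connections on `M × S¹`

`S¹` is Mathlib's `Circle`, and `t ∈ [0, 2π]` corresponds to the point `Circle.exp t = e^{it}`. -/

/-- The pull-back of the bundle to `M × S¹`. -/
abbrev onCircle (P : UnitaryBundle I M m ι) : UnitaryBundle (I.prod (𝓡 1)) (M × Circle) m ι :=
  P.pullback Prod.fst contMDiff_fst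

/-- The pull-back of the bundle to `M × ℝ`. -/
abbrev onLine (P : UnitaryBundle I M m ι) : UnitaryBundle (I.prod 𝓘(ℝ, ℝ)) (M × ℝ) m ι :=
  P.pullback Prod.fst contMDiff_fst

/-- The product metric on `M × S¹`, where `S¹ ⊂ ℂ` carries its standard metric `dt²`. -/
def productMetric (h : ∀ x : M, TangentSpace I x → TangentSpace I x → ℝ) (p : M × Circle)
    (v w : TangentSpace (I.prod (𝓡 1)) p) : ℝ :=
  h p.1 (mfderiv (I.prod (𝓡 1)) I Prod.fst p v) (mfderiv (I.prod (𝓡 1)) I Prod.fst p w) +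
    inner ℝ (E := ℂ) (mfderiv (I.prod (𝓡 1)) 𝓘(ℝ, ℂ) (fun q : M × Circle => (q.2 : ℂ)) p v)
      (mfderiv (I.prod (𝓡 1)) 𝓘(ℝ, ℂ) (fun q : M × Circle => (q.2 : ℂ)) p w)

/-- The projection `M × ℝ → M × S¹`. -/
def wrap (M : Type*) : M × ℝ → M × Circle := Prod.map id Circle.exp

lemma contMDiff_wrap : ContMDiff (I.prod 𝓘(ℝ, ℝ)) (I.prod (𝓡 1)) ∞ (wrap M) :=
  contMDiff_id.prodMap contMDiff_circleExp

lemma contMDiff_slice : ContMDiff I (I.prod (𝓡 1)) ∞ (fun x : M => (x, (1 : Circle))) :=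
  contMDiff_id.prodMk contMDiff_const

/-- The restriction `A(0)` of a connection on `M × S¹` to the slice `M × {t = 0}`. -/
def Connection.atZero (A : Connection P.onCircle) : Connection P :=
  A.pullback (fun x : M => (x, (1 : Circle))) contMDiff_slice

variable {h} in
/-- The map `ρ : [A] ↦ [A(0)]`. -/
def rho : Moduli P.onCircle (productMetric h) → Moduli P h :=
  Quotient.map (sa := Connection.gaugeSetoid _) (sb := Connection.gaugeSetoid _)
    Connection.atZero (by
      rintro A _ ⟨φ, rfl⟩
      exact ⟨pullGauge φ _ contMDiff_slice, A.pullback_act φ _ contMDiff_slice⟩)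

/-- A `B`-admissible gauge: a gauge `u` on `M × [0, 2π]`, smooth up to the boundary, with
`u(0) = Id`, with `u(2π) ∈ Γ_B`, and such that `u⁻¹ ∂u/∂t` is smoothly periodic, i.e. extends from
`M × (0, 2π)` to a smooth section over `M × S¹`. (Values of `toFun` at times outside `[0, 2π]`
play no role.) -/
structure AdmissibleGauge (B : Connection P) where
  toFun : M × ℝ → Matrix.unitaryGroup (Fin m) ℂ
  smooth : P.onLine.SmoothSectionOn (fun p => (toFun p : Mat m))
    (Set.univ ×ˢ Set.Icc 0 (2 * Real.pi))
  initial : ∀ x, toFun (x, 0) = 1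
  /-- The gauge `u(2π)`, as an element of `Γ_B`. -/
  final : B.stabilizer
  final_eq : ∀ x, final.1.1 x = toFun (x, 2 * Real.pi)
  periodic : ∃ χ : M × Circle → Mat m, P.onCircle.SmoothSectionOn χ Set.univ ∧
    ∀ x, ∀ t ∈ Set.Ioo 0 (2 * Real.pi), χ (x, Circle.exp t) =
      star (toFun (x, t) : Mat m) *
        Matrix.of fun a b => deriv (fun s => (toFun (x, s) : Mat m) a b) t

/-- `A = u(B)`: the connection `A` on `M × S¹`, viewed over `M × (0, 2π)`, is obtained by applying
the gauge `u` to the pull-back of `B`. -/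
def AdmissibleGauge.Yields {B : Connection P} (u : AdmissibleGauge B)
    (A : Connection P.onCircle) : Prop :=
  ∀ i, ∀ x ∈ P.baseSet i, ∀ t ∈ Set.Ioo 0 (2 * Real.pi),
    (A.pullback (wrap M) contMDiff_wrap).form i (x, t) =
      gaugeForm (I.prod 𝓘(ℝ, ℝ)) (P.onLine.rep i fun p => (u.toFun p : Mat m)) (x, t)
        ((B.pullback (Prod.fst : M × ℝ → M) contMDiff_fst).form i (x, t))

/-- A connection on `M × S¹` is iso-trivial if it is `u(B)` for some connection `B` on `M` and some
`B`-admissible gauge `u`. -/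
def Connection.IsoTrivial (A : Connection P.onCircle) : Prop :=
  ∃ (B : Connection P) (u : AdmissibleGauge B), u.Yields A

/-- The set of gauge equivalence classes of iso-trivial connections. -/
def isoModuli (P : UnitaryBundle I M m ι)
    (h : ∀ x : M, TangentSpace I x → TangentSpace I x → ℝ) :
    Set (Moduli P.onCircle (productMetric h)) :=
  {x | ∃ A : Connection P.onCircle, A.IsoTrivial ∧ A.cls _ = x}

/-- The set of gauge equivalence classes of irreducible iso-trivial connections. -/
def irredIsoModuli (P : UnitaryBundle I M m ι)
    (h : ∀ x : M, TangentSpace I x → TangentSpace I x → ℝ) :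
    Set (Moduli P.onCircle (productMetric h)) :=
  {x | ∃ A : Connection P.onCircle, A.IsoTrivial ∧ A.Irreducible ∧ A.cls _ = x}

/-- The fibre `ρ⁻¹([B])` of `ρ`, restricted to classes of iso-trivial connections. -/
def rhoFibre (h : ∀ x : M, TangentSpace I x → TangentSpace I x → ℝ) (B : Connection P) :
    Set (Moduli P.onCircle (productMetric h)) :=
  {x | x ∈ isoModuli P h ∧ rho x = B.cls h}

end UnitaryBundle

end

/-!
# Iso-trivial connections over the product with a circle

The classification rests on a description of iso-trivial connections by gauges on the covering
`M × ℝ` of `M × S¹`. If `A` arises from `B` by an admissible gauge `u`, then `u` extends by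
`u(t + 2π) = u(2π) u(t)` to a gauge on `M × ℝ` which is the identity at time `0` and takes the
pull-back of `B` to the pull-back of `A` (`IsCover`). That the extension is smooth is the content of
`Yields.exists_isCover`: it is continuous and satisfies, away from the slices `t ∈ 2πℤ`, the linear
equation `du = u A - B u` with smooth coefficients; such an equation extends across a hypersurface
(`dMat_eq_of_crossing`), and its solutions are smooth (`smoothMatOn_of_dMat_eq`). A gauge fixing the
pull-back of `B` does not depend on time, so `u` is determined by `A`, and its value `u(2π)`, the
holonomy, fixes `B`. Since periodic gauges on `M × ℝ` descend to `M × S¹`, two connections arising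
from `B` are gauge equivalent if and only if their holonomies are conjugate in the stabilizer of `B`
(`IsCover.gaugeAtZero_mem`, `IsCover.exists_act_eq`). This makes `τ_B` well defined and injective.

Every element of the stabilizer is a holonomy. For `a` and `c` fixing `B`, the connection
`B + (b(t) log a + b(t + π) log c) dt` with a bump function `b` arises from `B` by the gauge which
runs first from `1` to `a` along the powers of `a` and then from `a` to `a c` along the powers of
`c` (`modelConnection`, `modelGauge_yields`). The logarithm is not continuous on the unitary group,
but the eigenvalues of a parallel gauge are locally constant, and near each point any function of it
is a polynomial in it with constant coefficients (`eventually_fcalc_eq`); so `log a` is smooth and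
parallel for every `a` in the stabilizer.

The inverse of `τ_B` is continuous because a holonomy `b` close to `a` can be written as `a c` with
`c` close to `1`: the model connections of `(a, 1)` and `(a, c)` differ by `b(t + π) log c dt`, and
`|log c| ≤ 2 |1 - c|` (`supDist_modelConnection_le`, `IsCover.gaugeDist_le`). For the continuity of
`τ_B`, let `φ` be a gauge taking `A'` close to `A`. Its restriction `ψ` to the slice `t = 0` almost
fixes `B`, and conjugation by `ψ` takes the holonomy of `A'` close to that of `A`
(`supDist_atZero_le`, `gaugeNorm_hol_le`). But `ψ` itself need not fix `B`. By compactness of `M`, a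
gauge which almost fixes `B` is close to one which fixes it (`exists_mem_stabilizer_gaugeNorm_le`,
an application of the theorem of Arzelà and Ascoli), and that one may replace `ψ`.

The gauges fixing `A` are those fixing `B` and commuting with the holonomy; hence `A` is irreducible
if and only if `B` is irreducible and the holonomy is a central constant
(`IsCover.irreducible_left`, `IsCover.isConstCentral_hol`, `IsCover.irreducible_of_left`). A central
constant is invariant under conjugation by all gauges, so the second part follows from the same
estimates, now with `B` varying, and compactness of `M` plays no role in it. The two
homeomorphisms are constructed in `exists_homeomorph_con` and `exists_homeomorph_center`.
-/

noncomputable section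

/-! ### Regularity of linear systems -/

section LocalAnalysis

open Set Filter Topology

variable {E H M : Type*} [NormedAddCommGroup E] [NormedSpace ℝ E] [TopologicalSpace H]
  [TopologicalSpace M] [ChartedSpace H M] {m : ℕ} {I : ModelWithCorners ℝ E H}

/-- All entries of the matrix-valued function `f` are differentiable at `x`. -/
def MDiffMatAt (I : ModelWithCorners ℝ E H) (f : M → Mat m) (x : M) : Prop :=
  ∀ a b, MDifferentiableAt I 𝓘(ℝ, ℂ) (fun y => f y a b) x

lemma isOpen_chart_preimage [I.Boundaryless] {s : Set M} (hs : IsOpen s) (x₀ : M) :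
    IsOpen ((extChartAt I x₀).target ∩ (extChartAt I x₀).symm ⁻¹' s) :=
  (continuousOn_extChartAt_symm x₀).isOpen_inter_preimage (isOpen_extChartAt_target x₀) hs

/-- The derivative of an entry of a matrix-valued function, read in a chart. -/
lemma chart_hasFDerivAt [I.Boundaryless] [IsManifold I ∞ M] {f : M → Mat m} {x₀ : M} {z : E}
    (hz : z ∈ (extChartAt I x₀).target) (hf : MDiffMatAt I f ((extChartAt I x₀).symm z))
    (a b : Fin m) :
    DifferentiableAt ℝ (fun z => f ((extChartAt I x₀).symm z) a b) z ∧
      ∀ w, fderiv ℝ (fun z => f ((extChartAt I x₀).symm z) a b) z w =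
        dMat I f ((extChartAt I x₀).symm z)
          (mfderiv 𝓘(ℝ, E) I (extChartAt I x₀).symm z w) a b := by
  have hk : MDifferentiableAt 𝓘(ℝ, E) I (extChartAt I x₀).symm z :=
    ((contMDiffOn_extChartAt_symm (n := ∞) x₀).contMDiffAt
      ((isOpen_extChartAt_target x₀).mem_nhds hz)).mdifferentiableAt (by simp)
  have h := (hf a b).hasMFDerivAt.comp z hk.hasMFDerivAt
  have h2 := h.mdifferentiableAt.differentiableAt
  refine ⟨h2, fun w => ?_⟩
  rw [← mfderiv_eq_fderiv]
  exact congrArg (fun L : E →L[ℝ] ℂ => L w) h.mfderiv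

/-- A smooth form evaluated at the coordinate vector field of a fixed vector `w` is a smooth
function of the coordinates. -/
lemma SmoothFormOn.contDiffOn_chart [I.Boundaryless] [IsManifold I ∞ M]
    {α : ∀ x : M, TangentSpace I x →ₗ[ℝ] Mat m} {s : Set M} (hα : SmoothFormOn I α s) (x₀ : M)
    (w : E) (a b : Fin m) :
    ContDiffOn ℝ ∞ (fun z => α ((extChartAt I x₀).symm z)
      (mfderiv 𝓘(ℝ, E) I (extChartAt I x₀).symm z w) a b)
      ((extChartAt I x₀).target ∩ (extChartAt I x₀).symm ⁻¹' s) := by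
  have hO := isOpen_extChartAt_target (I := I) x₀
  have h1 := (contMDiffOn_extChartAt_symm (I := I) (n := ∞) x₀).contMDiffOn_tangentMapWithin
    (m := ∞) (by simp) hO.uniqueMDiffOn
  have h2 : ContMDiff 𝓘(ℝ, E) 𝓘(ℝ, E).tangent ∞
      (fun z : E => (⟨z, w⟩ : TangentBundle 𝓘(ℝ, E) E)) :=
    contMDiff_vectorSpace_iff_contDiff.2 contDiff_const
  have h3 := (hα a b).comp (h1.comp (h2.contMDiffOn
    (s := (extChartAt I x₀).target ∩ (extChartAt I x₀).symm ⁻¹' s)) (fun z hz => hz.1))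
    (fun z hz => hz.2)
  refine (contMDiffOn_iff_contDiffOn.1 h3).congr fun z hz => ?_
  simp only [Function.comp_apply, tangentMapWithin]
  rw [mfderivWithin_of_mem_nhds (hO.mem_nhds hz.1)]
  rfl

lemma entry_mul_sub {W α β : Mat m} (a b : Fin m) :
    (W * α - β * W) a b = ∑ c, (W a c * α c b - β a c * W c b) := by
  simp [Matrix.sub_apply, Matrix.mul_apply, Finset.sum_sub_distrib]

/-- The right hand side of the equation `dW = W α - β W`. -/
def commForm (W : M → Mat m) (α β : ∀ x : M, TangentSpace I x →ₗ[ℝ] Mat m) (x : M) :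
    TangentSpace I x →ₗ[ℝ] Mat m :=
  LinearMap.mulLeft ℝ (W x) ∘ₗ α x - LinearMap.mulRight ℝ (W x) ∘ₗ β x

lemma commForm_apply (W : M → Mat m) (α β : ∀ x : M, TangentSpace I x →ₗ[ℝ] Mat m) (x : M)
    (v : TangentSpace I x) : commForm W α β x v = W x * α x v - β x v * W x := rfl

/-- `W` is differentiable at `x` and satisfies the linear equation `dW = W α - β W` there. If `α`
and `β` are connection forms, this says that the gauge `W` takes `β` to `α`. -/
def SolvesAt (W : M → Mat m) (α β : ∀ x : M, TangentSpace I x →ₗ[ℝ] Mat m) (x : M) : Prop :=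
  MDiffMatAt I W x ∧ ∀ v, dMat I W x v = W x * α x v - β x v * W x

/-- Regularity bootstrap: a differentiable solution of the linear system `dW = W α - β W` with
smooth coefficients is smooth. -/
theorem smoothMatOn_of_dMat_eq [FiniteDimensional ℝ E] [I.Boundaryless] [IsManifold I ∞ M]
    {W : M → Mat m} {α β : ∀ x : M, TangentSpace I x →ₗ[ℝ] Mat m} {s : Set M} (hs : IsOpen s)
    (hα : SmoothFormOn I α s) (hβ : SmoothFormOn I β s) (h : ∀ x ∈ s, SolvesAt W α β x) :
    SmoothMatOn I W s := by
  intro a b x₀ hx₀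
  set k := (extChartAt I x₀).symm with hk
  set O := (extChartAt I x₀).target ∩ k ⁻¹' s with hO
  have hOo : IsOpen O := isOpen_chart_preimage hs x₀
  have key : ∀ n : ℕ, ∀ a b, ContDiffOn ℝ n (fun z => W (k z) a b) O := by
    intro n
    induction n with
    | zero =>
      intro a b
      refine contDiffOn_zero.2 fun z hz => ?_
      exact (chart_hasFDerivAt hz.1 (h _ hz.2).1 a b).1.continuousAt.continuousWithinAt
    | succ n ih =>
      intro a b
      push_cast
      refine (contDiffOn_succ_iff_fderiv_of_isOpen hOo).2 ⟨fun z hz =>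
        (chart_hasFDerivAt hz.1 (h _ hz.2).1 a b).1.differentiableWithinAt, by simp, ?_⟩
      refine contDiffOn_clm_apply.2 fun w => ?_
      have : ContDiffOn ℝ n (fun z => ∑ c, (W (k z) a c * α (k z) (mfderiv 𝓘(ℝ, E) I k z w) c b
          - β (k z) (mfderiv 𝓘(ℝ, E) I k z w) a c * W (k z) c b)) O := by
        refine ContDiffOn.sum fun c _ => ?_
        exact ((ih a c).mul ((hα.contDiffOn_chart x₀ w c b).of_le (by exact_mod_cast le_top))).sub
          (((hβ.contDiffOn_chart x₀ w a c).of_le (by exact_mod_cast le_top)).mul (ih c b))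
      refine this.congr fun z hz => ?_
      rw [(chart_hasFDerivAt hz.1 (h _ hz.2).1 a b).2, (h _ hz.2).2, entry_mul_sub]
  have h1 : ContDiffAt ℝ ∞ (fun z => W (k z) a b) (extChartAt I x₀ x₀) := by
    refine (contDiffOn_infty.2 fun n => key n a b).contDiffAt
      (hOo.mem_nhds ⟨mem_extChartAt_target x₀, ?_⟩)
    simpa [hk] using hx₀
  have h2 := h1.contMDiffAt.comp x₀ (contMDiffAt_extChartAt (I := I) (n := ∞) (x := x₀))
  refine ContMDiffAt.contMDiffWithinAt (h2.congr_of_eventuallyEq ?_)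
  filter_upwards [extChartAt_source_mem_nhds (I := I) x₀] with y hy
  change W y a b = W ((extChartAt I x₀).symm (extChartAt I x₀ y)) a b
  rw [(extChartAt I x₀).left_inv hy]

/-- If a function is continuous near `z₀` and differentiable there inside two convex open sets whose
closures cover the space, with a derivative that extends continuously, then it is differentiable at
`z₀`. -/
theorem hasFDerivAt_of_crossing {F : E → ℂ} {G : E → (E →L[ℝ] ℂ)} {O S T : Set E}
    (hO : IsOpen O) (hS : IsOpen S) (hT : IsOpen T) (hSc : Convex ℝ S) (hTc : Convex ℝ T)
    (hST : closure S ∪ closure T = univ) {z₀ : E} (hz₀ : z₀ ∈ O) (hF : ContinuousOn F O)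
    (hG : ContinuousOn G O) (hd : ∀ z ∈ O, z ∈ S ∪ T → HasFDerivAt F (G z) z) :
    HasFDerivAt F (G z₀) z₀ := by
  obtain ⟨r, hr, hrO⟩ := Metric.nhds_basis_closedBall.mem_iff.1 (hO.mem_nhds hz₀)
  have key : ∀ T' : Set E, IsOpen T' → Convex ℝ T' → T' ⊆ S ∪ T →
      HasFDerivWithinAt F (G z₀) (Metric.ball z₀ r ∩ closure T') z₀ := by
    intro T' hT hc h0
    set s := Metric.ball z₀ r ∩ T'
    have hsO : closure s ⊆ O := (closure_mono inter_subset_left).trans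
      (Metric.closure_ball_subset_closedBall.trans hrO)
    have hne : ∀ z ∈ s, HasFDerivAt F (G z) z := fun z hz =>
      hd z (hsO (subset_closure hz)) (h0 hz.2)
    have h1 := hasFDerivWithinAt_closure_of_tendsto_fderiv (f := F) (s := s) (x := z₀) (f' := G z₀)
      (fun z hz => (hne z hz).differentiableAt.differentiableWithinAt)
      ((convex_ball _ _).inter hc) (Metric.isOpen_ball.inter hT)
      (fun z hz => (hF z (hsO hz)).mono (subset_closure.trans hsO))
      (((hG z₀ hz₀).mono (subset_closure.trans hsO)).congr' (by
        filter_upwards [self_mem_nhdsWithin] with z hz using (hne z hz).fderiv.symm))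
    exact h1.mono Metric.isOpen_ball.inter_closure
  refine ((key S hS hSc subset_union_left).union (key T hT hTc subset_union_right)).hasFDerivAt ?_
  rw [← inter_union_distrib_left, hST, inter_univ]
  exact Metric.ball_mem_nhds z₀ hr

/-- An entry of `commForm`, read in a chart. -/
def chartComm [FiniteDimensional ℝ E] (W : M → Mat m)
    (α β : ∀ x : M, TangentSpace I x →ₗ[ℝ] Mat m) (x₀ : M) (a b : Fin m) (z : E) : E →L[ℝ] ℂ :=
  LinearMap.toContinuousLinearMap
    { toFun := fun w => commForm W α β ((extChartAt I x₀).symm z)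
        (mfderiv 𝓘(ℝ, E) I (extChartAt I x₀).symm z w) a b
      map_add' := fun w w' => by
        rw [← Matrix.add_apply, ← map_add]
        exact congrArg (fun u => commForm W α β _ u a b) (map_add (mfderiv 𝓘(ℝ, E) I _ z) w w')
      map_smul' := fun c w => by
        rw [RingHom.id_apply, ← Matrix.smul_apply, ← map_smul]
        exact congrArg (fun u => commForm W α β _ u a b) (map_smul (mfderiv 𝓘(ℝ, E) I _ z) c w) }

lemma chartComm_apply [FiniteDimensional ℝ E] (W : M → Mat m)
    (α β : ∀ x : M, TangentSpace I x →ₗ[ℝ] Mat m) (x₀ : M) (a b : Fin m) (z w : E) :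
    chartComm W α β x₀ a b z w = commForm W α β ((extChartAt I x₀).symm z)
      (mfderiv 𝓘(ℝ, E) I (extChartAt I x₀).symm z w) a b := rfl

lemma continuousOn_chartComm [FiniteDimensional ℝ E] [I.Boundaryless] [IsManifold I ∞ M]
    {W : M → Mat m} {α β : ∀ x : M, TangentSpace I x →ₗ[ℝ] Mat m} {s : Set M}
    (hα : SmoothFormOn I α s) (hβ : SmoothFormOn I β s)
    (hW : ∀ a b, ContinuousOn (fun x => W x a b) s) (x₀ : M) (a b : Fin m) :
    ContinuousOn (chartComm W α β x₀ a b)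
      ((extChartAt I x₀).target ∩ (extChartAt I x₀).symm ⁻¹' s) := by
  refine continuousOn_clm_apply.2 fun w => ?_
  have hWc : ∀ a b, ContinuousOn (fun z => W ((extChartAt I x₀).symm z) a b)
      ((extChartAt I x₀).target ∩ (extChartAt I x₀).symm ⁻¹' s) := fun a b =>
    (hW a b).comp ((continuousOn_extChartAt_symm x₀).mono inter_subset_left) fun z hz => hz.2
  have := continuousOn_finsetSum Finset.univ fun c _ =>
      ((hWc a c).mul (hα.contDiffOn_chart x₀ w c b).continuousOn).sub
        ((hβ.contDiffOn_chart x₀ w a c).continuousOn.mul (hWc c b))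
  refine this.congr fun z hz => ?_
  rw [chartComm_apply, commForm_apply, entry_mul_sub]
  rfl

/-- Equality of linear forms at a point can be tested in a chart. -/
lemma eq_of_chart [I.Boundaryless] [IsManifold I ∞ M] {x₀ x : M} {V : Type*}
    (hx : x ∈ (extChartAt I x₀).source) {f g : TangentSpace I x → V}
    (h : ∀ w : E, f (mfderiv 𝓘(ℝ, E) I (extChartAt I x₀).symm (extChartAt I x₀ x) w) =
      g (mfderiv 𝓘(ℝ, E) I (extChartAt I x₀).symm (extChartAt I x₀ x) w)) (v : TangentSpace I x) :
    f v = g v := by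
  have h1 := mfderivWithin_extChartAt_symm_comp_mfderiv_extChartAt' (I := I) hx
  rw [I.range_eq_univ, mfderivWithin_univ] at h1
  have h2 := h (mfderiv I 𝓘(ℝ, E) (extChartAt I x₀) x v)
  have h3 : mfderiv 𝓘(ℝ, E) I (extChartAt I x₀).symm (extChartAt I x₀ x)
    (mfderiv I 𝓘(ℝ, E) (extChartAt I x₀) x v) = v := DFunLike.congr_fun h1 v
  rwa [h3] at h2

/-- A function which near `x₀`, in the chart at `x₀`, is differentiable with derivative
`commForm W α β`, has this derivative. -/
lemma dMat_eq_of_chart [FiniteDimensional ℝ E] [I.Boundaryless] [IsManifold I ∞ M]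
    {W : M → Mat m} {α β : ∀ x : M, TangentSpace I x →ₗ[ℝ] Mat m} {x₀ : M} {x : M}
    (hx : x ∈ (extChartAt I x₀).source)
    (hF : ∀ a b, HasFDerivAt (fun z => W ((extChartAt I x₀).symm z) a b)
      (chartComm W α β x₀ a b (extChartAt I x₀ x)) (extChartAt I x₀ x)) :
    SolvesAt W α β x := by
  have hinv : (extChartAt I x₀).symm (extChartAt I x₀ x) = x := (extChartAt I x₀).left_inv hx
  have hmd : MDiffMatAt I W x := fun a b => by
    have h2 := (hF a b).differentiableAt.mdifferentiableAt.comp x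
      (mdifferentiableAt_extChartAt (I := I) (by rwa [extChartAt_source] at hx))
    refine h2.congr_of_eventuallyEq ?_
    filter_upwards [(isOpen_extChartAt_source (I := I) x₀).mem_nhds hx] with y hy
    rw [Function.comp_apply, (extChartAt I x₀).left_inv hy]
  refine ⟨hmd, eq_of_chart hx fun w => ?_⟩
  have h1 : ∀ y, y = x → MDiffMatAt I W y → ∀ w : E,
      (∀ a b, dMat I W y (mfderiv 𝓘(ℝ, E) I (extChartAt I x₀).symm (extChartAt I x₀ x) w) a b =
        commForm W α β y (mfderiv 𝓘(ℝ, E) I (extChartAt I x₀).symm (extChartAt I x₀ x) w) a b) →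
      dMat I W x (mfderiv 𝓘(ℝ, E) I (extChartAt I x₀).symm (extChartAt I x₀ x) w) =
      commForm W α β x (mfderiv 𝓘(ℝ, E) I (extChartAt I x₀).symm (extChartAt I x₀ x) w) := by
    rintro y rfl _ w h
    ext a b
    exact h a b
  refine h1 _ hinv (by rwa [hinv]) w fun a b => ?_
  rw [← (chart_hasFDerivAt ((extChartAt I x₀).map_source hx) (by rwa [hinv]) a b).2 w,
    (hF a b).fderiv, chartComm_apply]

/-- A solution of `dW = W α - β W` off the hypersurface `t = 0` of `M × ℝ` which is continuous
across this hypersurface satisfies the equation on the hypersurface, too. -/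
theorem dMat_eq_of_crossing [FiniteDimensional ℝ E] [I.Boundaryless] [IsManifold I ∞ M]
    {W : M × ℝ → Mat m} {α β : ∀ p : M × ℝ, TangentSpace (I.prod 𝓘(ℝ, ℝ)) p →ₗ[ℝ] Mat m}
    {s : Set (M × ℝ)} (hs : IsOpen s) (hα : SmoothFormOn (I.prod 𝓘(ℝ, ℝ)) α s)
    (hβ : SmoothFormOn (I.prod 𝓘(ℝ, ℝ)) β s) (hW : ∀ a b, ContinuousOn (fun p => W p a b) s)
    (h : ∀ p ∈ s, p.2 ≠ 0 → SolvesAt W α β p) {p₀ : M × ℝ} (hp₀ : p₀ ∈ s) :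
    SolvesAt W α β p₀ := by
  have hsnd : ∀ z : E × ℝ, ((extChartAt (I.prod 𝓘(ℝ, ℝ)) p₀).symm z).2 = z.2 := fun z => by
    rw [extChartAt_prod]; rfl
  have hOo := isOpen_chart_preimage (I := I.prod 𝓘(ℝ, ℝ)) hs p₀
  refine dMat_eq_of_chart (mem_extChartAt_source p₀) fun a b => ?_
  refine hasFDerivAt_of_crossing (F := fun z => W ((extChartAt (I.prod 𝓘(ℝ, ℝ)) p₀).symm z) a b)
    hOo (S := univ ×ˢ Ioi 0) (T := univ ×ˢ Iio 0)
    (isOpen_univ.prod isOpen_Ioi) (isOpen_univ.prod isOpen_Iio) (convex_univ.prod (convex_Ioi 0))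
    (convex_univ.prod (convex_Iio 0)) ?_ ⟨mem_extChartAt_target p₀, ?_⟩
    ((hW a b).comp ((continuousOn_extChartAt_symm p₀).mono inter_subset_left) fun z hz => hz.2)
    (continuousOn_chartComm hα hβ hW p₀ a b) fun z hz hz2 => ?_
  · rw [closure_prod_eq, closure_prod_eq, closure_univ, closure_Ioi, closure_Iio,
      ← prod_union, Ici_union_Iic, univ_prod_univ]
  · simpa only [mem_preimage, (extChartAt (I.prod 𝓘(ℝ, ℝ)) p₀).left_inv (mem_extChartAt_source p₀)]
  · have hne : z.2 ≠ 0 := by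
      rcases hz2 with h | h
      · exact ne_of_gt h.2
      · exact ne_of_lt h.2
    have h1 := chart_hasFDerivAt (f := W) hz.1 (h _ hz.2 (by rwa [hsnd])).1 a b
    refine h1.1.hasFDerivAt.congr_fderiv (ContinuousLinearMap.ext fun w => ?_)
    rw [h1.2, (h _ hz.2 (by rwa [hsnd])).2, chartComm_apply, commForm_apply]

lemma MDiffMatAt.congr {W V : M → Mat m} {x : M} (h : MDiffMatAt I V x) (hVW : W =ᶠ[𝓝 x] V) :
    MDiffMatAt I W x := fun a b =>
  (h a b).congr_of_eventuallyEq (hVW.mono fun _ hy => congrFun (congrFun hy a) b)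

lemma SolvesAt.congr {W V : M → Mat m} {α β : ∀ x : M, TangentSpace I x →ₗ[ℝ] Mat m} {x : M}
    (h : SolvesAt V α β x) (hVW : W =ᶠ[𝓝 x] V) : SolvesAt W α β x := by
  refine ⟨h.1.congr hVW, fun v => ?_⟩
  obtain ⟨U, hU, hUo, hxU⟩ := eventually_nhds_iff.1 hVW
  rw [dMat_congr hUo hU hxU, h.2, hVW.eq_of_nhds]

lemma MDiffMatAt.mul {f g : M → Mat m} {x : M} (hf : MDiffMatAt I f x) (hg : MDiffMatAt I g x) :
    MDiffMatAt I (fun y => f y * g y) x ∧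
      ∀ v, dMat I (fun y => f y * g y) x v = dMat I f x v * g x + f x * dMat I g x v := by
  let F : Fin m → Fin m → TangentSpace I x →L[ℝ] ℂ := fun a b =>
    mfderiv I 𝓘(ℝ, ℂ) (fun y => f y a b) x
  let G : Fin m → Fin m → TangentSpace I x →L[ℝ] ℂ := fun a b =>
    mfderiv I 𝓘(ℝ, ℂ) (fun y => g y a b) x
  have key : ∀ a b, HasMFDerivAt I 𝓘(ℝ, ℂ) (fun y => (f y * g y) a b) x
      (∑ c, (f x a c • G c b + g x c b • F a c)) := by
    intro a b
    have h := HasMFDerivAt.sum (I := I) (z := x) (t := Finset.univ)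
      (f := fun c : Fin m => (fun y => f y a c) * (fun y => g y c b))
      (fun c _ => ((hf a c).hasMFDerivAt).mul ((hg c b).hasMFDerivAt))
    have e : (fun y => (f y * g y) a b) = ∑ c, (fun y => f y a c) * (fun y => g y c b) := by
      ext y; simp [Matrix.mul_apply]
    rw [e]; exact h
  refine ⟨fun a b => (key a b).mdifferentiableAt, fun v => ?_⟩
  ext a b
  have h2 : (mfderiv I 𝓘(ℝ, ℂ) (fun y => (f y * g y) a b) x v : ℂ) =
      (∑ c, (f x a c • G c b + g x c b • F a c)) v :=
    congrArg (fun L : TangentSpace I x →L[ℝ] ℂ => L v) (key a b).mfderiv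
  refine h2.trans ?_
  have h3 : (dMat I f x v * g x + f x * dMat I g x v) a b =
      ∑ c, (F a c v * g x c b + f x a c * G c b v) := by
    simp only [Matrix.add_apply, Matrix.mul_apply, Finset.sum_add_distrib]; rfl
  rw [h3, _root_.sum_apply]
  refine Finset.sum_congr rfl fun c _ => (add_comm _ _).trans ?_
  exact congrArg (· + f x a c * G c b v) (mul_comm (g x c b) (F a c v))

variable {E' H' N : Type*} [NormedAddCommGroup E'] [NormedSpace ℝ E'] [TopologicalSpace H']
  [TopologicalSpace N] [ChartedSpace H' N] {J : ModelWithCorners ℝ E' H'}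

lemma MDiffMatAt.comp {f : M → Mat m} {k : N → M} {y : N} (hf : MDiffMatAt I f (k y))
    (hk : MDifferentiableAt J I k y) :
    MDiffMatAt J (fun y => f (k y)) y ∧
      ∀ v, dMat J (fun y => f (k y)) y v = dMat I f (k y) (mfderiv J I k y v) := by
  refine ⟨fun a b => (hf a b).comp y hk, fun v => ?_⟩
  ext a b
  exact congrArg (fun L => (L v : ℂ)) (mfderiv_comp y (hf a b) hk)

/-- The partial derivative in the direction of `ℝ` of a matrix-valued function on `M × ℝ`. -/
lemma MDiffMatAt.hasDerivAt {f : M × ℝ → Mat m} {x : M} {t : ℝ}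
    (hf : MDiffMatAt (I.prod 𝓘(ℝ, ℝ)) f (x, t)) (a b : Fin m) :
    HasDerivAt (fun s => f (x, s) a b)
      (dMat (I.prod 𝓘(ℝ, ℝ)) f (x, t) ((0, 1) : E × ℝ) a b) t := by
  have hk : MDifferentiableAt 𝓘(ℝ, ℝ) (I.prod 𝓘(ℝ, ℝ)) (fun s : ℝ => (x, s)) t :=
    mdifferentiableAt_const.prodMk mdifferentiableAt_id
  have h := MDiffMatAt.comp (J := 𝓘(ℝ, ℝ)) (k := fun s : ℝ => (x, s)) hf hk
  have h1 := (h.1 a b).differentiableAt.hasDerivAt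
  have h3 : deriv (fun s => f (x, s) a b) t =
      dMat (I.prod 𝓘(ℝ, ℝ)) f (x, t) ((0, 1) : E × ℝ) a b := by
    have h2 := congrArg (fun A : Mat m => A a b) (h.2 (1 : ℝ))
    rw [mfderiv_prod_right] at h2
    rw [← fderiv_apply_one_eq_deriv, ← mfderiv_eq_fderiv]
    exact h2
  rwa [h3] at h1

end LocalAnalysis

/-! ### Limits of approximate solutions -/

section Limits

open Set Filter Topology

variable {E H M : Type*} [NormedAddCommGroup E] [NormedSpace ℝ E] [TopologicalSpace H]
  [TopologicalSpace M] [ChartedSpace H M] {m : ℕ} {I : ModelWithCorners ℝ E H}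

/-- An entry of a matrix-valued linear form, read in a chart. -/
def chartEntry [FiniteDimensional ℝ E] (α : ∀ x : M, TangentSpace I x →ₗ[ℝ] Mat m) (x₀ : M)
    (a b : Fin m) (z : E) : E →L[ℝ] ℂ :=
  LinearMap.toContinuousLinearMap
    { toFun := fun w => α ((extChartAt I x₀).symm z)
        (mfderiv 𝓘(ℝ, E) I (extChartAt I x₀).symm z w) a b
      map_add' := fun w w' => by
        rw [← Matrix.add_apply, ← map_add]
        exact congrArg (fun u => α _ u a b) (map_add (mfderiv 𝓘(ℝ, E) I _ z) w w')
      map_smul' := fun c w => by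
        rw [RingHom.id_apply, ← Matrix.smul_apply, ← map_smul]
        exact congrArg (fun u => α _ u a b) (map_smul (mfderiv 𝓘(ℝ, E) I _ z) c w) }

lemma chartComm_eq [FiniteDimensional ℝ E] (W : M → Mat m)
    (α β : ∀ x : M, TangentSpace I x →ₗ[ℝ] Mat m) (x₀ : M) (a b : Fin m) (z : E) :
    chartComm W α β x₀ a b z =
      ∑ c, (W ((extChartAt I x₀).symm z) a c • chartEntry α x₀ c b z
        - W ((extChartAt I x₀).symm z) c b • chartEntry β x₀ a c z) := by
  ext w
  rw [chartComm_apply, commForm_apply, entry_mul_sub, _root_.sum_apply]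
  refine Finset.sum_congr rfl fun c _ => ?_
  exact congrArg (_ - ·) (mul_comm _ _)

lemma continuousOn_chartEntry [FiniteDimensional ℝ E] [I.Boundaryless] [IsManifold I ∞ M]
    {α : ∀ x : M, TangentSpace I x →ₗ[ℝ] Mat m} {s : Set M}
    (hα : SmoothFormOn I α s) (x₀ : M) (a b : Fin m) :
    ContinuousOn (chartEntry α x₀ a b)
      ((extChartAt I x₀).target ∩ (extChartAt I x₀).symm ⁻¹' s) :=
  continuousOn_clm_apply.2 fun w => (hα.contDiffOn_chart x₀ w a b).continuousOn

/-- Pointwise limits of uniformly Lipschitz functions are uniform on compact sets. -/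
lemma tendstoUniformlyOn_of_lipschitz {κ : Type*} {l : Filter κ} {F : κ → E → ℂ} {f : E → ℂ}
    {K : Set E} (hK : IsCompact K) {L : NNReal} (hF : ∀ k, LipschitzOnWith L (F k) K)
    (h : ∀ z ∈ K, Tendsto (fun k => F k z) l (𝓝 (f z))) : TendstoUniformlyOn F f l K := by
  have h1 := (EquicontinuousOn.tendsto_uniformOnFun_iff_pi' (𝔖 := {K}) (F := F) (by simpa)
    (by
      rintro _ rfl
      exact (LipschitzOnWith.uniformEquicontinuousOn F L hF).equicontinuousOn) l f).2 (by
      rw [tendsto_pi_nhds]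
      rintro ⟨z, hz⟩
      exact h z (by simpa using hz))
  exact UniformOnFun.tendsto_iff_tendstoUniformlyOn.1 h1 K rfl

/-- Limits of approximate solutions: if the bounded functions `F k` solve `dW = W α - β W` up to an
error tending to zero and converge pointwise, then they converge uniformly near each point, and the
limit is a solution. This is the compactness theorem of Arzelà and Ascoli combined with the theorem
on the differentiation of uniform limits. -/
theorem exists_nhds_tendstoUniformlyOn [FiniteDimensional ℝ E] [I.Boundaryless]
    [IsManifold I ∞ M] {κ : Type*} {l : Filter κ} [l.NeBot]
    {α β : ∀ x : M, TangentSpace I x →ₗ[ℝ] Mat m} {s : Set M} (hs : IsOpen s)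
    (hα : SmoothFormOn I α s) (hβ : SmoothFormOn I β s) {F : κ → M → Mat m} {f : M → Mat m}
    (hF : ∀ k, ∀ x ∈ s, MDiffMatAt I (F k) x) (hb : ∀ k, ∀ x ∈ s, ∀ a b, ‖F k x a b‖ ≤ 1)
    (hlim : ∀ x ∈ s, ∀ a b, Tendsto (fun k => F k x a b) l (𝓝 (f x a b)))
    {x₀ : M} (hx₀ : x₀ ∈ s) {ε : κ → ℝ} (hε0 : ∀ k, 0 ≤ ε k)
    {c₀ : ℝ} (hc₀ : 0 ≤ c₀) (hε1 : ∀ k, ε k ≤ c₀) (hε : Tendsto ε l (𝓝 0))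
    (herr : ∀ k, ∀ z ∈ (extChartAt I x₀).target, (extChartAt I x₀).symm z ∈ s → ∀ (w : E) a b,
      ‖(dMat I (F k) ((extChartAt I x₀).symm z)
          (mfderiv 𝓘(ℝ, E) I (extChartAt I x₀).symm z w)
        - commForm (F k) α β ((extChartAt I x₀).symm z)
          (mfderiv 𝓘(ℝ, E) I (extChartAt I x₀).symm z w)) a b‖ ≤ ε k * ‖w‖) :
    ∃ U ∈ 𝓝 x₀, (∀ x ∈ U, SolvesAt f α β x) ∧
      ∀ a b, TendstoUniformlyOn (fun k x => F k x a b) (fun x => f x a b) l U := by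
  set e := extChartAt I x₀ with he
  set O := e.target ∩ e.symm ⁻¹' s with hO
  have hOo : IsOpen O := isOpen_chart_preimage hs x₀
  have hz₀ : e x₀ ∈ O := ⟨mem_extChartAt_target x₀, by
    rw [mem_preimage, he, (extChartAt I x₀).left_inv (mem_extChartAt_source x₀)]
    exact hx₀⟩
  obtain ⟨r, hr, hrO⟩ := Metric.nhds_basis_closedBall.mem_iff.1 (hOo.mem_nhds hz₀)
  have hB : IsCompact (Metric.closedBall (e x₀) r) := isCompact_closedBall _ _
  -- a common bound for the coefficients
  have hK : ∃ K : ℝ, 0 ≤ K ∧ ∀ z ∈ Metric.closedBall (e x₀) r, ∀ a b,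
      ‖chartEntry α x₀ a b z‖ ≤ K ∧ ‖chartEntry β x₀ a b z‖ ≤ K := by
    have hc : ContinuousOn (fun z => ∑ a, ∑ b, (‖chartEntry α x₀ a b z‖ + ‖chartEntry β x₀ a b z‖))
        (Metric.closedBall (e x₀) r) :=
      continuousOn_finsetSum _ fun a _ => continuousOn_finsetSum _ fun b _ =>
        ((continuousOn_chartEntry hα x₀ a b).mono hrO).norm.add
          ((continuousOn_chartEntry hβ x₀ a b).mono hrO).norm
    obtain ⟨K, hK⟩ := hB.exists_bound_of_continuousOn hc
    refine ⟨K, (norm_nonneg _).trans (hK (e x₀) (Metric.mem_closedBall_self hr.le)),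
      fun z hz a b => ?_⟩
    have h1 : ‖chartEntry α x₀ a b z‖ + ‖chartEntry β x₀ a b z‖ ≤ K := by
      refine le_trans ?_ ((Real.le_norm_self _).trans (hK z hz))
      refine le_trans ?_ (Finset.single_le_sum (f := fun a => ∑ b, (‖chartEntry α x₀ a b z‖
        + ‖chartEntry β x₀ a b z‖)) (fun a _ => by positivity) (Finset.mem_univ a))
      exact Finset.single_le_sum (f := fun b => ‖chartEntry α x₀ a b z‖
        + ‖chartEntry β x₀ a b z‖) (fun b _ => by positivity) (Finset.mem_univ b)
    exact ⟨by linarith [norm_nonneg (chartEntry β x₀ a b z)],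
      by linarith [norm_nonneg (chartEntry α x₀ a b z)]⟩
  obtain ⟨K, hK0, hK⟩ := hK
  have hcomm : ∀ (V : M → Mat m) (η : ℝ), ∀ z ∈ Metric.closedBall (e x₀) r,
      (∀ a b, ‖V (e.symm z) a b‖ ≤ η) → ∀ a b, ‖chartComm V α β x₀ a b z‖ ≤ m * (2 * K) * η := by
    intro V η z hz hV a b
    have hη : 0 ≤ η := (norm_nonneg _).trans (hV a b)
    rw [chartComm_eq]
    refine (norm_sum_le _ _).trans ?_
    have : ∀ c ∈ Finset.univ, ‖V (e.symm z) a c • chartEntry α x₀ c b z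
        - V (e.symm z) c b • chartEntry β x₀ a c z‖ ≤ 2 * K * η := by
      intro c _
      refine (norm_sub_le _ _).trans ?_
      rw [norm_smul, norm_smul]
      have h1 := mul_le_mul (hV a c) (hK z hz c b).1 (norm_nonneg _) hη
      have h2 := mul_le_mul (hV c b) (hK z hz a c).2 (norm_nonneg _) hη
      linarith
    refine (Finset.sum_le_card_nsmul _ _ _ this).trans_eq ?_
    simp [mul_assoc]
  have hder : ∀ k, ∀ z ∈ O, ∀ a b, DifferentiableAt ℝ (fun z => F k (e.symm z) a b) z :=
    fun k z hz a b => (chart_hasFDerivAt hz.1 (hF k _ hz.2) a b).1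
  have hderr : ∀ k, ∀ z ∈ O, ∀ a b, ‖fderiv ℝ (fun z => F k (e.symm z) a b) z
      - chartComm (F k) α β x₀ a b z‖ ≤ ε k := by
    intro k z hz a b
    refine ContinuousLinearMap.opNorm_le_bound _ (hε0 k) fun w => ?_
    rw [sub_apply, (chart_hasFDerivAt hz.1 (hF k _ hz.2) a b).2,
      chartComm_apply, ← Matrix.sub_apply]
    exact herr k z hz.1 hz.2 w a b
  have hunif : ∀ a b, TendstoUniformlyOn (fun k z => F k (e.symm z) a b)
      (fun z => f (e.symm z) a b) l (Metric.closedBall (e x₀) r) := by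
    intro a b
    refine tendstoUniformlyOn_of_lipschitz hB (L := Real.toNNReal (m * (2 * K) * 1 + c₀))
      (fun k => ?_) fun z hz => hlim _ (hrO hz).2 a b
    refine LipschitzOnWith.of_dist_le_mul fun z hz z' hz' => ?_
    rw [dist_eq_norm, dist_eq_norm, Real.coe_toNNReal _ (by positivity)]
    refine (convex_closedBall _ _).norm_image_sub_le_of_norm_fderiv_le
      (fun y hy => hder k y (hrO hy) a b) (fun y hy => ?_) hz' hz
    have h1 := hderr k y (hrO hy) a b
    have h2 := hcomm (F k) 1 y hy (hb k _ (hrO hy).2) a b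
    calc _ = ‖(fderiv ℝ (fun z => F k (e.symm z) a b) y - chartComm (F k) α β x₀ a b y)
          + chartComm (F k) α β x₀ a b y‖ := by rw [sub_add_cancel]
      _ ≤ _ := (norm_add_le _ _).trans (by linarith [hε1 k])
  have hfd : ∀ a b, ∀ z ∈ Metric.ball (e x₀) r,
      HasFDerivAt (fun z => f (e.symm z) a b) (chartComm f α β x₀ a b z) z := by
    intro a b z hz
    refine hasFDerivAt_of_tendstoUniformlyOn (f := fun k z => F k (e.symm z) a b)
      (f' := fun k z => fderiv ℝ (fun z => F k (e.symm z) a b) z)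
      (g' := fun z => chartComm f α β x₀ a b z) (l := l) Metric.isOpen_ball ?_
      (fun k y hy => (hder k y (hrO (Metric.ball_subset_closedBall hy)) a b).hasFDerivAt)
      (fun y hy => hlim _ (hrO (Metric.ball_subset_closedBall hy)).2 a b) hz
    rw [Metric.tendstoUniformlyOn_iff]
    intro δ hδ
    set η : ℝ := δ / (2 * (m * (2 * K) + 1)) with hη
    have hη0 : 0 < η := by positivity
    have h1 : ∀ᶠ k in l, ∀ c d, ∀ y ∈ Metric.closedBall (e x₀) r,
        dist (f (e.symm y) c d) (F k (e.symm y) c d) < η :=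
      eventually_all.2 fun c => eventually_all.2 fun d =>
        Metric.tendstoUniformlyOn_iff.1 (hunif c d) η hη0
    filter_upwards [h1, hε.eventually_lt_const (half_pos hδ)] with k hk hεk y hy
    have hy' := Metric.ball_subset_closedBall hy
    have h2 : chartComm f α β x₀ a b y - chartComm (F k) α β x₀ a b y =
        chartComm (fun x => f x - F k x) α β x₀ a b y := by
      ext w
      simp only [sub_apply, chartComm_apply, commForm_apply]
      refine (Matrix.sub_apply _ _ _ _).symm.trans (congrArg (fun A : Mat m => A a b) ?_)
      rw [sub_mul, mul_sub]
      abel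
    have h3 := hcomm (fun x => f x - F k x) η y hy' (fun c d => by
      rw [Matrix.sub_apply, ← dist_eq_norm]; exact (hk c d y hy').le) a b
    rw [dist_eq_norm]
    have h4 : m * (2 * K) * η ≤ δ / 2 := by
      have : (m * (2 * K) + 1) * η = δ / 2 := by rw [hη]; field_simp
      nlinarith
    calc _ = ‖(chartComm f α β x₀ a b y - chartComm (F k) α β x₀ a b y)
          - (fderiv ℝ (fun z => F k (e.symm z) a b) y - chartComm (F k) α β x₀ a b y)‖ := by
          congr 1; abel
      _ ≤ m * (2 * K) * η + ε k := (norm_sub_le _ _).trans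
          (add_le_add (by rw [h2]; exact h3) (hderr k y (hrO hy') a b))
      _ < δ := by linarith
  refine ⟨e.source ∩ e ⁻¹' Metric.ball (e x₀) r, ?_, fun x hx => ?_, fun a b => ?_⟩
  · exact ((continuousOn_extChartAt x₀).isOpen_inter_preimage (isOpen_extChartAt_source x₀)
      Metric.isOpen_ball).mem_nhds ⟨mem_extChartAt_source x₀, Metric.mem_ball_self hr⟩
  · exact dMat_eq_of_chart hx.1 fun a b => hfd a b _ hx.2
  · rw [Metric.tendstoUniformlyOn_iff]
    intro δ hδ
    filter_upwards [Metric.tendstoUniformlyOn_iff.1 (hunif a b) δ hδ] with k hk x hx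
    have := hk (e x) (Metric.ball_subset_closedBall hx.2)
    rwa [e.left_inv hx.1] at this

end Limits

/-! ### Pull-backs to the covering and restrictions to slices -/

namespace UnitaryBundle

section Lifts

open Set Filter Topology

variable {E H M : Type*} [NormedAddCommGroup E] [NormedSpace ℝ E] [TopologicalSpace H]
  [TopologicalSpace M] [ChartedSpace H M] {I : ModelWithCorners ℝ E H} {m : ℕ} {ι : Type*}
  {E' H' N : Type*} [NormedAddCommGroup E'] [NormedSpace ℝ E'] [TopologicalSpace H']
  [TopologicalSpace N] [ChartedSpace H' N] {J : ModelWithCorners ℝ E' H'}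
  {E'' H'' N' : Type*} [NormedAddCommGroup E''] [NormedSpace ℝ E''] [TopologicalSpace H'']
  [TopologicalSpace N'] [ChartedSpace H'' N'] {J' : ModelWithCorners ℝ E'' H''}
  {P : UnitaryBundle I M m ι}

lemma lrep_indexAt (φ : P.gaugeGroup) (x : M) : lrep φ (P.indexAt x) x = φ.1 x := rep_self _ x

lemma gauge_ext {φ ψ : P.gaugeGroup} (h : ∀ x, φ.1 x = ψ.1 x) : φ = ψ := Subtype.ext (funext h)

lemma lrep_mdiff (φ : P.gaugeGroup) {i : ι} {x : M} (hx : x ∈ P.baseSet i) :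
    MDiffMatAt I (lrep φ i) x := (lrep_smooth φ i).mdiff (P.isOpen_baseSet i) hx

variable [IsManifold I ∞ M] [IsManifold J ∞ N] [IsManifold J' ∞ N']

lemma contMDiff_shift : ContMDiff (I.prod 𝓘(ℝ, ℝ)) (I.prod 𝓘(ℝ, ℝ)) ∞
    (fun p : M × ℝ => (p.1, p.2 + 2 * Real.pi)) :=
  contMDiff_fst.prodMk (contMDiff_snd.add contMDiff_const)

lemma contMDiff_sliceAt (t : ℝ) : ContMDiff I (I.prod 𝓘(ℝ, ℝ)) ∞ (fun x : M => (x, t)) :=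
  contMDiff_id.prodMk contMDiff_const

namespace Connection

/-- The gauge `φ` takes `A` to `A'` if and only if it solves the linear equation
`dφ = φ A' - A φ` in the local frames. -/
lemma act_eq_iff {A A' : Connection P} {φ : P.gaugeGroup} :
    A.act φ = A' ↔ ∀ i, ∀ x ∈ P.baseSet i, ∀ v,
      dMat I (lrep φ i) x v = lrep φ i x * A'.form i x v - A.form i x v * lrep φ i x := by
  constructor
  · rintro rfl i x hx v
    rw [act_form _ _ hx, gaugeForm_apply, ← mul_assoc, mul_star_lrep hx, one_mul,
      add_sub_cancel_left]
  · intro h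
    refine ext_on fun i x hx v => ?_
    rw [act_form _ _ hx, gaugeForm_apply, h i x hx, add_sub_cancel, ← mul_assoc,
      star_mul_lrep hx, one_mul]

lemma mem_stabilizer_iff {A : Connection P} {φ : P.gaugeGroup} :
    φ ∈ A.stabilizer ↔ A.act φ = A := by
  rw [act_eq_iff]
  refine forall₄_congr fun i x hx v => ?_
  change dMat I (lrep φ i) x v + (A.form i x v * lrep φ i x - lrep φ i x * A.form i x v) = 0 ↔ _
  rw [add_eq_zero_iff_eq_neg, neg_sub]

lemma pullback_form_apply (A : Connection P) (k : N → M) (hk : ContMDiff J I ∞ k) (i : ι) (y : N)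
    (v : TangentSpace J y) :
    (A.pullback k hk).form i y v = A.form i (k y) (mfderiv J I k y v) := rfl

/-- Pull-backs are functorial. The hypotheses allow for maps which agree with the composition
without being syntactically equal to it. -/
lemma pullback_pullback_form (A : Connection P) {k : N → M} (hk : ContMDiff J I ∞ k) {l : N' → N}
    (hl : ContMDiff J' J ∞ l) {k' : N' → M} (hk' : ContMDiff J' I ∞ k') (h : ∀ y, k' y = k (l y))
    (i : ι) (y : N') (v : TangentSpace J' y) :
    ((A.pullback k hk).pullback l hl).form i y v = (A.pullback k' hk').form i y v := by
  obtain rfl : k' = k ∘ l := funext h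
  simp only [pullback_form_apply]
  congr 1
  exact (congrArg (fun L => L v) (mfderiv_comp y (hk.mdifferentiableAt (by simp))
    (hl.mdifferentiableAt (by simp)))).symm

/-- The pull-back of a connection on `M` to `M × ℝ`. -/
def cyl (B : Connection P) : Connection P.onLine := B.pullback Prod.fst contMDiff_fst

/-- The pull-back of a connection on `M × S¹` to the covering `M × ℝ`. -/
def lift (A : Connection P.onCircle) : Connection P.onLine := A.pullback (wrap M) contMDiff_wrap

/-- The restriction of a connection on `M × ℝ` to the slice `M × {t}`. -/
def slice (A : Connection P.onLine) (t : ℝ) : Connection P :=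
  A.pullback (fun x : M => (x, t)) (contMDiff_sliceAt t)

end Connection

/-- The pull-back of a gauge on `M` to `M × ℝ`. -/
def cylGauge (ψ : P.gaugeGroup) : P.onLine.gaugeGroup := pullGauge ψ Prod.fst contMDiff_fst

/-- The pull-back of a gauge on `M` to `M × S¹`. -/
def circGauge (ψ : P.gaugeGroup) : P.onCircle.gaugeGroup := pullGauge ψ Prod.fst contMDiff_fst

/-- The pull-back of a gauge on `M × S¹` to the covering `M × ℝ`. -/
def liftGauge (φ : P.onCircle.gaugeGroup) : P.onLine.gaugeGroup :=
  pullGauge φ (wrap M) contMDiff_wrap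

/-- The restriction of a gauge on `M × ℝ` to the slice `M × {t}`. -/
def sliceGauge (u : P.onLine.gaugeGroup) (t : ℝ) : P.gaugeGroup :=
  pullGauge u (fun x : M => (x, t)) (contMDiff_sliceAt t)

lemma sliceGauge_mul (u v : P.onLine.gaugeGroup) (t : ℝ) :
    sliceGauge (u * v) t = sliceGauge u t * sliceGauge v t := rfl

lemma sliceGauge_inv (u : P.onLine.gaugeGroup) (t : ℝ) :
    sliceGauge u⁻¹ t = (sliceGauge u t)⁻¹ := rfl

lemma sliceGauge_cyl (ψ : P.gaugeGroup) (t : ℝ) : sliceGauge (cylGauge ψ) t = ψ := rfl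

lemma cylGauge_mul (ψ ψ' : P.gaugeGroup) : cylGauge (ψ * ψ') = cylGauge ψ * cylGauge ψ' := rfl

lemma cylGauge_inv (ψ : P.gaugeGroup) : cylGauge ψ⁻¹ = (cylGauge ψ)⁻¹ := rfl

/-- The translate of a gauge on `M × ℝ` by `2π`. -/
def shiftGauge (u : P.onLine.gaugeGroup) : P.onLine.gaugeGroup :=
  pullGauge u (fun p : M × ℝ => (p.1, p.2 + 2 * Real.pi)) contMDiff_shift

namespace Connection

lemma cyl_act (B : Connection P) (ψ : P.gaugeGroup) : (B.act ψ).cyl = B.cyl.act (cylGauge ψ) :=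
  B.pullback_act ψ _ _

lemma lift_act (A : Connection P.onCircle) (φ : P.onCircle.gaugeGroup) :
    (A.act φ).lift = A.lift.act (liftGauge φ) := A.pullback_act φ _ _

lemma slice_act (A : Connection P.onLine) (φ : P.onLine.gaugeGroup) (t : ℝ) :
    (A.act φ).slice t = (A.slice t).act (sliceGauge φ t) := A.pullback_act φ _ _

/-- The translate of a connection on `M × ℝ` by `2π`. -/
def shift (A : Connection P.onLine) : Connection P.onLine :=
  A.pullback (fun p : M × ℝ => (p.1, p.2 + 2 * Real.pi)) contMDiff_shift

lemma shift_act (A : Connection P.onLine) (φ : P.onLine.gaugeGroup) :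
    (A.act φ).shift = A.shift.act (shiftGauge φ) := A.pullback_act φ _ _

lemma shift_cyl (B : Connection P) : B.cyl.shift = B.cyl :=
  ext_on fun i x _ v => B.pullback_pullback_form contMDiff_fst contMDiff_shift
    contMDiff_fst (fun _ => rfl) i x v

lemma shift_lift (A : Connection P.onCircle) : A.lift.shift = A.lift :=
  ext_on fun i x _ v => A.pullback_pullback_form contMDiff_wrap contMDiff_shift
    contMDiff_wrap (fun y => Prod.ext rfl (Circle.periodic_exp y.2).symm) i x v

lemma slice_cyl (B : Connection P) (t : ℝ) : B.cyl.slice t = B :=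
  ext_on fun i x _ v => by
    refine (B.pullback_pullback_form contMDiff_fst (contMDiff_sliceAt t) contMDiff_id (fun _ => rfl)
      i x v).trans ?_
    rw [pullback_form_apply, mfderiv_id]
    rfl

lemma slice_lift (A : Connection P.onCircle) {t : ℝ} (ht : Circle.exp t = 1) :
    A.lift.slice t = A.atZero :=
  ext_on fun i x _ v => A.pullback_pullback_form contMDiff_wrap (contMDiff_sliceAt t)
    contMDiff_slice (fun _ => Prod.ext rfl ht.symm) i x v

end Connection

end Lifts

end UnitaryBundle

/-! ### Connections over the circle and gauges on the covering -/

namespace UnitaryBundle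

section Covers

open Set Filter Topology

variable {E H M : Type*} [NormedAddCommGroup E] [NormedSpace ℝ E] [TopologicalSpace H]
  [TopologicalSpace M] [ChartedSpace H M] {I : ModelWithCorners ℝ E H} {m : ℕ} {ι : Type*}
  {P : UnitaryBundle I M m ι}

lemma rep_mul_star {i : ι} {x : M} (hx : x ∈ P.baseSet i)
    (s : M → Matrix.unitaryGroup (Fin m) ℂ) :
    P.rep i (fun x => (s x : Mat m)) x * star (P.rep i (fun x => (s x : Mat m)) x) = 1 := by
  rw [← rep_star hx, ← rep_mul hx, ← rep_one hx]
  simp only [rep]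
  rw [Matrix.mem_unitaryGroup_iff.1 (s x).2]

variable [IsManifold I ∞ M]

namespace Connection

lemma cyl_form_time (B : Connection P) (i : ι) (x : M) (t : ℝ) :
    B.cyl.form i (x, t) ((0, 1) : E × ℝ) = 0 := by
  have h : mfderiv (I.prod 𝓘(ℝ, ℝ)) I Prod.fst (x, t) ((0, 1) : E × ℝ) = (0 : E) := by
    rw [mfderiv_fst]; rfl
  refine (congrArg (B.form i x) h).trans (map_zero _)

/-- A gauge on `M × ℝ` which fixes the pull-back of a connection on `M` is the pull-back of a gauge
on `M` fixing that connection. -/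
lemma eq_cylGauge_of_act_cyl_eq {B : Connection P} {h : P.onLine.gaugeGroup}
    (hh : B.cyl.act h = B.cyl) :
    sliceGauge h 0 ∈ B.stabilizer ∧ h = cylGauge (sliceGauge h 0) := by
  constructor
  · rw [mem_stabilizer_iff]
    have := slice_act B.cyl h 0
    rwa [hh, slice_cyl, eq_comm] at this
  · refine gauge_ext fun ⟨x, t⟩ => ?_
    have hx := P.mem_baseSet_at x
    have h1 : ∀ s, lrep h (P.indexAt x) (x, s) = (h.1 (x, s) : Mat m) := fun s =>
      lrep_indexAt h (x, s)
    have h2 : ∀ a b, (h.1 (x, t) : Mat m) a b = (h.1 (x, 0) : Mat m) a b := by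
      intro a b
      have h3 : ∀ s, HasDerivAt (fun s => lrep h (P.indexAt x) (x, s) a b) 0 s := fun s => by
        have h4 := (lrep_mdiff h (i := P.indexAt x) (x := (x, s)) hx).hasDerivAt a b
        have h5 : dMat (I.prod 𝓘(ℝ, ℝ)) (lrep h (P.indexAt x)) (x, s) ((0, 1) : E × ℝ) = 0 :=
          (act_eq_iff.1 hh (P.indexAt x) (x, s) hx ((0, 1) : E × ℝ)).trans (by
            rw [cyl_form_time, mul_zero, zero_mul, sub_zero])
        rwa [h5] at h4
      have h5 := is_const_of_deriv_eq_zero (fun s => (h3 s).differentiableAt)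
        (fun s => (h3 s).deriv) t 0
      rwa [h1, h1] at h5
    exact Subtype.ext (Matrix.ext h2)

end Connection

/-- The gauge `u` on the covering `M × ℝ` of `M × S¹` exhibits `A` as obtained
from `B`: it is the identity at time `0` and takes the pull-back of `B` to the pull-back of `A`.
This is the notion of `A = u(B)` with the admissible gauge `u` replaced by its extension to all
times. -/
structure IsCover (B : Connection P) (A : Connection P.onCircle) (u : P.onLine.gaugeGroup) :
    Prop where
  initial : sliceGauge u 0 = 1
  act_eq : B.cyl.act u = A.lift

/-- The value of a gauge on `M × ℝ` at time `2π`. It is called the holonomy if the gauge exhibits a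
connection on `M × S¹` as obtained from a connection on `M`. -/
def hol (u : P.onLine.gaugeGroup) : P.gaugeGroup := sliceGauge u (2 * Real.pi)

lemma circleExp_two_pi : Circle.exp (2 * Real.pi) = 1 := by simp

/-- The restriction of a gauge on `M × S¹` to the slice `M × {t = 0}`. -/
def gaugeAtZero (φ : P.onCircle.gaugeGroup) : P.gaugeGroup :=
  pullGauge φ (fun x : M => (x, (1 : Circle))) contMDiff_slice

lemma sliceGauge_lift (φ : P.onCircle.gaugeGroup) {t : ℝ} (ht : Circle.exp t = 1) :
    sliceGauge (liftGauge φ) t = gaugeAtZero φ := by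
  refine gauge_ext fun x => ?_
  change φ.1 (x, Circle.exp t) = φ.1 (x, 1)
  rw [ht]

namespace IsCover

variable {B : Connection P} {A : Connection P.onCircle} {u : P.onLine.gaugeGroup}

lemma atZero_eq (h : IsCover B A u) : A.atZero = B := by
  rw [← Connection.slice_lift A (t := 0) (by simp), ← h.act_eq, Connection.slice_act,
    Connection.slice_cyl, h.initial, Connection.act_one]

/-- The holonomy fixes `B`, and `u(t + 2π) = u(2π) u(t)`: both pull-backs are invariant under the
translation by `2π`, so that `u(t + 2π) u(t)⁻¹` fixes the pull-back of `B`, and hence does not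
depend on `t`. -/
lemma hol_mem_shift (h : IsCover B A u) :
    hol u ∈ B.stabilizer ∧ shiftGauge u = cylGauge (hol u) * u := by
  have h1 : B.cyl.act (shiftGauge u * u⁻¹) = B.cyl := by
    rw [← Connection.act_act, ← Connection.shift_cyl, ← Connection.shift_act, h.act_eq,
      Connection.shift_lift, ← h.act_eq, Connection.act_act, mul_inv_cancel, Connection.act_one,
      Connection.shift_cyl]
  have h2 : sliceGauge (shiftGauge u * u⁻¹) 0 = hol u := by
    rw [sliceGauge_mul, sliceGauge_inv, h.initial, inv_one, mul_one]
    refine gauge_ext fun x => ?_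
    change u.1 (x, 0 + 2 * Real.pi) = u.1 (x, 2 * Real.pi)
    rw [zero_add]
  have h3 := Connection.eq_cylGauge_of_act_cyl_eq h1
  rw [h2] at h3
  exact ⟨h3.1, by rw [← h3.2, inv_mul_cancel_right]⟩

/-- A gauge transformation of `A` acts on the data `B`, `u`, too. -/
lemma act (h : IsCover B A u) (φ : P.onCircle.gaugeGroup) :
    IsCover (B.act (gaugeAtZero φ)) (A.act φ)
      (cylGauge (gaugeAtZero φ)⁻¹ * u * liftGauge φ) where
  initial := by
    rw [sliceGauge_mul, sliceGauge_mul, h.initial, sliceGauge_cyl, sliceGauge_lift φ (by simp),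
      mul_one, inv_mul_cancel]
  act_eq := by
    rw [Connection.cyl_act, Connection.act_act, cylGauge_inv, mul_assoc, mul_inv_cancel_left,
      Connection.lift_act, ← h.act_eq, Connection.act_act]

lemma hol_act (u : P.onLine.gaugeGroup) (φ : P.onCircle.gaugeGroup) :
    hol (cylGauge (gaugeAtZero φ)⁻¹ * u * liftGauge φ) =
      (gaugeAtZero φ)⁻¹ * hol u * gaugeAtZero φ := by
  rw [hol, sliceGauge_mul, sliceGauge_mul, sliceGauge_cyl, sliceGauge_lift φ circleExp_two_pi]
  rfl

/-- The gauge exhibiting `A` as obtained from `B` is unique. -/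
lemma unique {u' : P.onLine.gaugeGroup} (h : IsCover B A u) (h' : IsCover B A u') : u = u' := by
  have h1 : B.cyl.act (u * u'⁻¹) = B.cyl := by
    rw [← Connection.act_act, h.act_eq, ← h'.act_eq, Connection.act_act, mul_inv_cancel,
      Connection.act_one]
  have h2 := (Connection.eq_cylGauge_of_act_cyl_eq h1).2
  rw [sliceGauge_mul, sliceGauge_inv, h.initial, h'.initial, inv_one, mul_one] at h2
  exact mul_inv_eq_one.1 h2

/-- If `A` and `φ(A)` both arise from `B`, then `φ` restricts to a gauge fixing `B` which conjugates
the holonomies into each other. -/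
lemma gaugeAtZero_mem {A' : Connection P.onCircle} {u' : P.onLine.gaugeGroup}
    (h : IsCover B A u) (h' : IsCover B A' u') {φ : P.onCircle.gaugeGroup} (hφ : A' = A.act φ) :
    gaugeAtZero φ ∈ B.stabilizer ∧ hol u * gaugeAtZero φ = gaugeAtZero φ * hol u' := by
  subst hφ
  have h1 := h.act φ
  have hB : B.act (gaugeAtZero φ) = B := by rw [← h1.atZero_eq, h'.atZero_eq]
  rw [hB] at h1
  refine ⟨Connection.mem_stabilizer_iff.2 hB, ?_⟩
  rw [← h1.unique h', hol_act, ← mul_assoc, ← mul_assoc, mul_inv_cancel, one_mul]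

end IsCover

end Covers

/-! ### Descent from the covering to the circle -/

section Descent

open Set Filter Topology

variable {E H M : Type*} [NormedAddCommGroup E] [NormedSpace ℝ E] [TopologicalSpace H]
  [TopologicalSpace M] [ChartedSpace H M] {I : ModelWithCorners ℝ E H} {m : ℕ} {ι : Type*}
  {P : UnitaryBundle I M m ι}

/-- A section of the covering `ℝ → S¹` which is smooth near the point `z₀`. -/
def circleSection (z₀ z : Circle) : ℝ := Complex.arg ((z : ℂ) * star (z₀ : ℂ)) + Complex.arg z₀

lemma exp_circleSection (z₀ z : Circle) : Circle.exp (circleSection z₀ z) = z := by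
  have h : ((z : ℂ) * star (z₀ : ℂ)) = ((z * z₀⁻¹ : Circle) : ℂ) := by
    rw [Circle.coe_mul, Circle.coe_inv_eq_conj]; rfl
  rw [circleSection, h, Circle.exp_add, Circle.exp_arg, Circle.exp_arg, inv_mul_cancel_right]

lemma contMDiffAt_circleSection (z₀ : Circle) :
    ContMDiffAt (𝓡 1) 𝓘(ℝ, ℝ) ∞ (circleSection z₀) z₀ := by
  have h1 : ContDiffAt ℝ ∞ (fun w : ℂ => (Complex.log (w * star (z₀ : ℂ))).im
      + Complex.arg z₀) (z₀ : ℂ) := by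
    have h2 : ContDiffAt ℝ ∞ Complex.log ((z₀ : ℂ) * star (z₀ : ℂ)) := by
      refine (Complex.contDiffAt_log ?_).restrict_scalars ℝ
      have : (z₀ : ℂ) * star (z₀ : ℂ) = 1 := by
        rw [Complex.star_def, Complex.mul_conj, Circle.normSq_coe, Complex.ofReal_one]
      rw [this]; exact Complex.one_mem_slitPlane
    have h3 : ContDiffAt ℝ ∞ (fun w : ℂ => w * star (z₀ : ℂ)) (z₀ : ℂ) :=
      contDiffAt_id.mul contDiffAt_const
    exact (Complex.imCLM.contDiff.contDiffAt.comp (z₀ : ℂ) (h2.comp (z₀ : ℂ) h3)).add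
      contDiffAt_const
  have h4 : ContMDiffAt (𝓡 1) 𝓘(ℝ, ℂ) ∞ (fun z : Circle => (z : ℂ)) z₀ :=
    have := finrank_real_complex_fact'
    contMDiff_coe_sphere.contMDiffAt
  refine (ContMDiffAt.comp z₀ h1.contMDiffAt h4).congr_of_eventuallyEq
    (Eventually.of_forall fun z => ?_)
  exact congrArg (· + Complex.arg (z₀ : ℂ)) (Complex.log_im _).symm

variable [IsManifold I ∞ M]

/-- The section of `M × ℝ → M × S¹` given by `circleSection`. -/
lemma contMDiffAt_section (x : M) (z₀ : Circle) :
    ContMDiffAt (I.prod (𝓡 1)) (I.prod 𝓘(ℝ, ℝ)) ∞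
      (fun p : M × Circle => (p.1, circleSection z₀ p.2)) (x, z₀) :=
  contMDiffAt_fst.prodMk ((contMDiffAt_circleSection z₀).comp (x, z₀) contMDiffAt_snd)

/-- The covering `M × ℝ → M × S¹` is a submersion onto `M × S¹`. -/
lemma mfderiv_wrap_surjective (x : M) (z₀ : Circle)
    (v : TangentSpace (I.prod (𝓡 1)) (x, z₀)) :
    ∃ t : ℝ, Circle.exp t = z₀ ∧ ∃ w : E × ℝ,
      (mfderiv (I.prod 𝓘(ℝ, ℝ)) (I.prod (𝓡 1)) (wrap M) (x, t) w : E × EuclideanSpace ℝ (Fin 1))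
        = v := by
  refine ⟨circleSection z₀ z₀, exp_circleSection z₀ z₀, mfderiv (I.prod (𝓡 1)) (I.prod 𝓘(ℝ, ℝ))
      (fun p : M × Circle => (p.1, circleSection z₀ p.2)) (x, z₀) v, ?_⟩
  have h := mfderiv_comp (I := I.prod (𝓡 1)) (I' := I.prod 𝓘(ℝ, ℝ)) (I'' := I.prod (𝓡 1)) (x, z₀)
    (g := wrap M) (f := fun p : M × Circle => (p.1, circleSection z₀ p.2))
    (contMDiff_wrap.mdifferentiable (by simp) _)
    ((contMDiffAt_section x z₀).mdifferentiableAt (by simp))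
  have h2 : wrap M ∘ (fun p : M × Circle => (p.1, circleSection z₀ p.2)) = id :=
    funext fun p => Prod.ext rfl (exp_circleSection z₀ p.2)
  rw [h2, mfderiv_id] at h
  exact (DFunLike.congr_fun h v).symm

/-- A connection on `M × S¹` is determined by its pull-back to the covering. -/
lemma Connection.lift_injective {A A' : Connection P.onCircle} (h : A.lift = A'.lift) : A = A' := by
  refine ext_on fun i ⟨x, z⟩ _ v => ?_
  obtain ⟨t, rfl, w, rfl⟩ := mfderiv_wrap_surjective x z v
  exact congrArg (fun C : Connection P.onLine => C.form i (x, t) w) h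

/-- A `2π`-periodic gauge on `M × ℝ` descends to `M × S¹`. -/
lemma exists_liftGauge_eq {u : P.onLine.gaugeGroup} (h : shiftGauge u = u) :
    ∃ φ : P.onCircle.gaugeGroup, liftGauge φ = u := by
  have h1 : ∀ x t, u.1 (x, t + 2 * Real.pi) = u.1 (x, t) := fun x t =>
    congrArg (fun v : P.onLine.gaugeGroup => v.1 (x, t)) h
  have h2 : ∀ x s t, Circle.exp s = Circle.exp t → u.1 (x, s) = u.1 (x, t) := by
    intro x s t hst
    obtain ⟨k, rfl⟩ := Circle.exp_eq_exp.1 hst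
    have h3 : Function.Periodic (fun t => u.1 (x, t)) (2 * Real.pi) := h1 x
    exact h3.int_mul k t
  refine ⟨⟨fun p => u.1 (p.1, Complex.arg p.2), fun i a b p hp => ?_⟩, gauge_ext fun ⟨x, t⟩ => ?_⟩
  · obtain ⟨x, z₀⟩ := p
    have h4 : ContMDiffAt (I.prod 𝓘(ℝ, ℝ)) 𝓘(ℝ, ℂ) ∞ (fun q => lrep u i q a b)
        (x, circleSection z₀ z₀) :=
      (lrep_smooth u i a b).contMDiffAt ((P.onLine.isOpen_baseSet i).mem_nhds hp.1)
    refine ((h4.comp (x, z₀) (contMDiffAt_section x z₀)).congr_of_eventuallyEq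
      (Eventually.of_forall fun q => ?_)).contMDiffWithinAt
    simp only [Function.comp_apply, lrep, rep, val]
    rw [h2 q.1 (circleSection z₀ q.2) (Complex.arg q.2)
      (by rw [exp_circleSection, Circle.exp_arg])]
    rfl
  · exact h2 x _ _ (Circle.exp_arg _)

/-- Two connections on `M × S¹` arising from `B` are gauge equivalent if their holonomies
are conjugate by an element of the stabilizer of `B`. The connecting gauge restricts to that
element. -/
lemma IsCover.exists_act_eq {B : Connection P} {A A' : Connection P.onCircle}
    {u u' : P.onLine.gaugeGroup} (h : IsCover B A u) (h' : IsCover B A' u') {g : P.gaugeGroup}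
    (hg : g ∈ B.stabilizer) (hgu : hol u * g = g * hol u') :
    ∃ φ : P.onCircle.gaugeGroup, A' = A.act φ ∧ gaugeAtZero φ = g ∧
      liftGauge φ = u⁻¹ * cylGauge g * u' := by
  have h1 : shiftGauge (u⁻¹ * cylGauge g * u') = u⁻¹ * cylGauge g * u' := by
    calc shiftGauge (u⁻¹ * cylGauge g * u')
        = (shiftGauge u)⁻¹ * cylGauge g * shiftGauge u' := rfl
      _ = u⁻¹ * (cylGauge (hol u)⁻¹ * cylGauge g * cylGauge (hol u')) * u' := by
          rw [h.hol_mem_shift.2, h'.hol_mem_shift.2, mul_inv_rev, cylGauge_inv]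
          simp only [mul_assoc]
      _ = _ := by
          rw [← cylGauge_mul, ← cylGauge_mul, mul_assoc _ g, ← hgu, inv_mul_cancel_left]
  obtain ⟨φ, hφ⟩ := exists_liftGauge_eq h1
  refine ⟨φ, Connection.lift_injective ?_, ?_, hφ⟩
  · rw [Connection.lift_act, hφ, ← h.act_eq, ← h'.act_eq, Connection.act_act, ← mul_assoc,
      ← mul_assoc, mul_inv_cancel, one_mul, ← Connection.act_act, ← Connection.cyl_act,
      Connection.mem_stabilizer_iff.1 hg]
  · rw [← sliceGauge_lift φ (t := 0) (by simp), hφ, sliceGauge_mul, sliceGauge_mul, sliceGauge_inv,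
      h.initial, h'.initial, sliceGauge_cyl, inv_one, one_mul, mul_one]

end Descent

end UnitaryBundle

/-! ### Extension of admissible gauges to the covering -/

namespace UnitaryBundle

section Extension

open Set Filter Topology

variable {E H M : Type*} [NormedAddCommGroup E] [NormedSpace ℝ E] [TopologicalSpace H]
  [TopologicalSpace M] [ChartedSpace H M] {I : ModelWithCorners ℝ E H} {m : ℕ} {ι : Type*}
  {P : UnitaryBundle I M m ι} [IsManifold I ∞ M] {B : Connection P}

lemma rep_of_mul {i : ι} {x : M} (hx : x ∈ P.baseSet i) {r s t : M → Mat m}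
    (h : r x = s x * t x) : P.rep i r x = P.rep i s x * P.rep i t x := by
  rw [← rep_mul hx]
  simp only [rep, h]

/-- The equation for gauges on `M × ℝ` taking the pull-back of `B` to the lift of `A` is invariant
under translations by periods and left multiplication by gauges fixing `B`. -/
lemma solvesAt_translate {A : Connection P.onCircle} {V : M × ℝ → Mat m} {i : ι}
    {g : P.gaugeGroup} (hg : g ∈ B.stabilizer) {c : ℝ}
    (hc : ∀ t, Circle.exp (t + c) = Circle.exp t) {x : M} {t : ℝ} (hx : x ∈ P.baseSet i)
    (h : SolvesAt (I := I.prod 𝓘(ℝ, ℝ)) V (A.lift.form i) (B.cyl.form i) (x, t + c)) :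
    SolvesAt (I := I.prod 𝓘(ℝ, ℝ)) (fun p => lrep g i p.1 * V (p.1, p.2 + c)) (A.lift.form i)
      (B.cyl.form i) (x, t) := by
  have hσ : ContMDiff (I.prod 𝓘(ℝ, ℝ)) (I.prod 𝓘(ℝ, ℝ)) ∞ (fun p : M × ℝ => (p.1, p.2 + c)) :=
    contMDiff_fst.prodMk (contMDiff_snd.add contMDiff_const)
  have h1 := MDiffMatAt.comp (J := I.prod 𝓘(ℝ, ℝ)) (k := fun p : M × ℝ => (p.1, p.2 + c))
    (y := (x, t)) h.1 (hσ.mdifferentiable (by simp) _)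
  have hA : ∀ v, A.lift.form i (x, t + c)
      (mfderiv (I.prod 𝓘(ℝ, ℝ)) (I.prod 𝓘(ℝ, ℝ)) (fun p : M × ℝ => (p.1, p.2 + c)) (x, t) v) =
        A.lift.form i (x, t) v := fun v =>
    A.pullback_pullback_form contMDiff_wrap hσ contMDiff_wrap
      (fun y => Prod.ext rfl (hc y.2).symm) i (x, t) v
  have hB : ∀ v, B.cyl.form i (x, t + c)
      (mfderiv (I.prod 𝓘(ℝ, ℝ)) (I.prod 𝓘(ℝ, ℝ)) (fun p : M × ℝ => (p.1, p.2 + c)) (x, t) v) =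
        B.cyl.form i (x, t) v := fun v =>
    B.pullback_pullback_form contMDiff_fst hσ contMDiff_fst (fun _ => rfl) i (x, t) v
  have hg1 : B.cyl.act (cylGauge g) = B.cyl := by
    rw [← Connection.cyl_act, Connection.mem_stabilizer_iff.1 hg]
  have h2 := Connection.act_eq_iff.1 hg1 i (x, t) hx
  have h3 := MDiffMatAt.mul (lrep_mdiff (cylGauge g) (i := i) (x := (x, t)) hx) h1.1
  refine ⟨h3.1, fun v => (h3.2 v).trans ?_⟩
  rw [h1.2, h.2, h2, hA, hB]
  change _ = lrep (cylGauge g) i (x, t) * V (x, t + c) * _ - _ *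
    (lrep (cylGauge g) i (x, t) * V (x, t + c))
  noncomm_ring

namespace AdmissibleGauge

/-- The extension of a `B`-admissible gauge to `M × ℝ` by `u(t + 2π) = u(2π) u(t)`. -/
def ext (u : AdmissibleGauge B) (p : M × ℝ) : Matrix.unitaryGroup (Fin m) ℂ :=
  (u.final.1.1 p.1) ^ ⌊p.2 / (2 * Real.pi)⌋ *
    u.toFun (p.1, p.2 - ⌊p.2 / (2 * Real.pi)⌋ * (2 * Real.pi))

variable (u : AdmissibleGauge B)

lemma ext_sub (x : M) (t : ℝ) (k : ℤ) :
    u.ext (x, t) = (u.final.1.1 x) ^ k * u.ext (x, t - k * (2 * Real.pi)) := by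
  have h : ⌊(t - k * (2 * Real.pi)) / (2 * Real.pi)⌋ = ⌊t / (2 * Real.pi)⌋ - k := by
    rw [sub_div, mul_div_cancel_right₀ _ Real.two_pi_pos.ne', Int.floor_sub_intCast]
  unfold ext
  dsimp only
  rw [h, ← mul_assoc (_ ^ k), ← zpow_add, add_sub_cancel, Int.cast_sub, sub_mul,
    sub_sub_sub_cancel_right]

lemma ext_of_mem_Ico {x : M} {t : ℝ} (ht : t ∈ Ico 0 (2 * Real.pi)) :
    u.ext (x, t) = u.toFun (x, t) := by
  have h : ⌊t / (2 * Real.pi)⌋ = 0 := Int.floor_eq_zero_iff.2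
    ⟨div_nonneg ht.1 Real.two_pi_pos.le, (div_lt_one Real.two_pi_pos).2 ht.2⟩
  simp [ext, h]

lemma ext_of_mem_Icc {x : M} {t : ℝ} (ht : t ∈ Icc 0 (2 * Real.pi)) :
    u.ext (x, t) = u.toFun (x, t) := by
  rcases ht.2.lt_or_eq with h | rfl
  · exact u.ext_of_mem_Ico ⟨ht.1, h⟩
  · rw [u.ext_sub x _ 1, zpow_one, Int.cast_one, one_mul, sub_self,
      u.ext_of_mem_Ico ⟨le_rfl, Real.two_pi_pos⟩, u.initial, mul_one, u.final_eq]

variable {u}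

lemma Yields.solvesAt {A : Connection P.onCircle} (h : u.Yields A) {i : ι} {x : M}
    (hx : x ∈ P.baseSet i) {t : ℝ} (ht : t ∈ Ioo 0 (2 * Real.pi)) :
    SolvesAt (I := I.prod 𝓘(ℝ, ℝ)) (P.onLine.rep i fun p => (u.toFun p : Mat m))
      (A.lift.form i) (B.cyl.form i) (x, t) := by
  have hs : IsOpen (P.onLine.baseSet i ∩ (univ ×ˢ Ioo 0 (2 * Real.pi))) :=
    (P.onLine.isOpen_baseSet i).inter (isOpen_univ.prod isOpen_Ioo)
  refine ⟨((u.smooth i).mono (inter_subset_inter_right _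
    (prod_mono_right Ioo_subset_Icc_self))).mdiff hs ⟨hx, trivial, ht⟩, fun v => ?_⟩
  have h1 : A.lift.form i (x, t) v = _ := congrArg (fun L => L v) (h i x hx t ht)
  have h2 := rep_mul_star (P := P.onLine) (i := i) (x := (x, t)) hx u.toFun
  rw [h1, gaugeForm_apply, ← mul_assoc, h2, one_mul]
  exact (add_sub_cancel_left _ _).symm

lemma rep_ext_sub (u : AdmissibleGauge B) {i : ι} {x : M} (hx : x ∈ P.baseSet i) (t : ℝ) (k : ℤ) :
    P.onLine.rep i (fun p => (u.ext p : Mat m)) (x, t) =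
      lrep (u.final.1 ^ k) i x *
        P.onLine.rep i (fun p => (u.ext p : Mat m)) (x, t - k * (2 * Real.pi)) := by
  refine rep_of_mul (P := P) hx (r := fun y => (u.ext (y, t) : Mat m))
    (s := val (u.final.1 ^ k)) (t := fun y => (u.ext (y, t - k * (2 * Real.pi)) : Mat m)) ?_
  rw [u.ext_sub x t k, Matrix.UnitaryGroup.mul_val, val, Subgroup.coe_zpow, Pi.pow_apply]

lemma rep_ext_eq (u : AdmissibleGauge B) (i : ι) {x : M} {t : ℝ}
    (ht : t ∈ Icc 0 (2 * Real.pi)) :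
    P.onLine.rep i (fun p => (u.ext p : Mat m)) (x, t) =
      P.onLine.rep i (fun p => (u.toFun p : Mat m)) (x, t) := by
  simp only [rep, u.ext_of_mem_Icc ht]

/-- The extension is continuous at time `0`: it is pieced together from two continuous functions on
the closed half-spaces `t ≥ 0` and `t ≤ 0`. -/
lemma continuousOn_rep_ext (u : AdmissibleGauge B) (i : ι) (a b : Fin m) :
    ContinuousOn (fun p => P.onLine.rep i (fun p => (u.ext p : Mat m)) p a b)
      (P.baseSet i ×ˢ Ioo (-(2 * Real.pi)) (2 * Real.pi)) := by
  set s : Set (M × ℝ) := P.baseSet i ×ˢ Ioo (-(2 * Real.pi)) (2 * Real.pi) with hs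
  have hw : ∀ a b, ContinuousOn (fun p => P.onLine.rep i (fun p => (u.toFun p : Mat m)) p a b)
      (P.baseSet i ×ˢ Icc 0 (2 * Real.pi)) := fun a b =>
    (u.smooth i a b).continuousOn.mono fun p hp => ⟨hp.1, trivial, hp.2⟩
  have h1 : ContinuousOn (fun p => P.onLine.rep i (fun p => (u.ext p : Mat m)) p a b)
      (s ∩ {p | 0 ≤ p.2}) := by
    refine ((hw a b).mono ?_).congr fun p hp => ?_
    · exact fun p hp => ⟨hp.1.1, hp.2, hp.1.2.2.le⟩
    · exact congrFun (congrFun (u.rep_ext_eq i (x := p.1) ⟨hp.2, hp.1.2.2.le⟩) a) b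
  have h2 : ContinuousOn (fun p => P.onLine.rep i (fun p => (u.ext p : Mat m)) p a b)
      (s ∩ {p | p.2 ≤ 0}) := by
    have h3 : ContinuousOn (fun p : M × ℝ => ∑ c, lrep (u.final.1 ^ (-1 : ℤ)) i p.1 a c *
        P.onLine.rep i (fun p => (u.toFun p : Mat m)) (p.1, p.2 + 2 * Real.pi) c b)
        (s ∩ {p | p.2 ≤ 0}) := by
      refine continuousOn_finsetSum _ fun c _ => ContinuousOn.mul ?_ ?_
      · exact (lrep_smooth _ i a c).continuousOn.comp continuous_fst.continuousOn
          fun p hp => hp.1.1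
      · refine (hw c b).comp (f := fun p : M × ℝ => (p.1, p.2 + 2 * Real.pi))
          (by fun_prop) fun p hp => ⟨hp.1.1, ?_, ?_⟩
        · have := hp.1.2.1; simp only; linarith
        · have : p.2 ≤ 0 := hp.2
          simp only; linarith
    refine h3.congr fun p hp => ?_
    have h4 := u.rep_ext_sub (x := p.1) (i := i) hp.1.1 p.2 (-1)
    have h5 : p.2 - ((-1 : ℤ) : ℝ) * (2 * Real.pi) = p.2 + 2 * Real.pi := by push_cast; ring
    rw [h5, u.rep_ext_eq (t := p.2 + 2 * Real.pi)] at h4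
    · exact (congrFun (congrFun h4 a) b).trans (Matrix.mul_apply ..)
    · have h6 := hp.1.2.1
      have h7 : p.2 ≤ 0 := hp.2
      exact ⟨by linarith, by linarith⟩
  intro p hp
  have h3 : s = (s ∩ {p | 0 ≤ p.2}) ∪ (s ∩ {p | p.2 ≤ 0}) := by
    rw [← inter_union_distrib_left]
    refine (inter_eq_left.2 fun q _ => ?_).symm
    exact le_total 0 q.2
  rw [h3]
  refine ContinuousWithinAt.union ?_ ?_
  · by_cases h0 : 0 ≤ p.2
    · exact h1 p ⟨hp, h0⟩
    · refine continuousWithinAt_of_notMem_closure fun hcl => h0 ?_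
      exact (isClosed_le continuous_const continuous_snd).closure_subset_iff.2
        inter_subset_right hcl
  · by_cases h0 : p.2 ≤ 0
    · exact h2 p ⟨hp, h0⟩
    · refine continuousWithinAt_of_notMem_closure fun hcl => h0 ?_
      exact (isClosed_le continuous_snd continuous_const).closure_subset_iff.2
        inter_subset_right hcl

/-- An admissible gauge yielding `A` extends to a smooth gauge on all of `M × ℝ`. The extension
solves a linear equation for `t ∉ 2πℤ`; it does so at `t = 0` by continuity, and at the other
multiples of `2π` by translation. -/
theorem Yields.exists_isCover [FiniteDimensional ℝ E] [I.Boundaryless]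
    {A : Connection P.onCircle} (h : u.Yields A) :
    ∃ v : P.onLine.gaugeGroup, IsCover B A v ∧
      ∀ x, ∀ t ∈ Icc 0 (2 * Real.pi), v.1 (x, t) = u.toFun (x, t) := by
  set W : ι → M × ℝ → Mat m := fun i => P.onLine.rep i (fun p => (u.ext p : Mat m)) with hW
  have hA : ∀ i, SmoothFormOn (I.prod 𝓘(ℝ, ℝ)) (A.lift.form i) (P.onLine.baseSet i) :=
    A.lift.smooth
  have hB : ∀ i, SmoothFormOn (I.prod 𝓘(ℝ, ℝ)) (B.cyl.form i) (P.onLine.baseSet i) :=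
    B.cyl.smooth
  have h1 : ∀ i, ∀ x ∈ P.baseSet i, ∀ t ∈ Ioo 0 (2 * Real.pi),
      SolvesAt (I := I.prod 𝓘(ℝ, ℝ)) (W i) (A.lift.form i) (B.cyl.form i) (x, t) := by
    intro i x hx t ht
    refine (h.solvesAt hx ht).congr ?_
    filter_upwards [(isOpen_univ.prod isOpen_Ioo).mem_nhds
      (show (x, t) ∈ (univ : Set M) ×ˢ Ioo 0 (2 * Real.pi) from ⟨trivial, ht⟩)] with p hp
    exact u.rep_ext_eq i (x := p.1) (t := p.2) (Ioo_subset_Icc_self hp.2)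
  -- the equation may be checked after translation by a multiple of the period
  have h2 : ∀ i, ∀ x ∈ P.baseSet i, ∀ (t : ℝ) (k : ℤ),
      SolvesAt (I := I.prod 𝓘(ℝ, ℝ)) (W i) (A.lift.form i) (B.cyl.form i)
        (x, t + (-k : ℝ) * (2 * Real.pi)) →
      SolvesAt (I := I.prod 𝓘(ℝ, ℝ)) (W i) (A.lift.form i) (B.cyl.form i) (x, t) := by
    intro i x hx t k hk
    have hc : ∀ t, Circle.exp (t + (-k : ℝ) * (2 * Real.pi)) = Circle.exp t := fun t =>
      Circle.exp_eq_exp.2 ⟨-k, by push_cast; rfl⟩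
    refine (solvesAt_translate (B.stabilizer.zpow_mem u.final.2 k) hc hx hk).congr ?_
    filter_upwards [(P.onLine.isOpen_baseSet i).mem_nhds (show (x, t) ∈ P.onLine.baseSet i from hx)]
      with p hp
    rw [hW]
    have h3 := u.rep_ext_sub (i := i) (x := p.1) hp p.2 k
    rw [sub_eq_add_neg, ← neg_mul] at h3
    exact h3
  -- on `(-2π, 2π)` the slice `t = 0` is the only exception, and it is crossed continuously
  have h3 : ∀ i, ∀ x ∈ P.baseSet i,
      SolvesAt (I := I.prod 𝓘(ℝ, ℝ)) (W i) (A.lift.form i) (B.cyl.form i) (x, 0) := by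
    intro i x hx
    have hsub : P.baseSet i ×ˢ Ioo (-(2 * Real.pi)) (2 * Real.pi) ⊆ P.onLine.baseSet i :=
      fun p hp => hp.1
    refine dMat_eq_of_crossing ((P.isOpen_baseSet i).prod isOpen_Ioo)
      (fun a b => (hA i a b).mono (preimage_mono hsub))
      (fun a b => (hB i a b).mono (preimage_mono hsub))
      (u.continuousOn_rep_ext i) ?_
      ⟨hx, by simpa using Real.pi_pos, by simpa using Real.pi_pos⟩
    rintro ⟨y, t⟩ ⟨hy, ht⟩ h0
    rcases lt_or_gt_of_ne h0 with h0 | h0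
    · refine h2 i y hy t (-1) (h1 i y hy _ ?_)
      have h4 : t < 0 := h0
      have h5 := ht.1
      simp only at h5
      push_cast
      exact ⟨by linarith, by linarith⟩
    · exact h1 i y hy t ⟨h0, ht.2⟩
  have h4 : ∀ i, ∀ p ∈ P.onLine.baseSet i,
      SolvesAt (I := I.prod 𝓘(ℝ, ℝ)) (W i) (A.lift.form i) (B.cyl.form i) p := by
    rintro i ⟨x, t⟩ hx
    refine h2 i x hx t ⌊t / (2 * Real.pi)⌋ ?_
    have e : t + (-⌊t / (2 * Real.pi)⌋ : ℝ) * (2 * Real.pi) =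
        (t / (2 * Real.pi) - ⌊t / (2 * Real.pi)⌋) * (2 * Real.pi) := by
      field_simp
      ring
    have h5 : 0 ≤ t + (-⌊t / (2 * Real.pi)⌋ : ℝ) * (2 * Real.pi) := by
      rw [e]
      exact mul_nonneg (sub_nonneg.2 (Int.floor_le _)) Real.two_pi_pos.le
    have h6 : t + (-⌊t / (2 * Real.pi)⌋ : ℝ) * (2 * Real.pi) < 2 * Real.pi := by
      rw [e]
      have := Int.lt_floor_add_one (t / (2 * Real.pi))
      nlinarith [Real.two_pi_pos]
    rcases h5.lt_or_eq with h7 | h7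
    · exact h1 i x hx _ ⟨h7, h6⟩
    · rw [← h7]; exact h3 i x hx
  let v : P.onLine.gaugeGroup := ⟨u.ext, fun i =>
    (smoothMatOn_of_dMat_eq (P.onLine.isOpen_baseSet i) (hA i) (hB i) (h4 i)).mono
      inter_subset_left⟩
  refine ⟨v, ⟨?_, ?_⟩, fun x t ht => u.ext_of_mem_Icc ht⟩
  · refine gauge_ext fun x => ?_
    exact (u.ext_of_mem_Icc ⟨le_rfl, Real.two_pi_pos.le⟩).trans (u.initial x)
  · exact Connection.act_eq_iff.2 fun i p hp => (h4 i p hp).2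

end AdmissibleGauge

end Extension

end UnitaryBundle

/-! ### Functional calculus of unitary matrices -/

namespace UnitaryBundle

section FunctionalCalculus

open Polynomial

variable {m : ℕ} {a : Mat m}

open scoped Matrix.Norms.L2Operator in
/-- The functional calculus of normal matrices: `f(a)` has the eigenvectors of `a`, with `f` applied
to the eigenvalues. The spectrum is finite, so that `f` need not be continuous. -/
def fcalc (f : ℂ → ℂ) (a : Mat m) : Mat m := cfc f a

open scoped Matrix.Norms.L2Operator

lemma isStarNormal_of_unitary (ha : a ∈ Matrix.unitaryGroup (Fin m) ℂ) : IsStarNormal a :=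
  ⟨by rw [Commute, SemiconjBy, Matrix.mem_unitaryGroup_iff'.1 ha, Matrix.mem_unitaryGroup_iff.1 ha]⟩

lemma norm_eq_one_of_mem_spectrum (ha : a ∈ Matrix.unitaryGroup (Fin m) ℂ) {s : ℂ}
    (hs : s ∈ spectrum ℂ a) : ‖s‖ = 1 := by
  have := spectrum.subset_circle_of_unitary (𝕜 := ℂ) (E := Mat m) ha hs
  simpa using this

lemma continuousOn_spectrum (f : ℂ → ℂ) (a : Mat m) : ContinuousOn f (spectrum ℂ a) :=
  (Matrix.finite_spectrum a).continuousOn f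

lemma fcalc_congr {f g : ℂ → ℂ} (h : ∀ s ∈ spectrum ℂ a, f s = g s) : fcalc f a = fcalc g a :=
  cfc_congr h

lemma fcalc_mul (f g : ℂ → ℂ) (a : Mat m) :
    fcalc (fun s => f s * g s) a = fcalc f a * fcalc g a :=
  cfc_mul f g a (continuousOn_spectrum f a) (continuousOn_spectrum g a)

lemma fcalc_sub (f g : ℂ → ℂ) (a : Mat m) :
    fcalc (fun s => f s - g s) a = fcalc f a - fcalc g a :=
  cfc_sub f g a (continuousOn_spectrum f a) (continuousOn_spectrum g a)

lemma fcalc_const_mul (r : ℂ) (f : ℂ → ℂ) (a : Mat m) :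
    fcalc (fun s => r * f s) a = r • fcalc f a :=
  cfc_const_mul r f a (continuousOn_spectrum f a)

lemma fcalc_star (f : ℂ → ℂ) (a : Mat m) : fcalc (fun s => star (f s)) a = star (fcalc f a) :=
  cfc_star f a

lemma fcalc_polynomial (ha : a ∈ Matrix.unitaryGroup (Fin m) ℂ) (p : ℂ[X]) :
    fcalc (fun s => p.eval s) a = aeval a p :=
  cfc_polynomial p a (isStarNormal_of_unitary ha)

lemma fcalc_one (ha : a ∈ Matrix.unitaryGroup (Fin m) ℂ) : fcalc (fun _ => 1) a = 1 :=
  cfc_const_one ℂ a (isStarNormal_of_unitary ha)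

lemma fcalc_id (ha : a ∈ Matrix.unitaryGroup (Fin m) ℂ) : fcalc (fun s => s) a = a :=
  cfc_id' ℂ a (isStarNormal_of_unitary ha)

/-- Lagrange interpolation on a finite set containing the spectrum writes `f(a)` as a combination of
polynomials in `a` which depend on that set only, with the values of `f` as coefficients. -/
lemma fcalc_eq_sum (ha : a ∈ Matrix.unitaryGroup (Fin m) ℂ) {S : Finset ℂ}
    (hS : ∀ s ∈ spectrum ℂ a, s ∈ S) (f : ℂ → ℂ) :
    fcalc f a = ∑ s ∈ S, f s • aeval a (Lagrange.basis S id s) := by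
  have h : fcalc f a = aeval a (Lagrange.interpolate S id f) := by
    rw [← fcalc_polynomial ha]
    exact fcalc_congr fun s hs =>
      (Lagrange.eval_interpolate_at_node (v := id) f (Function.injective_id.injOn) (hS s hs)).symm
  rw [h, Lagrange.interpolate_apply, map_sum]
  refine Finset.sum_congr rfl fun s _ => ?_
  rw [← smul_eq_C_mul, map_smul]

lemma frobSq_nonneg (a : Mat m) : 0 ≤ frobSq a :=
  Finset.sum_nonneg fun _ _ => Finset.sum_nonneg fun _ _ => sq_nonneg _

lemma norm_apply_sq_le (a : Mat m) (i j : Fin m) : ‖a i j‖ ^ 2 ≤ frobSq a :=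
  (Finset.single_le_sum (f := fun j => ‖a i j‖ ^ 2) (fun _ _ => sq_nonneg _)
    (Finset.mem_univ j)).trans
    (Finset.single_le_sum (f := fun i => ∑ j, ‖a i j‖ ^ 2)
      (fun _ _ => Finset.sum_nonneg fun _ _ => sq_nonneg _) (Finset.mem_univ i))

lemma eq_zero_of_frobSq_eq_zero (h : frobSq a = 0) : a = 0 := by
  ext i j
  have := norm_apply_sq_le a i j
  rw [h] at this
  simpa using le_antisymm this (sq_nonneg _)

/-- Pointwise bounds on the spectrum imply bounds for the Frobenius norm. -/
lemma frobSq_fcalc_le {f g : ℂ → ℂ} (h : ∀ s ∈ spectrum ℂ a, ‖f s‖ ≤ ‖g s‖) :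
    frobSq (fcalc f a) ≤ frobSq (fcalc g a) := by
  -- `k(a)⋆ k(a) = g(a)⋆ g(a) - f(a)⋆ f(a)` has a trace which is a sum of squares
  let k : ℂ → ℂ := fun s => (√(‖g s‖ ^ 2 - ‖f s‖ ^ 2) : ℝ)
  have key : fcalc (fun s => star (k s) * k s) a =
      fcalc (fun s => star (g s) * g s) a - fcalc (fun s => star (f s) * f s) a := by
    rw [← fcalc_sub]
    refine fcalc_congr fun s hs => ?_
    have h1 : 0 ≤ ‖g s‖ ^ 2 - ‖f s‖ ^ 2 := by
      have := pow_le_pow_left₀ (norm_nonneg _) (h s hs) 2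
      linarith
    have h2 : ∀ z : ℂ, star z * z = ((‖z‖ ^ 2 : ℝ) : ℂ) := fun z => by
      rw [Complex.star_def, Complex.conj_mul']; push_cast; rfl
    rw [h2, h2, h2, Complex.norm_real, Real.norm_of_nonneg (Real.sqrt_nonneg _), Real.sq_sqrt h1]
    push_cast; rfl
  have e : ∀ f : ℂ → ℂ, ((frobSq (fcalc f a) : ℝ) : ℂ) =
      (fcalc (fun s => star (f s) * f s) a).trace := fun f => by
    rw [frobSq_eq_trace, fcalc_mul, fcalc_star]
  have h3 : ((frobSq (fcalc k a) : ℝ) : ℂ) =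
      ((frobSq (fcalc g a) - frobSq (fcalc f a) : ℝ) : ℂ) := by
    rw [e, key, Matrix.trace_sub, ← e, ← e]; push_cast; rfl
  have h4 : frobSq (fcalc k a) = frobSq (fcalc g a) - frobSq (fcalc f a) := by exact_mod_cast h3
  linarith [frobSq_nonneg (fcalc k a)]

/-- The logarithm of a unitary matrix, with the arguments of the eigenvalues in `(-π, π]`. -/
def unitaryLog (a : Mat m) : Mat m := fcalc (fun s => Complex.I * s.arg) a

/-- The power `a ^ τ = exp (τ log a)` of a unitary matrix. -/
def unitaryPow (τ : ℝ) (a : Mat m) : Mat m :=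
  fcalc (fun s => Complex.exp (τ * (Complex.I * s.arg))) a

lemma star_unitaryLog (a : Mat m) : star (unitaryLog a) = -unitaryLog a := by
  rw [unitaryLog, ← fcalc_star, ← zero_sub]
  have h0 : fcalc (fun _ => 0) a = 0 := by simpa using fcalc_sub (fun _ => 0) (fun _ => 0) a
  rw [← h0, ← fcalc_sub]
  refine fcalc_congr fun s _ => ?_
  simp

lemma unitaryPow_mem (ha : a ∈ Matrix.unitaryGroup (Fin m) ℂ) (τ : ℝ) :
    unitaryPow τ a ∈ Matrix.unitaryGroup (Fin m) ℂ := by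
  rw [Matrix.mem_unitaryGroup_iff, unitaryPow, ← fcalc_star, ← fcalc_mul, ← fcalc_one ha]
  refine fcalc_congr fun s _ => ?_
  rw [Complex.star_def, ← Complex.exp_conj, ← Complex.exp_add]
  simp

lemma unitaryPow_zero (ha : a ∈ Matrix.unitaryGroup (Fin m) ℂ) : unitaryPow 0 a = 1 := by
  rw [unitaryPow, ← fcalc_one ha]
  exact fcalc_congr fun s _ => by simp

lemma unitaryPow_one (ha : a ∈ Matrix.unitaryGroup (Fin m) ℂ) : unitaryPow 1 a = a := by
  conv_rhs => rw [← fcalc_id ha]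
  refine fcalc_congr fun s hs => ?_
  have h := Complex.norm_mul_exp_arg_mul_I s
  rw [norm_eq_one_of_mem_spectrum ha hs, Complex.ofReal_one, one_mul] at h
  rw [Complex.ofReal_one, one_mul, mul_comm, h]

/-- The estimate `|log a| ≤ 2 |1 - a|`, from `|arg s| ≤ (π / 2) |1 - s|` on the unit circle. -/
lemma frobSq_unitaryLog_le (ha : a ∈ Matrix.unitaryGroup (Fin m) ℂ) :
    frobSq (unitaryLog a) ≤ 4 * frobSq (1 - a) := by
  have h1 : fcalc (fun s => 2 * (1 - s)) a = (2 : ℂ) • (1 - a) := by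
    have : fcalc (fun _ => (2 : ℂ)) a = (2 : ℂ) • 1 := by
      have := fcalc_polynomial ha (C 2)
      simpa [Algebra.algebraMap_eq_smul_one] using this
    rw [fcalc_mul, fcalc_sub, fcalc_one ha, fcalc_id ha, this, smul_mul_assoc, one_mul]
  have h2 : frobSq ((2 : ℂ) • (1 - a)) = 4 * frobSq (1 - a) := by
    simp only [frobSq, Finset.mul_sum, Matrix.smul_apply, smul_eq_mul, norm_mul, mul_pow]
    norm_num
  rw [← h2, ← h1]
  refine frobSq_fcalc_le fun s hs => ?_
  have hs1 := norm_eq_one_of_mem_spectrum ha hs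
  have hs0 : s ≠ 0 := by rintro rfl; simp at hs1
  have h3 := Complex.angle_le_mul_norm_sub (x := 1) (y := s) (by simp) hs1
  rw [Complex.angle_one_left hs0] at h3
  rw [norm_mul, norm_mul, Complex.norm_I, Complex.norm_real, one_mul, Real.norm_eq_abs]
  refine h3.trans (mul_le_mul_of_nonneg_right ?_ (norm_nonneg _))
  norm_num
  linarith [Real.pi_le_four]

lemma unitaryLog_one : unitaryLog (1 : Mat m) = 0 := by
  have h := frobSq_unitaryLog_le (one_mem (Matrix.unitaryGroup (Fin m) ℂ))
  rw [sub_self, frobSq_zero, mul_zero] at h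
  exact eq_zero_of_frobSq_eq_zero (le_antisymm h (frobSq_nonneg _))

end FunctionalCalculus

end UnitaryBundle

/-! ### Derivatives of sums and traces -/

section Calculus

open Set Filter Topology

variable {E H M : Type*} [NormedAddCommGroup E] [NormedSpace ℝ E] [TopologicalSpace H]
  [TopologicalSpace M] [ChartedSpace H M] {m : ℕ} {I : ModelWithCorners ℝ E H}

/-- The differential of a complex-valued function. -/
def dFun (I : ModelWithCorners ℝ E H) (g : M → ℂ) (x : M) : TangentSpace I x →L[ℝ] ℂ :=
  mfderiv I 𝓘(ℝ, ℂ) g x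

lemma MDiffMatAt.sum_smul {κ : Type} (S : Finset κ) {g : κ → M → ℂ} {W : κ → M → Mat m} {x : M}
    (hg : ∀ s, MDifferentiableAt I 𝓘(ℝ, ℂ) (g s) x) (hW : ∀ s, MDiffMatAt I (W s) x) :
    MDiffMatAt I (fun y => ∑ s ∈ S, g s y • W s y) x ∧
      ∀ v, dMat I (fun y => ∑ s ∈ S, g s y • W s y) x v =
        ∑ s ∈ S, (dFun I (g s) x v • W s x + g s x • dMat I (W s) x v) := by
  have key : ∀ a b, HasMFDerivAt I 𝓘(ℝ, ℂ) (fun y => (∑ s ∈ S, g s y • W s y) a b) x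
      (∑ s ∈ S, (g s x • dFun I (fun y => W s y a b) x + W s x a b • dFun I (g s) x)) := by
    intro a b
    have h0 : ∀ s, HasMFDerivAt I 𝓘(ℝ, ℂ) (g s * (fun y => W s y a b)) x
        (g s x • dFun I (fun y => W s y a b) x + W s x a b • dFun I (g s) x) := fun s =>
      ((hg s).hasMFDerivAt).mul ((hW s a b).hasMFDerivAt)
    have h := HasMFDerivAt.sum (I := I) (z := x) (t := S)
      (f := fun s : κ => g s * (fun y => W s y a b))
      (f' := fun s : κ => g s x • dFun I (fun y => W s y a b) x + W s x a b • dFun I (g s) x)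
      (fun s _ => h0 s)
    have e : (fun y => (∑ s ∈ S, g s y • W s y) a b) = ∑ s ∈ S, g s * (fun y => W s y a b) := by
      ext y; simp [Matrix.sum_apply]
    rw [e]; exact h
  refine ⟨fun a b => (key a b).mdifferentiableAt, fun v => ?_⟩
  ext a b
  have h2 : dFun I (fun y => (∑ s ∈ S, g s y • W s y) a b) x v =
      (∑ s ∈ S, (g s x • dFun I (fun y => W s y a b) x + W s x a b • dFun I (g s) x)) v :=
    congrArg (fun L : TangentSpace I x →L[ℝ] ℂ => L v) (key a b).mfderiv
  refine h2.trans ?_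
  rw [_root_.sum_apply, Matrix.sum_apply]
  refine Finset.sum_congr rfl fun s _ => (add_comm _ _).trans ?_
  exact congrArg (· + g s x * dFun I (fun y => W s y a b) x v)
    (mul_comm (W s x a b) (dFun I (g s) x v))

lemma MDiffMatAt.trace {W : M → Mat m} {x : M} (hW : MDiffMatAt I W x) :
    MDifferentiableAt I 𝓘(ℝ, ℂ) (fun y => (W y).trace) x ∧
      ∀ v, dFun I (fun y => (W y).trace) x v = (dMat I W x v).trace := by
  have h := HasMFDerivAt.sum (I := I) (z := x) (t := Finset.univ)
    (f := fun a : Fin m => (fun y => W y a a)) (f' := fun a => dFun I (fun y => W y a a) x)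
    (fun a _ => (hW a a).hasMFDerivAt)
  have e : (fun y => (W y).trace) = ∑ a : Fin m, (fun y => W y a a) := by
    ext y; simp [Matrix.trace]
  rw [e]
  refine ⟨h.mdifferentiableAt, fun v => ?_⟩
  refine (congrArg (fun L : TangentSpace I x →L[ℝ] ℂ => L v) h.mfderiv).trans ?_
  rw [_root_.sum_apply]
  rfl

/-- A function whose derivative vanishes near `x₀` is constant near `x₀`. -/
lemma eventually_eq_of_mfderiv_eq_zero [I.Boundaryless] [IsManifold I ∞ M] {f : M → ℂ} {x₀ : M}
    (h : ∀ᶠ x in 𝓝 x₀, MDifferentiableAt I 𝓘(ℝ, ℂ) f x ∧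
      ∀ v, dFun I f x v = 0) : ∀ᶠ x in 𝓝 x₀, f x = f x₀ := by
  have h0 : (extChartAt I x₀).target ∩ (extChartAt I x₀).symm ⁻¹'
      {x | MDifferentiableAt I 𝓘(ℝ, ℂ) f x ∧ ∀ v, dFun I f x v = 0} ∈
      𝓝 (extChartAt I x₀ x₀) :=
    inter_mem (extChartAt_target_mem_nhds x₀)
      ((continuousAt_extChartAt_symm x₀).preimage_mem_nhds (by rwa [extChartAt_to_inv]))
  obtain ⟨r, hr, hball⟩ := Metric.mem_nhds_iff.1 h0
  have h1 : ∀ z ∈ Metric.ball (extChartAt I x₀ x₀) r,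
      HasFDerivAt (fun z => f ((extChartAt I x₀).symm z)) (0 : E →L[ℝ] ℂ) z := by
    intro z hz
    obtain ⟨hz1, hz2, hz3⟩ := hball hz
    have h4 : MDifferentiableAt 𝓘(ℝ, E) I (extChartAt I x₀).symm z :=
      ((contMDiffOn_extChartAt_symm (n := ∞) x₀).contMDiffAt
        ((isOpen_extChartAt_target x₀).mem_nhds hz1)).mdifferentiableAt (by simp)
    have h5 := (hz2.hasMFDerivAt).comp z h4.hasMFDerivAt
    have h6 : DifferentiableAt ℝ (fun z => f ((extChartAt I x₀).symm z)) z :=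
      h5.mdifferentiableAt.differentiableAt
    have h7 : fderiv ℝ (fun z => f ((extChartAt I x₀).symm z)) z = 0 := by
      ext w
      rw [← mfderiv_eq_fderiv]
      exact (congrArg (fun L => (L w : ℂ)) h5.mfderiv).trans (hz3 _)
    rw [← h7]
    exact h6.hasFDerivAt
  have h2 : ∀ z ∈ Metric.ball (extChartAt I x₀ x₀) r,
      f ((extChartAt I x₀).symm z) = f ((extChartAt I x₀).symm (extChartAt I x₀ x₀)) := by
    intro z hz
    refine (convex_ball _ r).is_const_of_fderivWithin_eq_zero (𝕜 := ℝ)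
      (f := fun z => f ((extChartAt I x₀).symm z))
      (fun z hz => (h1 z hz).differentiableAt.differentiableWithinAt) (fun z hz => ?_) hz
      (Metric.mem_ball_self hr)
    rw [fderivWithin_of_isOpen Metric.isOpen_ball hz, (h1 z hz).fderiv]
  filter_upwards [(continuousAt_extChartAt (I := I) x₀).preimage_mem_nhds
    (Metric.ball_mem_nhds _ hr), extChartAt_source_mem_nhds (I := I) x₀] with x hx hx'
  have := h2 _ hx
  rwa [(extChartAt I x₀).left_inv hx', extChartAt_to_inv] at this

end Calculus

/-! ### Parallel sections -/

namespace UnitaryBundle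

section ParallelSections

open Set Filter Topology Polynomial

variable {E H M : Type*} [NormedAddCommGroup E] [NormedSpace ℝ E] [TopologicalSpace H]
  [TopologicalSpace M] [ChartedSpace H M] {I : ModelWithCorners ℝ E H} {m : ℕ} {ι : Type*}
  {P : UnitaryBundle I M m ι} [IsManifold I ∞ M] {B : Connection P}

lemma rep_sum_smul {κ : Type*} (i : ι) (S : Finset κ) (g : κ → ℂ) (W : κ → M → Mat m) (x : M) :
    P.rep i (fun y => ∑ s ∈ S, g s • W s y) x = ∑ s ∈ S, g s • P.rep i (W s) x := by
  simp only [rep, Matrix.mul_sum, Matrix.sum_mul, mul_smul_comm, smul_mul_assoc]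

namespace Connection

/-- A section `s` of `End E` is parallel if `d_B s = 0`. -/
def Parallel (B : Connection P) (s : M → Mat m) : Prop :=
  ∀ i, ∀ x ∈ P.baseSet i, SolvesAt (P.rep i s) (B.form i) (B.form i) x

lemma parallel_of_mem_stabilizer {φ : P.gaugeGroup} (hφ : φ ∈ B.stabilizer) :
    B.Parallel (val φ) := fun i x hx =>
  ⟨lrep_mdiff φ hx, act_eq_iff.1 (mem_stabilizer_iff.1 hφ) i x hx⟩

namespace Parallel

lemma smooth [FiniteDimensional ℝ E] [I.Boundaryless] {s : M → Mat m} (hs : B.Parallel s) (i : ι) :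
    SmoothMatOn I (P.rep i s) (P.baseSet i) :=
  smoothMatOn_of_dMat_eq (P.isOpen_baseSet i) (B.smooth i) (B.smooth i) (hs i)

lemma sum_smul {κ : Type} (S : Finset κ) {s : κ → M → Mat m} (hs : ∀ k, B.Parallel (s k))
    (c : κ → ℂ) : B.Parallel (fun x => ∑ k ∈ S, c k • s k x) := by
  intro i x hx
  have h := MDiffMatAt.sum_smul S (g := fun k _ => c k) (W := fun k => P.rep i (s k)) (x := x)
    (fun k => mdifferentiableAt_const) (fun k => (hs k i x hx).1)
  have e : P.rep i (fun x => ∑ k ∈ S, c k • s k x) = fun y => ∑ k ∈ S, c k • P.rep i (s k) y :=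
    funext fun y => rep_sum_smul i S c s y
  rw [e]
  refine ⟨h.1, fun v => (h.2 v).trans ?_⟩
  rw [Finset.sum_mul, Finset.mul_sum, ← Finset.sum_sub_distrib]
  refine Finset.sum_congr rfl fun k _ => ?_
  have h0 : dFun I (fun _ : M => c k) x v = 0 :=
    congrArg (fun L : TangentSpace I x →L[ℝ] ℂ => L v) mfderiv_const
  rw [(hs k i x hx).2, h0, zero_smul, zero_add, smul_sub, smul_mul_assoc, mul_smul_comm]

lemma mul {s t : M → Mat m} (hs : B.Parallel s) (ht : B.Parallel t) :
    B.Parallel (fun x => s x * t x) := by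
  intro i x hx
  have h := MDiffMatAt.mul (hs i x hx).1 (ht i x hx).1
  have h1 : SolvesAt (fun y => P.rep i s y * P.rep i t y) (B.form i) (B.form i) x := by
    refine ⟨h.1, fun v => (h.2 v).trans ?_⟩
    rw [(hs i x hx).2, (ht i x hx).2]
    noncomm_ring
  refine h1.congr ?_
  filter_upwards [(P.isOpen_baseSet i).mem_nhds hx] with y hy using rep_mul hy s t

lemma one : B.Parallel (fun _ => 1) := by
  have := parallel_of_mem_stabilizer (B.stabilizer.one_mem)
  exact this

lemma aeval {s : M → Mat m} (hs : B.Parallel s) (p : ℂ[X]) :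
    B.Parallel (fun x => Polynomial.aeval (s x) p) := by
  have h : ∀ k : ℕ, B.Parallel (fun x => s x ^ k) := by
    intro k
    induction k with
    | zero => simpa only [pow_zero] using one
    | succ k ih => simpa only [pow_succ] using ih.mul hs
  have e : (fun x => Polynomial.aeval (s x) p) =
      fun x => ∑ k ∈ Finset.range (p.natDegree + 1), p.coeff k • s x ^ k :=
    funext fun x => Polynomial.aeval_eq_sum_range _
  rw [e]
  exact sum_smul _ h _

variable [FiniteDimensional ℝ E] [I.Boundaryless]

/-- A parallel section which vanishes at a point vanishes near it, because its norm is locally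
constant. -/
lemma eventually_eq_zero {s : M → Mat m} (hs : B.Parallel s) {x₀ : M} (h0 : s x₀ = 0) :
    ∀ᶠ x in 𝓝 x₀, s x = 0 := by
  set i := P.indexAt x₀ with hi
  have hO := P.isOpen_baseSet i
  have hx₀ : x₀ ∈ P.baseSet i := P.mem_baseSet_at x₀
  have hW := hs.smooth i
  have h1 : ∀ᶠ x in 𝓝 x₀, (star (P.rep i s x) * P.rep i s x).trace =
      (star (P.rep i s x₀) * P.rep i s x₀).trace := by
    refine eventually_eq_of_mfderiv_eq_zero (I := I) ?_
    filter_upwards [hO.mem_nhds hx₀] with x hx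
    have h2 := MDiffMatAt.trace (I := I) (x := x)
      (W := fun y => star (P.rep i s y) * P.rep i s y) ((hW.star.mul hW).mdiff hO hx)
    refine ⟨h2.1, fun v => (h2.2 v).trans ?_⟩
    rw [dMat_mul hW.star hW hO hx, dMat_star hW hO hx, (hs i x hx).2, star_sub, star_mul, star_mul,
      B.skew]
    generalize P.rep i s x = W
    generalize B.form i x v = β
    have e : (-β * star W - star W * -β) * W + star W * (W * β - β * W) =
        star W * W * β - β * (star W * W) := by noncomm_ring
    rw [e, Matrix.trace_sub, Matrix.trace_mul_comm, sub_self]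
  filter_upwards [h1, hO.mem_nhds hx₀] with x hx hxi
  have h2 : P.rep i s x₀ = 0 := by rw [rep, h0, mul_zero, zero_mul]
  rw [h2, mul_zero, Matrix.trace_zero, ← frobSq_eq_trace] at hx
  have h3 : P.rep i s x = 0 := eq_zero_of_frobSq_eq_zero (by exact_mod_cast hx)
  rw [← rep_self (P := P) s x, rep_change hxi (P.mem_baseSet_at x), h3, mul_zero, zero_mul]

end Parallel

end Connection

end ParallelSections

end UnitaryBundle

/-! ### Functions of parallel gauges -/

namespace UnitaryBundle

section ParallelCalculus

open Set Filter Topology Polynomial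

variable {E H M : Type*} [NormedAddCommGroup E] [NormedSpace ℝ E] [TopologicalSpace H]
  [TopologicalSpace M] [ChartedSpace H M] {I : ModelWithCorners ℝ E H} {m : ℕ} {ι : Type*}
  {P : UnitaryBundle I M m ι} [IsManifold I ∞ M] {B : Connection P}
  [FiniteDimensional ℝ E] [I.Boundaryless] {φ : P.gaugeGroup}

lemma val_mem (φ : P.gaugeGroup) (x : M) : val φ x ∈ Matrix.unitaryGroup (Fin m) ℂ := (φ.1 x).2

/-- The spectrum of a parallel gauge `φ` near `x₀` is contained in its spectrum at `x₀`: the minimal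
polynomial `p` of `φ(x₀)` gives a parallel section `p(φ)` which vanishes at `x₀`. -/
lemma eventually_spectrum_subset (hφ : φ ∈ B.stabilizer) (x₀ : M) :
    ∀ᶠ x in 𝓝 x₀, ∀ s ∈ spectrum ℂ (val φ x),
      s ∈ (Matrix.finite_spectrum (val φ x₀)).toFinset := by
  set S := (Matrix.finite_spectrum (val φ x₀)).toFinset with hS
  let p : ℂ[X] := Lagrange.nodal S id
  have h0 : aeval (val φ x₀) p = 0 := by
    rw [← fcalc_polynomial (val_mem φ x₀)]
    have h1 : fcalc (fun s => p.eval s) (val φ x₀) =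
        fcalc (fun s => (0 : ℂ[X]).eval s) (val φ x₀) :=
      fcalc_congr fun s hs => by
        rw [eval_zero]
        exact Lagrange.eval_nodal_at_node (v := id)
          (show s ∈ S from (Matrix.finite_spectrum (val φ x₀)).mem_toFinset.2 hs)
    rw [h1, fcalc_polynomial (val_mem φ x₀), map_zero]
  filter_upwards [((Connection.parallel_of_mem_stabilizer hφ).aeval p).eventually_eq_zero h0]
    with x hx s hs
  have h1 := spectrum.subset_polynomial_aeval (val φ x) p ⟨s, hs, rfl⟩
  rw [hx] at h1
  have h2 : p.eval s = 0 := by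
    by_contra h3
    refine h1 ?_
    rw [spectrum.mem_resolventSet_iff, sub_zero]
    exact (IsUnit.mk0 _ h3).map _
  rw [Lagrange.eval_nodal, Finset.prod_eq_zero_iff] at h2
  obtain ⟨r, hr, hr'⟩ := h2
  rw [sub_eq_zero] at hr'
  rw [hr']; exact hr

/-- Near each point, a function of a parallel gauge is a combination of parallel sections with
constant coefficients. -/
lemma eventually_fcalc_eq (hφ : φ ∈ B.stabilizer) (x₀ : M) :
    ∃ (S : Finset ℂ) (Q : ℂ → M → Mat m), (∀ s, B.Parallel (Q s)) ∧
      ∀ᶠ x in 𝓝 x₀, ∀ f : ℂ → ℂ, fcalc f (val φ x) = ∑ s ∈ S, f s • Q s x := by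
  refine ⟨(Matrix.finite_spectrum (val φ x₀)).toFinset,
    fun s x => aeval (val φ x) (Lagrange.basis (Matrix.finite_spectrum (val φ x₀)).toFinset id s),
    fun s => (Connection.parallel_of_mem_stabilizer hφ).aeval _, ?_⟩
  filter_upwards [eventually_spectrum_subset hφ x₀] with x hx f
  exact fcalc_eq_sum (val_mem φ x) hx f

/-- The section `(x, t) ↦ F_t(φ(x))` over `M × ℝ`, for a parallel gauge `φ`. -/
def fcalcSection (F : ℝ → ℂ → ℂ) (φ : P.gaugeGroup) (p : M × ℝ) : Mat m := fcalc (F p.2) (val φ p.1)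

lemma eventually_rep_fcalcSection (hφ : φ ∈ B.stabilizer) (i : ι) (x₀ : M) (t₀ : ℝ) :
    ∃ (S : Finset ℂ) (Q : ℂ → M → Mat m), (∀ s, B.Parallel (Q s)) ∧
      ∀ᶠ p : M × ℝ in 𝓝 (x₀, t₀), ∀ F : ℝ → ℂ → ℂ, P.onLine.rep i (fcalcSection F φ) p =
        ∑ s ∈ S, F p.2 s • P.rep i (Q s) p.1 := by
  obtain ⟨S, Q, hQ, h⟩ := eventually_fcalc_eq hφ x₀
  refine ⟨S, Q, hQ, ?_⟩
  filter_upwards [(continuous_fst.tendsto (x₀, t₀)).eventually h] with p hp F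
  rw [← rep_sum_smul]
  change P.transition i _ p.1 * fcalc (F p.2) (val φ p.1) * _ = P.transition i _ p.1 * _ * _
  rw [hp]
  rfl

lemma smoothSectionOn_fcalcSection (hφ : φ ∈ B.stabilizer) {F : ℝ → ℂ → ℂ}
    (hF : ∀ s, ContDiff ℝ ∞ fun t => F t s) :
    P.onLine.SmoothSectionOn (fcalcSection F φ) univ := by
  rintro i a b ⟨x, t⟩ ⟨hx, -⟩
  obtain ⟨S, Q, hQ, h⟩ := eventually_rep_fcalcSection hφ i x t
  refine ContMDiffAt.contMDiffWithinAt ?_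
  have h1 : ContMDiffAt (I.prod 𝓘(ℝ, ℝ)) 𝓘(ℝ, ℂ) ∞
      (fun p : M × ℝ => ∑ s ∈ S, F p.2 s * P.rep i (Q s) p.1 a b) (x, t) := by
    refine contMDiffAt_finsetSum fun s _ => ?_
    have h2 : ContMDiffAt (I.prod 𝓘(ℝ, ℝ)) 𝓘(ℝ, ℂ) ∞ (fun p : M × ℝ => F p.2 s) (x, t) :=
      (hF s).contMDiff.contMDiffAt.comp (x, t) contMDiffAt_snd
    have h3 : ContMDiffAt (I.prod 𝓘(ℝ, ℝ)) 𝓘(ℝ, ℂ) ∞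
        (fun p : M × ℝ => P.rep i (Q s) p.1 a b) (x, t) :=
      (((hQ s).smooth i a b).contMDiffAt ((P.isOpen_baseSet i).mem_nhds hx)).comp (x, t)
        contMDiffAt_fst
    exact (contDiff_mul (𝕜 := ℝ) (𝔸 := ℂ)).contMDiff.contMDiffAt.comp (x, t) (h2.prodMk_space h3)
  refine h1.congr_of_eventuallyEq ?_
  filter_upwards [h] with p hp
  rw [hp F, Matrix.sum_apply]
  rfl

/-- The derivative of `(x, t) ↦ F_t(φ(x))`: covariantly constant in the directions of `M`, and
differentiated with respect to the parameter in the direction of `ℝ`. -/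
lemma dMat_fcalcSection (hφ : φ ∈ B.stabilizer) {F F' : ℝ → ℂ → ℂ}
    (hF : ∀ s t, HasDerivAt (fun t => F t s) (F' t s) t) {i : ι} {x : M} (hx : x ∈ P.baseSet i)
    (t : ℝ) :
    MDiffMatAt (I.prod 𝓘(ℝ, ℝ)) (P.onLine.rep i (fcalcSection F φ)) (x, t) ∧
      ∀ v : E × ℝ, dMat (I.prod 𝓘(ℝ, ℝ)) (P.onLine.rep i (fcalcSection F φ)) (x, t) v =
        P.onLine.rep i (fcalcSection F φ) (x, t) * B.cyl.form i (x, t) v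
        - B.cyl.form i (x, t) v * P.onLine.rep i (fcalcSection F φ) (x, t)
        + v.2 • P.onLine.rep i (fcalcSection F' φ) (x, t) := by
  obtain ⟨S, Q, hQ, h⟩ := eventually_rep_fcalcSection hφ i x t
  have hg : ∀ s, HasMFDerivAt (I.prod 𝓘(ℝ, ℝ)) 𝓘(ℝ, ℂ) (fun p : M × ℝ => F p.2 s) (x, t)
      ((ContinuousLinearMap.toSpanSingleton ℝ (F' t s)).comp (ContinuousLinearMap.snd ℝ E ℝ)) :=
    fun s => (hF s t).hasFDerivAt.hasMFDerivAt.comp (x, t) (hasMFDerivAt_snd (x := (x, t)))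
  have hg' : ∀ s (v : E × ℝ), dFun (I.prod 𝓘(ℝ, ℝ)) (fun p : M × ℝ => F p.2 s) (x, t) v =
      v.2 • F' t s := fun s v =>
    congrArg (fun L : E × ℝ →L[ℝ] ℂ => L v) (hg s).mfderiv
  have hW : ∀ s, MDiffMatAt (I.prod 𝓘(ℝ, ℝ)) (fun p : M × ℝ => P.rep i (Q s) p.1) (x, t) ∧
      ∀ v : E × ℝ, dMat (I.prod 𝓘(ℝ, ℝ)) (fun p : M × ℝ => P.rep i (Q s) p.1) (x, t) v =
        P.rep i (Q s) x * B.cyl.form i (x, t) v - B.cyl.form i (x, t) v * P.rep i (Q s) x := by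
    intro s
    have h1 := MDiffMatAt.comp (J := I.prod 𝓘(ℝ, ℝ)) (k := (Prod.fst : M × ℝ → M)) (y := (x, t))
      (hQ s i x hx).1 (contMDiff_fst.mdifferentiable (n := ∞) (by simp) _)
    exact ⟨h1.1, fun v => (h1.2 v).trans ((hQ s i x hx).2 _)⟩
  have h2 := MDiffMatAt.sum_smul (I := I.prod 𝓘(ℝ, ℝ)) (x := (x, t)) S
    (fun s => (hg s).mdifferentiableAt) (fun s => (hW s).1)
  obtain ⟨U, hU, hUo, hxU⟩ := eventually_nhds_iff.1 h
  have h3 := hU _ hxU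
  refine ⟨h2.1.congr (by filter_upwards [h] with p hp using hp F), fun v => ?_⟩
  rw [h3 F, h3 F']
  refine (dMat_congr hUo (fun p hp => hU p hp F) hxU v).trans ((h2.2 v).trans ?_)
  rw [Finset.sum_mul, Finset.mul_sum, Finset.smul_sum, ← Finset.sum_sub_distrib,
    ← Finset.sum_add_distrib]
  refine Finset.sum_congr rfl fun s _ => ?_
  rw [hg', (hW s).2, smul_sub, smul_mul_assoc, mul_smul_comm, add_comm, smul_assoc]

end ParallelCalculus

end UnitaryBundle

/-! ### A smooth step function -/

namespace UnitaryBundle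

section Ramp

open Set Filter Topology

/-- The integral of the bump function `exp (-1 / sin t)` over `[0, π]`. -/
def bumpMass : ℝ := ∫ t in (0 : ℝ)..Real.pi, expNegInvGlue (Real.sin t)

/-- The function `exp (-1 / sin t)` on `(0, π)`, extended by zero to `(π, 2π)` and then
periodically, and normalized to have integral one over a period. -/
def rampDeriv (t : ℝ) : ℝ := expNegInvGlue (Real.sin t) / bumpMass

/-- A smooth function which is `0` on `[-π, 0]` and `1` on `[π, 2π]`. -/
def ramp (t : ℝ) : ℝ := ∫ s in (0 : ℝ)..t, rampDeriv s

lemma contDiff_bump : ContDiff ℝ ∞ fun t => expNegInvGlue (Real.sin t) :=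
  expNegInvGlue.contDiff.comp Real.contDiff_sin

lemma bumpMass_pos : 0 < bumpMass := by
  refine intervalIntegral.intervalIntegral_pos_of_pos_on
    (contDiff_bump.continuous.intervalIntegrable _ _) (fun t ht => ?_) Real.pi_pos
  exact expNegInvGlue.pos_of_pos (Real.sin_pos_of_pos_of_lt_pi ht.1 ht.2)

lemma contDiff_rampDeriv : ContDiff ℝ ∞ rampDeriv := contDiff_bump.div_const _

lemma hasDerivAt_ramp (t : ℝ) : HasDerivAt ramp (rampDeriv t) t :=
  intervalIntegral.integral_hasDerivAt_right
    (contDiff_rampDeriv.continuous.intervalIntegrable _ _)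
    (contDiff_rampDeriv.continuous.stronglyMeasurableAtFilter _ _)
    contDiff_rampDeriv.continuous.continuousAt

lemma contDiff_ramp : ContDiff ℝ ∞ ramp := by
  rw [contDiff_infty_iff_deriv]
  refine ⟨fun t => (hasDerivAt_ramp t).differentiableAt, ?_⟩
  rw [show deriv ramp = rampDeriv from funext fun t => (hasDerivAt_ramp t).deriv]
  exact contDiff_rampDeriv

lemma ramp_zero : ramp 0 = 0 := intervalIntegral.integral_same

lemma ramp_eq_zero {t : ℝ} (ht : t ∈ Icc (-Real.pi) 0) : ramp t = 0 := by
  rw [ramp]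
  refine (intervalIntegral.integral_congr (g := fun _ => (0 : ℝ)) fun s hs => ?_).trans (by simp)
  rw [uIcc_of_ge ht.2] at hs
  rw [rampDeriv, expNegInvGlue.zero_of_nonpos
    (Real.sin_nonpos_of_nonpos_of_neg_pi_le hs.2 (ht.1.trans hs.1)), zero_div]

lemma rampDeriv_eq_zero {t : ℝ} (ht : t ∈ Icc Real.pi (2 * Real.pi)) : rampDeriv t = 0 := by
  have h : Real.sin t ≤ 0 := by
    rw [← Real.sin_sub_two_pi]
    exact Real.sin_nonpos_of_nonpos_of_neg_pi_le (by linarith [ht.2]) (by linarith [ht.1])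
  rw [rampDeriv, expNegInvGlue.zero_of_nonpos h, zero_div]

lemma ramp_eq_one {t : ℝ} (ht : t ∈ Icc Real.pi (2 * Real.pi)) : ramp t = 1 := by
  have hi := fun a b => contDiff_rampDeriv.continuous.intervalIntegrable
    (μ := MeasureTheory.volume) a b
  rw [ramp, ← intervalIntegral.integral_add_adjacent_intervals (hi 0 Real.pi) (hi Real.pi t),
    intervalIntegral.integral_congr (g := fun _ => (0 : ℝ)) (a := Real.pi) fun s hs => ?_]
  · simp only [rampDeriv, intervalIntegral.integral_div, intervalIntegral.integral_zero, add_zero]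
    exact div_self bumpMass_pos.ne'
  · rw [uIcc_of_le ht.1] at hs
    exact rampDeriv_eq_zero ⟨hs.1, hs.2.trans ht.2⟩

/-- The function `rampDeriv` as a function on the circle. -/
def circleBump (z : Circle) : ℝ := expNegInvGlue (z : ℂ).im / bumpMass

lemma circleBump_exp (t : ℝ) : circleBump (Circle.exp t) = rampDeriv t := by
  rw [circleBump, rampDeriv, Circle.coe_exp, Complex.exp_ofReal_mul_I_im]

lemma circleBump_neg_exp (t : ℝ) : circleBump (-Circle.exp t) = rampDeriv (t - Real.pi) := by
  rw [circleBump, rampDeriv, Circle.coe_neg, Circle.coe_exp, Complex.neg_im,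
    Complex.exp_ofReal_mul_I_im, Real.sin_sub_pi]

lemma abs_circleBump_le (z : Circle) : |circleBump z| ≤ 1 / bumpMass := by
  rw [circleBump, abs_div, abs_of_pos bumpMass_pos]
  refine div_le_div_of_nonneg_right ?_ bumpMass_pos.le
  rw [abs_of_nonneg (expNegInvGlue.nonneg _)]
  rw [expNegInvGlue]
  split_ifs with h
  · exact zero_le_one
  · exact Real.exp_le_one_iff.2 (neg_nonpos.2 (inv_nonneg.2 (not_le.1 h).le))

end Ramp

/-! ### Adding one-forms to connections -/

section ModelConnections

open Set Filter Topology

variable {E H M : Type*} [NormedAddCommGroup E] [NormedSpace ℝ E] [TopologicalSpace H]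
  [TopologicalSpace M] [ChartedSpace H M] {I : ModelWithCorners ℝ E H} {m : ℕ} {ι : Type*}
  {P : UnitaryBundle I M m ι} [IsManifold I ∞ M]

lemma rep_smul {R : Type*} [SMul R (Mat m)] [IsScalarTower R (Mat m) (Mat m)]
    [SMulCommClass R (Mat m) (Mat m)] (i : ι) (r : M → R) (s : M → Mat m) (x : M) :
    P.rep i (fun y => r y • s y) x = r x • P.rep i s x := by
  simp only [rep, mul_smul_comm, smul_mul_assoc]

lemma rep_add (i : ι) (s t : M → Mat m) (x : M) :
    P.rep i (fun y => s y + t y) x = P.rep i s x + P.rep i t x := by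
  simp only [rep, mul_add, add_mul]

/-- The connection `A + θ χ` for a real-valued `1`-form `θ` and a section `χ` of skew-Hermitian
endomorphisms. -/
def Connection.addForm (A : Connection P) (θ : ∀ x : M, TangentSpace I x →ₗ[ℝ] ℝ)
    (hθ : ContMDiff I.tangent 𝓘(ℝ, ℂ) ∞ (fun p : TangentBundle I M => (θ p.proj p.snd : ℂ)))
    (χ : M → Mat m) (hχ : P.SmoothSectionOn χ univ) (hs : ∀ x, star (χ x) = -χ x) :
    Connection P where
  form i x := open scoped Classical in A.form i x +
    if x ∈ P.baseSet i then (θ x).smulRight (P.rep i χ x) else 0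
  form_off i x hx := by rw [if_neg hx, A.form_off i x hx, add_zero]
  skew i x v := by
    by_cases hx : x ∈ P.baseSet i
    · have h1 : star (P.rep i χ x) = -P.rep i χ x := by
        rw [← rep_star hx]
        simp only [hs, rep, mul_neg, neg_mul]
      rw [if_pos hx, LinearMap.add_apply, LinearMap.smulRight_apply, star_add, A.skew, star_smul,
        h1, star_trivial, smul_neg, neg_add]
    · rw [if_neg hx, add_zero, A.skew]
  smooth i a b := by
    have h1 : ContMDiffOn I.tangent 𝓘(ℝ, ℂ) ∞
        (fun p : TangentBundle I M => (θ p.proj p.snd : ℂ) * P.rep i χ p.proj a b)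
        (Bundle.TotalSpace.proj ⁻¹' P.baseSet i) :=
      (contDiff_mul (𝕜 := ℝ) (𝔸 := ℂ)).contMDiff.comp_contMDiffOn (hθ.contMDiffOn.prodMk_space
        (SmoothMatOn.comp_proj ((hχ i).mono fun x hx => ⟨hx, trivial⟩) a b))
    refine ((A.smooth i a b).add h1).congr fun p hp => ?_
    have hp' : p.proj ∈ P.baseSet i := hp
    have e : (open scoped Classical in if p.proj ∈ P.baseSet i then
        (θ p.proj).smulRight (P.rep i χ p.proj) else 0) =
        (θ p.proj).smulRight (P.rep i χ p.proj) := if_pos hp'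
    refine (congrArg (fun L => (A.form i p.proj p.snd + L p.snd) a b) e).trans ?_
    change A.form i p.proj p.snd a b + (θ p.proj p.snd) • (P.rep i χ p.proj a b) = _
    rw [Complex.real_smul]
    rfl
  compat i j x hx v := by
    rw [if_pos hx.1, if_pos hx.2, LinearMap.add_apply, LinearMap.add_apply, A.compat i j x hx,
      LinearMap.smulRight_apply, LinearMap.smulRight_apply, rep_change hx.1 hx.2, mul_add, add_mul,
      mul_smul_comm, smul_mul_assoc]
    abel

lemma Connection.addForm_form {A : Connection P} {θ : ∀ x : M, TangentSpace I x →ₗ[ℝ] ℝ}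
    {hθ : ContMDiff I.tangent 𝓘(ℝ, ℂ) ∞ (fun p : TangentBundle I M => (θ p.proj p.snd : ℂ))}
    {χ : M → Mat m} {hχ : P.SmoothSectionOn χ univ} {hs : ∀ x, star (χ x) = -χ x} {i : ι} {x : M}
    (hx : x ∈ P.baseSet i) (v : TangentSpace I x) :
    (A.addForm θ hθ χ hχ hs).form i x v = A.form i x v + θ x v • P.rep i χ x := by
  change (A.form i x + (open scoped Classical in
    if x ∈ P.baseSet i then (θ x).smulRight (P.rep i χ x) else 0)) v = _
  rw [if_pos hx]
  rfl

lemma contMDiff_circleCoe : ContMDiff (I.prod (𝓡 1)) 𝓘(ℝ, ℂ) ∞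
    (fun q : M × Circle => (q.2 : ℂ)) := by
  have := finrank_real_complex_fact'
  exact contMDiff_coe_sphere.comp contMDiff_snd

/-- The form `dt` on `M × S¹`. -/
def angleForm (p : M × Circle) : TangentSpace (I.prod (𝓡 1)) p →ₗ[ℝ] ℝ where
  toFun v := (star (p.2 : ℂ) * dFun (I.prod (𝓡 1)) (fun q : M × Circle => (q.2 : ℂ)) p v).im
  map_add' v w := by rw [map_add, mul_add, Complex.add_im]
  map_smul' c v := by rw [map_smul, mul_smul_comm, Complex.smul_im]; rfl

lemma contMDiff_angleForm : ContMDiff (I.prod (𝓡 1)).tangent 𝓘(ℝ, ℂ) ∞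
    (fun p : TangentBundle (I.prod (𝓡 1)) (M × Circle) => (angleForm p.proj p.snd : ℂ)) := by
  have h1 := (contMDiff_circleCoe (I := I) (M := M)).contMDiff_tangentMap (m := ∞) (by simp)
  have h2 := (contMDiff_snd_tangentBundle_modelSpace ℂ 𝓘(ℝ, ℂ) (n := ∞)).comp h1
  have h3 : ContMDiff (I.prod (𝓡 1)).tangent 𝓘(ℝ, ℂ) ∞
      (fun p : TangentBundle (I.prod (𝓡 1)) (M × Circle) => (p.proj.2 : ℂ)) :=
    (contMDiff_circleCoe (I := I) (M := M)).comp
      (Bundle.contMDiff_proj (TangentSpace (I.prod (𝓡 1))))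
  have h4 : ContDiff ℝ ∞ (fun z : ℂ × ℂ => (((star z.1 * z.2).im : ℝ) : ℂ)) :=
    Complex.ofRealCLM.contDiff.comp (Complex.imCLM.contDiff.comp
      ((Complex.conjCLE.contDiff.comp contDiff_fst).mul contDiff_snd))
  exact h4.contMDiff.comp (h3.prodMk_space h2)

lemma dFun_circleCoe_wrap (x : M) (t : ℝ) (v : E × ℝ) :
    dFun (I.prod (𝓡 1)) (fun q : M × Circle => (q.2 : ℂ)) (wrap M (x, t))
      (mfderiv (I.prod 𝓘(ℝ, ℝ)) (I.prod (𝓡 1)) (wrap M) (x, t) v) =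
        v.2 • ((Circle.exp t : ℂ) * Complex.I) := by
  have h1 := mfderiv_comp (x, t)
    ((contMDiff_circleCoe (I := I) (M := M)).mdifferentiable (by simp) (wrap M (x, t)))
    (contMDiff_wrap.mdifferentiable (n := ∞) (by simp) (x, t))
  have h2 : HasDerivAt (fun t : ℝ => (Circle.exp t : ℂ)) (Circle.exp t * Complex.I) t := by
    simp only [Circle.coe_exp]
    simpa using ((Complex.ofRealCLM.hasDerivAt (x := t)).mul_const Complex.I).cexp
  have h3 : HasMFDerivAt (I.prod 𝓘(ℝ, ℝ)) 𝓘(ℝ, ℂ) (fun p : M × ℝ => (Circle.exp p.2 : ℂ)) (x, t)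
      ((ContinuousLinearMap.toSpanSingleton ℝ ((Circle.exp t : ℂ) * Complex.I)).comp
        (ContinuousLinearMap.snd ℝ E ℝ)) :=
    HasMFDerivAt.comp (I' := 𝓘(ℝ, ℝ)) (g := fun t : ℝ => (Circle.exp t : ℂ))
      (f := (Prod.snd : M × ℝ → ℝ)) (x, t) h2.hasFDerivAt.hasMFDerivAt (hasMFDerivAt_snd _)
  exact (congrArg (fun L => (L v : ℂ)) h1).symm.trans
    (congrArg (fun L : E × ℝ →L[ℝ] ℂ => L v) h3.mfderiv)

lemma angleForm_wrap (x : M) (t : ℝ) (v : E × ℝ) :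
    angleForm (wrap M (x, t)) (mfderiv (I.prod 𝓘(ℝ, ℝ)) (I.prod (𝓡 1)) (wrap M) (x, t) v) =
      v.2 := by
  change (star (Circle.exp t : ℂ) * _).im = _
  rw [dFun_circleCoe_wrap, mul_smul_comm, ← mul_assoc, Complex.star_def, Complex.conj_mul',
    Circle.norm_coe]
  simp

end ModelConnections

end UnitaryBundle

/-! ### Connections with prescribed holonomy -/

namespace UnitaryBundle

section ModelGauges

open Set Filter Topology

variable {E H M : Type*} [NormedAddCommGroup E] [NormedSpace ℝ E] [TopologicalSpace H]
  [TopologicalSpace M] [ChartedSpace H M] {I : ModelWithCorners ℝ E H} {m : ℕ} {ι : Type*}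
  {P : UnitaryBundle I M m ι} [IsManifold I ∞ M] {B : Connection P}

/-- The product rule for two covariantly constant families with logarithmic time derivatives `L₁`
and `L₂`. For the product to have logarithmic derivative `L₁ + L₂` it suffices that `L₁` commutes
with the second factor. -/
lemma solvesAt_mul_of_commute {W₁ W₂ : M → Mat m} {α β : ∀ x : M, TangentSpace I x →ₗ[ℝ] Mat m}
    {x : M} {τ : TangentSpace I x → ℝ} {L₁ L₂ : Mat m} (h₁ : MDiffMatAt I W₁ x)
    (h₁' : ∀ v, dMat I W₁ x v = W₁ x * β x v - β x v * W₁ x + τ v • (W₁ x * L₁))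
    (h₂ : MDiffMatAt I W₂ x)
    (h₂' : ∀ v, dMat I W₂ x v = W₂ x * β x v - β x v * W₂ x + τ v • (W₂ x * L₂))
    (hα : ∀ v, α x v = β x v + τ v • (L₁ + L₂)) (hc : L₁ * W₂ x = W₂ x * L₁) :
    SolvesAt (fun y => W₁ y * W₂ y) α β x := by
  have h := MDiffMatAt.mul h₁ h₂
  refine ⟨h.1, fun v => ?_⟩
  rw [h.2, h₁', h₂', hα]
  beta_reduce
  generalize W₂ x = V₂ at *
  generalize W₁ x = V₁
  have e : V₁ * L₁ * V₂ = V₁ * V₂ * L₁ := by rw [mul_assoc, hc, mul_assoc]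
  rw [add_mul, mul_add, mul_add, smul_add, smul_mul_assoc, mul_add, mul_smul_comm, mul_smul_comm,
    mul_smul_comm, e]
  noncomm_ring

/-- The logarithm of a gauge, as a section of `End E`. -/
def logSection (φ : P.gaugeGroup) (x : M) : Mat m := unitaryLog (val φ x)

/-- The gauge `φ ^ r(t)` over `M × ℝ`, as a section of `End E`. -/
def powSection (r : ℝ → ℝ) (φ : P.gaugeGroup) (p : M × ℝ) : Mat m := unitaryPow (r p.2) (val φ p.1)

/-- The section `b(t) log a + b(t + π) log c` over `M × S¹`, where `b` is the bump function
`circleBump`. -/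
def modelField (a c : P.gaugeGroup) (p : M × Circle) : Mat m :=
  (circleBump p.2 : ℂ) • logSection a p.1 + (circleBump (-p.2) : ℂ) • logSection c p.1

lemma star_modelField (a c : P.gaugeGroup) (p : M × Circle) :
    star (modelField a c p) = -modelField a c p := by
  rw [modelField, star_add, star_smul, star_smul, logSection, logSection, star_unitaryLog,
    star_unitaryLog, Complex.star_def, Complex.conj_ofReal, Complex.conj_ofReal]
  simp only [smul_neg, neg_add]

variable [FiniteDimensional ℝ E] [I.Boundaryless]

lemma smoothSectionOn_logSection {φ : P.gaugeGroup} (hφ : φ ∈ B.stabilizer) :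
    P.SmoothSectionOn (logSection φ) univ := fun i =>
  (((smoothSectionOn_fcalcSection hφ (F := fun _ s => Complex.I * s.arg)
    (fun _ => contDiff_const)) i).comp (contMDiff_sliceAt (I := I) (0 : ℝ))).mono
      fun _ hx => hx

lemma smoothSectionOn_powSection {φ : P.gaugeGroup} (hφ : φ ∈ B.stabilizer) {r : ℝ → ℝ}
    (hr : ContDiff ℝ ∞ r) : P.onLine.SmoothSectionOn (powSection r φ) univ :=
  smoothSectionOn_fcalcSection hφ (F := fun t s => Complex.exp (r t * (Complex.I * s.arg)))
    fun _ => Complex.contDiff_exp.comp ((Complex.ofRealCLM.contDiff.comp hr).mul contDiff_const)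

lemma dMat_powSection {φ : P.gaugeGroup} (hφ : φ ∈ B.stabilizer) {r r' : ℝ → ℝ}
    (hr : ∀ t, HasDerivAt r (r' t) t) {i : ι} {x : M} (hx : x ∈ P.baseSet i) (t : ℝ) :
    MDiffMatAt (I.prod 𝓘(ℝ, ℝ)) (P.onLine.rep i (powSection r φ)) (x, t) ∧
      ∀ v : E × ℝ, dMat (I.prod 𝓘(ℝ, ℝ)) (P.onLine.rep i (powSection r φ)) (x, t) v =
        P.onLine.rep i (powSection r φ) (x, t) * B.cyl.form i (x, t) v
        - B.cyl.form i (x, t) v * P.onLine.rep i (powSection r φ) (x, t)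
        + v.2 • (P.onLine.rep i (powSection r φ) (x, t) *
          ((r' t : ℂ) • P.rep i (logSection φ) x)) := by
  have h := dMat_fcalcSection hφ (F := fun t s => Complex.exp (r t * (Complex.I * s.arg)))
    (F' := fun t s => Complex.exp (r t * (Complex.I * s.arg)) * (r' t * (Complex.I * s.arg)))
    (fun s t => (((hr t).ofReal_comp).mul_const _).cexp) hx t
  have e : P.onLine.rep i (fcalcSection (fun t s => Complex.exp (r t * (Complex.I * s.arg)) *
      (r' t * (Complex.I * s.arg))) φ) (x, t) = P.onLine.rep i (powSection r φ) (x, t) *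
          ((r' t : ℂ) • P.rep i (logSection φ) x) := by
    have e1 := rep_mul (P := P.onLine) (i := i) (x := (x, t)) hx (powSection r φ)
      (fun p : M × ℝ => (r' p.2 : ℂ) • logSection φ p.1)
    rw [rep_smul] at e1
    refine Eq.trans ?_ e1
    change P.transition i _ x * fcalc _ _ * _ = P.transition i _ x * (_ * _) * _
    rw [fcalc_mul, fcalc_const_mul]
    rfl
  rw [e] at h
  exact h

lemma contMDiff_circleBump : ContMDiff (I.prod (𝓡 1)) 𝓘(ℝ, ℂ) ∞
      (fun p : M × Circle => (circleBump p.2 : ℂ)) ∧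
    ContMDiff (I.prod (𝓡 1)) 𝓘(ℝ, ℂ) ∞ (fun p : M × Circle => (circleBump (-p.2) : ℂ)) := by
  have h1 : ContDiff ℝ ∞ fun z : ℂ => ((expNegInvGlue z.im / bumpMass : ℝ) : ℂ) :=
    Complex.ofRealCLM.contDiff.comp
      ((expNegInvGlue.contDiff.comp Complex.imCLM.contDiff).div_const _)
  have h2 : ContDiff ℝ ∞ fun z : ℂ => ((expNegInvGlue (-z).im / bumpMass : ℝ) : ℂ) :=
    h1.comp contDiff_neg
  exact ⟨h1.contMDiff.comp contMDiff_circleCoe, h2.contMDiff.comp contMDiff_circleCoe⟩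

lemma rep_modelField (a c : P.gaugeGroup) (i : ι) (p : M × Circle) :
    P.onCircle.rep i (modelField a c) p = (circleBump p.2 : ℂ) • P.rep i (logSection a) p.1 +
      (circleBump (-p.2) : ℂ) • P.rep i (logSection c) p.1 := by
  have h := rep_add (P := P.onCircle) i
    (fun p : M × Circle => (circleBump p.2 : ℂ) • logSection a p.1)
    (fun p : M × Circle => (circleBump (-p.2) : ℂ) • logSection c p.1) p
  rw [rep_smul, rep_smul] at h
  exact h

lemma smoothSectionOn_modelField {a c : P.gaugeGroup} (ha : a ∈ B.stabilizer)
    (hc : c ∈ B.stabilizer) : P.onCircle.SmoothSectionOn (modelField a c) univ := by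
  intro i α β
  have h1 := ((smoothSectionOn_logSection ha i).comp (contMDiff_fst (I := I) (J := 𝓡 1)
    (N := Circle) (n := ∞))) α β
  have h2 := ((smoothSectionOn_logSection hc i).comp (contMDiff_fst (I := I) (J := 𝓡 1)
    (N := Circle) (n := ∞))) α β
  have hmul := (contDiff_mul (𝕜 := ℝ) (𝔸 := ℂ) (n := ∞)).contMDiff
  refine ((hmul.comp_contMDiffOn (contMDiff_circleBump.1.contMDiffOn.prodMk_space h1)).add
    (hmul.comp_contMDiffOn (contMDiff_circleBump.2.contMDiffOn.prodMk_space h2))).congr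
      fun p _ => ?_
  rw [rep_modelField]
  rfl

/-- The pull-back of `B` plus `modelField a c dt`. It arises from `B` by the gauge `modelGauge`,
which runs from `1` to `a` along the powers of `a` and then from `a` to `a c` along the powers of
`c`. -/
def modelConnection (B : Connection P) (a c : B.stabilizer) : Connection P.onCircle :=
  (B.pullback Prod.fst contMDiff_fst).addForm angleForm contMDiff_angleForm
    (modelField (a : P.gaugeGroup) c) (smoothSectionOn_modelField a.2 c.2) (star_modelField _ _)

lemma lift_modelConnection (a c : B.stabilizer) {i : ι} {x : M} (hx : x ∈ P.baseSet i) (t : ℝ)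
    (v : E × ℝ) : (modelConnection B a c).lift.form i (x, t) v = B.cyl.form i (x, t) v +
      v.2 • ((rampDeriv t : ℂ) • P.rep i (logSection (a : P.gaugeGroup)) x +
        (rampDeriv (t - Real.pi) : ℂ) • P.rep i (logSection (c : P.gaugeGroup)) x) := by
  refine (Connection.pullback_form_apply _ _ contMDiff_wrap i (x, t) v).trans ?_
  refine (Connection.addForm_form (P := P.onCircle) (x := wrap M (x, t)) hx _).trans ?_
  rw [angleForm_wrap, rep_modelField]
  have h := B.pullback_pullback_form (contMDiff_fst (I := I) (J := 𝓡 1) (N := Circle))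
    (contMDiff_wrap (I := I)) (contMDiff_fst (I := I) (J := 𝓘(ℝ, ℝ)) (N := ℝ)) (fun _ => rfl)
    i (x, t) v
  rw [← circleBump_exp, ← circleBump_neg_exp]
  exact congrArg (· + _) h

/-- The product of powers `a ^ ramp(t) c ^ ramp(t - π)`. -/
def modelSection (a c : P.gaugeGroup) (p : M × ℝ) : Matrix.unitaryGroup (Fin m) ℂ :=
  ⟨powSection ramp a p, unitaryPow_mem (val_mem a p.1) _⟩ *
    ⟨powSection (fun t => ramp (t - Real.pi)) c p, unitaryPow_mem (val_mem c p.1) _⟩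

lemma solvesAt_modelSection (a c : B.stabilizer) {i : ι} {x : M} (hx : x ∈ P.baseSet i) {t : ℝ}
    (ht : t ∈ Ioo 0 (2 * Real.pi)) :
    SolvesAt (I := I.prod 𝓘(ℝ, ℝ))
      (P.onLine.rep i fun p => (modelSection (a : P.gaugeGroup) c p : Mat m))
      ((modelConnection B a c).lift.form i) (B.cyl.form i) (x, t) := by
  have h1 := dMat_powSection (i := i) a.2 hasDerivAt_ramp hx t
  have h2 := dMat_powSection (i := i) c.2 (r := fun t => ramp (t - Real.pi))
    (fun t => (hasDerivAt_ramp (t - Real.pi)).comp_sub_const t Real.pi) hx t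
  have h3 : ((rampDeriv t : ℂ) • P.rep i (logSection (a : P.gaugeGroup)) x) *
      P.onLine.rep i (powSection (fun t => ramp (t - Real.pi)) (c : P.gaugeGroup)) (x, t) =
      P.onLine.rep i (powSection (fun t => ramp (t - Real.pi)) (c : P.gaugeGroup)) (x, t) *
        ((rampDeriv t : ℂ) • P.rep i (logSection (a : P.gaugeGroup)) x) := by
    -- the first factor moves only while the second one is the identity
    rcases le_total t Real.pi with h | h
    · have e : P.onLine.rep i (powSection (fun t => ramp (t - Real.pi)) (c : P.gaugeGroup)) (x, t)
          = 1 := by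
        have e1 : powSection (fun t => ramp (t - Real.pi)) (c : P.gaugeGroup) (x, t) = 1 := by
          rw [powSection]
          dsimp only
          rw [ramp_eq_zero ⟨by linarith [ht.1], by linarith⟩, unitaryPow_zero (val_mem _ _)]
        rw [← rep_one (P := P.onLine) (i := i) (x := (x, t)) hx]
        simp only [rep, e1]
      rw [e, one_mul, mul_one]
    · rw [rampDeriv_eq_zero ⟨h, ht.2.le⟩, Complex.ofReal_zero, zero_smul, zero_mul, mul_zero]
  have h4 := solvesAt_mul_of_commute (I := I.prod 𝓘(ℝ, ℝ)) (τ := fun v : E × ℝ => v.2)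
    h1.1 h1.2 h2.1 h2.2 (lift_modelConnection a c hx t) h3
  refine h4.congr ?_
  filter_upwards [(P.onLine.isOpen_baseSet i).mem_nhds (show (x, t) ∈ P.onLine.baseSet i from hx)]
    with p hp using rep_mul (P := P.onLine) hp _ _

/-- The admissible gauge from `1` to `a c` along the powers of `a` and `c`. -/
def modelGauge (B : Connection P) (a c : B.stabilizer) : AdmissibleGauge B where
  toFun := modelSection (a : P.gaugeGroup) c
  smooth i := by
    have h1 := smoothSectionOn_powSection a.2 contDiff_ramp i
    have h2 := smoothSectionOn_powSection c.2
      (contDiff_ramp.comp (contDiff_id.sub (contDiff_const (c := Real.pi)))) i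
    refine ((h1.mul h2).mono (inter_subset_inter_right _ (subset_univ _))).congr
      fun p hp => rep_mul (P := P.onLine) hp.1 _ _
  initial x := by
    refine Subtype.ext ?_
    change unitaryPow (ramp 0) _ * unitaryPow (ramp (0 - Real.pi)) _ = (1 : Mat m)
    rw [ramp_zero, ramp_eq_zero ⟨by simp, by simpa using Real.pi_pos.le⟩,
      unitaryPow_zero (val_mem _ _), unitaryPow_zero (val_mem _ _), one_mul]
  final := a * c
  final_eq x := by
    refine Subtype.ext ?_
    change val (a : P.gaugeGroup) x * val (c : P.gaugeGroup) x =
      unitaryPow (ramp (2 * Real.pi)) _ * unitaryPow (ramp (2 * Real.pi - Real.pi)) _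
    have := Real.pi_pos
    rw [ramp_eq_one ⟨by linarith, le_rfl⟩, ramp_eq_one ⟨by linarith, by linarith⟩,
      unitaryPow_one (val_mem _ _), unitaryPow_one (val_mem _ _)]
  periodic := by
    refine ⟨modelField (a : P.gaugeGroup) c, smoothSectionOn_modelField a.2 c.2, fun x t ht => ?_⟩
    have h1 := solvesAt_modelSection a c (P.mem_baseSet_at x) ht
    set W := P.onLine.rep (P.indexAt x)
      (fun p => (modelSection (a : P.gaugeGroup) c p : Mat m)) with hW
    have hr : ∀ s, W (x, s) = modelSection (a : P.gaugeGroup) c (x, s) := fun s =>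
      rep_self (P := P.onLine) _ (x, s)
    have h2 : (Matrix.of fun α β => deriv (fun s =>
        (modelSection (a : P.gaugeGroup) c (x, s) : Mat m) α β) t) =
        dMat (I.prod 𝓘(ℝ, ℝ)) W (x, t) ((0, 1) : E × ℝ) := by
      ext α β
      have := (h1.1.hasDerivAt α β).deriv
      simp only [hr] at this
      exact this
    have h5 : dMat (I.prod 𝓘(ℝ, ℝ)) W (x, t) ((0, 1) : E × ℝ) =
        modelSection (a : P.gaugeGroup) c (x, t) *
          (modelConnection B a c).lift.form (P.indexAt x) (x, t) ((0, 1) : E × ℝ) :=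
      (h1.2 ((0, 1) : E × ℝ)).trans (by rw [B.cyl_form_time, hr, zero_mul, sub_zero])
    rw [h2, h5]
    have h3 := lift_modelConnection a c (P.mem_baseSet_at x) t ((0, 1) : E × ℝ)
    rw [B.cyl_form_time, zero_add, one_smul, rep_self, rep_self] at h3
    have h4 : modelField (a : P.gaugeGroup) c (x, Circle.exp t) =
      (rampDeriv t : ℂ) • logSection (a : P.gaugeGroup) x +
        (rampDeriv (t - Real.pi) : ℂ) • logSection (c : P.gaugeGroup) x := by
      rw [modelField, circleBump_exp, circleBump_neg_exp]
    rw [h4, ← h3, ← mul_assoc,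
      Matrix.mem_unitaryGroup_iff'.1 (modelSection (a : P.gaugeGroup) c (x, t)).2, one_mul]

lemma modelGauge_yields (a c : B.stabilizer) :
    (modelGauge B a c).Yields (modelConnection B a c) := by
  intro i x hx t ht
  ext1 v
  have h1 := solvesAt_modelSection a c hx ht
  have h2 := mul_eq_one_comm.1 (rep_mul_star (P := P.onLine) (i := i) (x := (x, t)) hx
    (modelSection (a : P.gaugeGroup) c))
  rw [gaugeForm_apply]
  change (modelConnection B a c).lift.form i (x, t) v =
    star (P.onLine.rep i (fun p => (modelSection (a : P.gaugeGroup) c p : Mat m)) (x, t)) *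
    (B.cyl.form i (x, t) v *
      P.onLine.rep i (fun p => (modelSection (a : P.gaugeGroup) c p : Mat m)) (x, t) +
      dMat (I.prod 𝓘(ℝ, ℝ))
        (P.onLine.rep i (fun p => (modelSection (a : P.gaugeGroup) c p : Mat m))) (x, t) v)
  rw [h1.2, add_sub_cancel, ← mul_assoc, h2, one_mul]

end ModelGauges

end UnitaryBundle

/-! ### Inner products and orthonormal frames -/

section Frames

/-- `h` is an inner product on the real vector space `V`. -/
structure IsInnerProduct {V : Type*} [AddCommGroup V] [Module ℝ V] (h : V → V → ℝ) : Prop where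
  add_left : ∀ u v w, h (u + v) w = h u w + h v w
  smul_left : ∀ (c : ℝ) v w, h (c • v) w = c * h v w
  symm : ∀ v w, h v w = h w v
  pos : ∀ v, v ≠ 0 → 0 < h v v

variable {V : Type*} [AddCommGroup V] [Module ℝ V] {h : V → V → ℝ}

lemma IsInnerProduct.zero_left (H : IsInnerProduct h) (v : V) : h 0 v = 0 := by
  simpa using H.smul_left 0 0 v

lemma IsInnerProduct.nonneg (H : IsInnerProduct h) (v : V) : 0 ≤ h v v := by
  by_cases hv : v = 0
  · rw [hv, H.zero_left]
  · exact (H.pos v hv).le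

/-- An inner product on a finite dimensional space has an orthonormal frame. -/
lemma IsInnerProduct.exists_frame [FiniteDimensional ℝ V] (H : IsInnerProduct h) :
    ∃ e : Fin (Module.finrank ℝ V) → V, (∀ c d, h (e c) (e d) = if c = d then 1 else 0) ∧
      ∀ v, v = ∑ c, h (e c) v • e c ∧ h v v = ∑ c, h (e c) v ^ 2 := by
  let core : InnerProductSpace.Core ℝ V :=
    { inner := h
      conj_inner_symm := fun v w => H.symm w v
      re_inner_nonneg := fun v => H.nonneg v
      add_left := H.add_left
      smul_left := fun v w c => H.smul_left c v w
      definite := fun v hv => by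
        by_contra h0
        exact (H.pos v h0).ne' hv }
  let : NormedAddCommGroup V := core.toNormedAddCommGroup
  let : InnerProductSpace ℝ V := InnerProductSpace.ofCore core.toCore
  let b := stdOrthonormalBasis ℝ V
  refine ⟨b, fun c d => orthonormal_iff_ite.1 b.orthonormal c d, fun v => ⟨?_, ?_⟩⟩
  · exact (b.sum_repr' v).symm
  · have := b.sum_sq_norm_inner_right v
    rw [← real_inner_self_eq_norm_sq] at this
    simp only [Real.norm_eq_abs, sq_abs] at this
    exact this.symm

end Frames

/-! ### Norms of forms and connections -/

namespace UnitaryBundle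

section FormNorms

open Set Filter Topology

variable {m : ℕ}

/-- A matrix as a vector of a Euclidean space. -/
def frobVec : Mat m →ₗ[ℝ] EuclideanSpace ℂ (Fin m × Fin m) where
  toFun a := WithLp.toLp 2 fun p => a p.1 p.2
  map_add' _ _ := rfl
  map_smul' _ _ := rfl

lemma norm_frobVec (a : Mat m) : ‖frobVec a‖ = √(frobSq a) := by
  rw [EuclideanSpace.norm_eq, Fintype.sum_prod_type]
  rfl

lemma norm_frobVec_mul_left {w : Mat m} (hw : star w * w = 1) (a : Mat m) :
    ‖frobVec (w * a)‖ = ‖frobVec a‖ := by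
  have h : (frobSq (w * a) : ℂ) = frobSq a := by
    rw [frobSq_eq_trace, frobSq_eq_trace, star_mul, mul_assoc, ← mul_assoc _ w, hw, one_mul]
  rw [norm_frobVec, norm_frobVec, Complex.ofReal_injective h]

lemma norm_frobVec_mul_right {w : Mat m} (hw : w * star w = 1) (a : Mat m) :
    ‖frobVec (a * w)‖ = ‖frobVec a‖ := by
  have h : (frobSq (a * w) : ℂ) = frobSq a := by
    rw [frobSq_eq_trace, frobSq_eq_trace, star_mul, Matrix.trace_mul_comm, ← mul_assoc,
      mul_assoc a, hw, mul_one, Matrix.trace_mul_comm]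
  rw [norm_frobVec, norm_frobVec, Complex.ofReal_injective h]

/-- Two curves in the unitary group with `U' = U α` and `V' = V α'` which start at the same point
drift apart at most linearly, because `(U V⋆)' = U (α - α') V⋆` has the norm of `α - α'`. -/
lemma norm_frobVec_sub_le_of_hasDerivAt {U V α α' : ℝ → Mat m} {K T : ℝ}
    (hU : ∀ t a b, HasDerivAt (fun t => U t a b) ((U t * α t) a b) t)
    (hV : ∀ t a b, HasDerivAt (fun t => V t a b) ((V t * α' t) a b) t)
    (hUu : ∀ t, U t * star (U t) = 1) (hVu : ∀ t, star (V t) * V t = 1)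
    (hα' : ∀ t, star (α' t) = -α' t) (hK : ∀ t, ‖frobVec (α t - α' t)‖ ≤ K) (h0 : U 0 = V 0)
    (hT : 0 ≤ T) : ‖frobVec (U T - V T)‖ ≤ T * K := by
  have hW : ∀ t a b, HasDerivAt (fun t => (U t * star (V t)) a b)
      ((U t * (α t - α' t) * star (V t)) a b) t := by
    intro t a b
    have h1 : HasDerivAt (fun t => ∑ c, U t a c * star (V t b c))
        (∑ c, ((U t * α t) a c * star (V t b c) + U t a c * star ((V t * α' t) b c))) t :=
      HasDerivAt.fun_sum fun c _ => (hU t a c).mul (hV t b c).star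
    have h2 : U t * (α t - α' t) * star (V t) =
        U t * α t * star (V t) + U t * star (V t * α' t) := by
      rw [star_mul, hα']
      noncomm_ring
    rw [h2, Matrix.add_apply, Matrix.mul_apply (M := U t * α t), Matrix.mul_apply (M := U t),
      ← Finset.sum_add_distrib]
    exact h1
  have hderiv : ∀ t, HasDerivAt (fun t => frobVec (U t * star (V t)))
      (frobVec (U t * (α t - α' t) * star (V t))) t := fun t =>
    ((PiLp.continuousLinearEquiv 2 ℝ (fun _ : Fin m × Fin m => ℂ)).symm :
      (Fin m × Fin m → ℂ) →L[ℝ] EuclideanSpace ℂ (Fin m × Fin m)).hasFDerivAt.comp_hasDerivAt t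
        (hasDerivAt_pi.2 fun p : Fin m × Fin m => hW t p.1 p.2)
  have h1 := norm_image_sub_le_of_norm_deriv_le_segment' (a := 0) (b := T)
    (fun t _ => (hderiv t).hasDerivWithinAt) (C := K) (fun t _ => by
      rw [norm_frobVec_mul_right (by rw [star_star]; exact hVu t),
        norm_frobVec_mul_left (mul_eq_one_comm.1 (hUu t))]
      exact hK t) T (Set.right_mem_Icc.2 hT)
  have h2 : ∀ t, V t * star (V t) = 1 := fun t => mul_eq_one_comm.1 (hVu t)
  rw [h0, h2, ← map_sub, sub_zero] at h1
  have h3 : U T - V T = (U T * star (V T) - 1) * V T := by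
    rw [sub_mul, one_mul, mul_assoc, hVu, mul_one]
  rw [h3, norm_frobVec_mul_right (h2 T), mul_comm T]
  exact h1

variable {E H M : Type*} [NormedAddCommGroup E] [NormedSpace ℝ E] [TopologicalSpace H]
  [TopologicalSpace M] [ChartedSpace H M] {I : ModelWithCorners ℝ E H} {ι : Type*}
  {P : UnitaryBundle I M m ι}

/-- The norm of a form dominates its values on the unit ball. -/
lemma le_formNorm {h : ∀ x : M, TangentSpace I x → TangentSpace I x → ℝ} {x : M}
    [FiniteDimensional ℝ E] (hx : IsInnerProduct (h x)) (α : TangentSpace I x →ₗ[ℝ] Mat m)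
    {v : TangentSpace I x} (hv : h x v v ≤ 1) :
    ENNReal.ofReal ‖frobVec (α v)‖ ≤ formNorm h x α := by
  have : FiniteDimensional ℝ (TangentSpace I x) := inferInstanceAs (FiniteDimensional ℝ E)
  obtain ⟨e, he, hsum⟩ := hx.exists_frame
  have h1 : ENNReal.ofReal √(∑ c, frobSq (α (e c))) ≤ formNorm h x α := by
    rw [formNorm]
    exact le_iSup₂_of_le e he le_rfl
  refine (ENNReal.ofReal_le_ofReal ?_).trans h1
  have h2 : frobVec (α v) = ∑ c, h x (e c) v • frobVec (α (e c)) := by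
    conv_lhs => rw [(hsum v).1]
    simp only [map_sum, map_smul]
  calc ‖frobVec (α v)‖ ≤ ∑ c, |h x (e c) v| * √(frobSq (α (e c))) := by
        rw [h2]
        refine (norm_sum_le _ _).trans (Finset.sum_le_sum fun c _ => ?_)
        rw [norm_smul, norm_frobVec, Real.norm_eq_abs]
    _ ≤ √(∑ c, |h x (e c) v| ^ 2) * √(∑ c, √(frobSq (α (e c))) ^ 2) :=
        Real.sum_mul_le_sqrt_mul_sqrt _ _ _
    _ ≤ 1 * √(∑ c, √(frobSq (α (e c))) ^ 2) := by
        refine mul_le_mul_of_nonneg_right ?_ (Real.sqrt_nonneg _)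
        rw [Real.sqrt_le_one]
        simpa only [sq_abs, ← (hsum v).2] using hv
    _ = √(∑ c, frobSq (α (e c))) := by
        rw [one_mul]
        simp only [Real.sq_sqrt (frobSq_nonneg _)]

/-- Conversely, the norm of a form is at most the dimension times a bound on unit vectors. -/
lemma formNorm_le {h : ∀ x : M, TangentSpace I x → TangentSpace I x → ℝ} {x : M}
    {α : TangentSpace I x →ₗ[ℝ] Mat m} {K : ℝ≥0∞}
    (hα : ∀ v, h x v v = 1 → ENNReal.ofReal ‖frobVec (α v)‖ ≤ K) :
    formNorm h x α ≤ Module.finrank ℝ E * K := by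
  refine iSup₂_le fun e he => ?_
  have h1 : ∀ c, ENNReal.ofReal ‖frobVec (α (e c))‖ ≤ K := fun c => hα _ (by rw [he, if_pos rfl])
  have h2 : √(∑ c, frobSq (α (e c))) ≤ ∑ c, ‖frobVec (α (e c))‖ := by
    refine Real.sqrt_le_iff.2 ⟨Finset.sum_nonneg fun _ _ => norm_nonneg _, ?_⟩
    refine le_trans (Finset.sum_le_sum fun c _ => ?_)
      (Finset.sum_sq_le_sq_sum_of_nonneg fun _ _ => norm_nonneg _)
    rw [norm_frobVec, Real.sq_sqrt (frobSq_nonneg _)]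
  refine (ENNReal.ofReal_le_ofReal h2).trans ?_
  rw [ENNReal.ofReal_sum_of_nonneg fun _ _ => norm_nonneg _]
  refine (Finset.sum_le_sum fun c _ => h1 c).trans ?_
  rw [Finset.sum_const, Finset.card_univ, Fintype.card_fin, nsmul_eq_mul]

lemma norm_frobVec_rep {i : ι} {x : M} (hx : x ∈ P.baseSet i) (s : M → Mat m) :
    ‖frobVec (P.rep i s x)‖ = ‖frobVec (s x)‖ := by
  have h1 := P.mem_baseSet_at x
  have h2 : P.transition (P.indexAt x) i x * star (P.transition (P.indexAt x) i x) = 1 := by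
    rw [star_trans h1 hx, trans_mul h1 hx]
  rw [norm_frobVec, rep, ← star_trans h1 hx, frobSq_conj h2, ← norm_frobVec]

variable [IsManifold I ∞ M]

lemma le_supDist {h : ∀ x : M, TangentSpace I x → TangentSpace I x → ℝ}
    [FiniteDimensional ℝ E] (hh : ∀ x, IsInnerProduct (h x)) (A A' : Connection P)
    {x : M} {i : ι} (hx : x ∈ P.baseSet i) {v : TangentSpace I x} (hv : h x v v ≤ 1) :
    ENNReal.ofReal ‖frobVec (A.form i x v - A'.form i x v)‖ ≤ A.supDist h A' := by
  have h1 := P.mem_baseSet_at x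
  have e : A.form i x v - A'.form i x v = P.transition i (P.indexAt x) x *
      (A.form (P.indexAt x) x v - A'.form (P.indexAt x) x v) * P.transition (P.indexAt x) i x := by
    rw [A.compat _ i x ⟨h1, hx⟩, A'.compat _ i x ⟨h1, hx⟩]
    noncomm_ring
  have h2 : P.transition (P.indexAt x) i x * star (P.transition (P.indexAt x) i x) = 1 := by
    rw [star_trans h1 hx, trans_mul h1 hx]
  rw [norm_frobVec, e, ← star_trans h1 hx, frobSq_conj h2, ← norm_frobVec]
  refine le_trans ?_ (le_iSup (fun x => formNorm h x
    (A.form (P.indexAt x) x - A'.form (P.indexAt x) x)) x)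
  exact le_formNorm (hh x) (A.form (P.indexAt x) x - A'.form (P.indexAt x) x) hv

lemma supDist_le {h : ∀ x : M, TangentSpace I x → TangentSpace I x → ℝ} {A A' : Connection P}
    {K : ℝ≥0∞} (hA : ∀ x v, h x v v = 1 → ENNReal.ofReal
      ‖frobVec (A.form (P.indexAt x) x v - A'.form (P.indexAt x) x v)‖ ≤ K) :
    A.supDist h A' ≤ Module.finrank ℝ E * K :=
  iSup_le fun x => formNorm_le fun v hv => hA x v hv

lemma productMetric_apply (h : ∀ x : M, TangentSpace I x → TangentSpace I x → ℝ) (p : M × Circle)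
    (v w : TangentSpace (I.prod (𝓡 1)) p) : productMetric h p v w =
      h p.1 (mfderiv (I.prod (𝓡 1)) I Prod.fst p v) (mfderiv (I.prod (𝓡 1)) I Prod.fst p w) +
      inner ℝ (dFun (I.prod (𝓡 1)) (fun q : M × Circle => (q.2 : ℂ)) p v)
        (dFun (I.prod (𝓡 1)) (fun q : M × Circle => (q.2 : ℂ)) p w) := rfl

lemma mfderiv_fst_wrap (x : M) (t : ℝ) (w : E × ℝ) :
    mfderiv (I.prod (𝓡 1)) I Prod.fst (wrap M (x, t))
      (mfderiv (I.prod 𝓘(ℝ, ℝ)) (I.prod (𝓡 1)) (wrap M) (x, t) w) = w.1 := by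
  have h1 := mfderiv_comp (x, t)
    ((contMDiff_fst (I := I) (J := 𝓡 1) (M := M) (N := Circle) (n := ∞)).mdifferentiable (by simp)
      (wrap M (x, t)))
    (contMDiff_wrap.mdifferentiable (n := ∞) (by simp) (x, t))
  have h2 := (hasMFDerivAt_fst (I := I) (I' := 𝓘(ℝ, ℝ)) (M := M) (M' := ℝ) (x, t)).mfderiv
  exact (congrArg (fun L => (L w : E)) h1).symm.trans
    (congrArg (fun L : E × ℝ →L[ℝ] E => L w) h2)

lemma isInnerProduct_productMetric {h : ∀ x : M, TangentSpace I x → TangentSpace I x → ℝ}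
    (hh : ∀ x, IsInnerProduct (h x)) (p : M × Circle) :
    IsInnerProduct (productMetric h p) where
  add_left u v w := by
    rw [productMetric_apply, productMetric_apply, productMetric_apply, map_add, map_add,
      (hh p.1).add_left, inner_add_left]
    ring
  smul_left c v w := by
    rw [productMetric_apply, productMetric_apply, map_smul, map_smul, (hh p.1).smul_left,
      real_inner_smul_left]
    ring
  symm v w := by
    rw [productMetric_apply, productMetric_apply, (hh p.1).symm, real_inner_comm]
  pos v hv := by
    rw [productMetric_apply]
    have h1 := (hh p.1).nonneg (mfderiv (I.prod (𝓡 1)) I Prod.fst p v)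
    have h2 := real_inner_self_nonneg
      (x := dFun (I.prod (𝓡 1)) (fun q : M × Circle => (q.2 : ℂ)) p v)
    refine lt_of_le_of_ne (add_nonneg h1 h2) fun h0 => hv ?_
    have h3 : mfderiv (I.prod (𝓡 1)) I Prod.fst p v = 0 := by
      by_contra h4
      linarith [(hh p.1).pos _ h4]
    have h4 : dFun (I.prod (𝓡 1)) (fun q : M × Circle => (q.2 : ℂ)) p v = 0 := by
      rw [← inner_self_eq_zero (𝕜 := ℝ)]
      linarith
    obtain ⟨x, z⟩ := p
    obtain ⟨t, rfl, w, rfl⟩ := mfderiv_wrap_surjective x z v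
    have h5 : w.1 = 0 := (mfderiv_fst_wrap (I := I) x t w).symm.trans h3
    have h6 : w.2 = 0 := by
      rw [← angleForm_wrap (I := I) x t w]
      change (star _ * dFun (I.prod (𝓡 1)) (fun q : M × Circle => (q.2 : ℂ)) _ _).im = 0
      refine (congrArg (fun z => (star (Circle.exp t : ℂ) * z).im) h4).trans ?_
      rw [mul_zero, Complex.zero_im]
    rw [show w = 0 from Prod.ext h5 h6]
    exact map_zero _

lemma productMetric_wrap (h : ∀ x : M, TangentSpace I x → TangentSpace I x → ℝ) (x : M) (t : ℝ)
    (w : E × ℝ) : productMetric h (wrap M (x, t))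
      (mfderiv (I.prod 𝓘(ℝ, ℝ)) (I.prod (𝓡 1)) (wrap M) (x, t) w)
      (mfderiv (I.prod 𝓘(ℝ, ℝ)) (I.prod (𝓡 1)) (wrap M) (x, t) w) = h x w.1 w.1 + w.2 ^ 2 := by
  rw [productMetric_apply, mfderiv_fst_wrap, dFun_circleCoe_wrap, real_inner_self_eq_norm_sq,
    norm_smul, norm_mul, Circle.norm_coe, Complex.norm_I, mul_one, mul_one, Real.norm_eq_abs,
    sq_abs]
  rfl

lemma le_supDist_lift {h : ∀ x : M, TangentSpace I x → TangentSpace I x → ℝ}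
    [FiniteDimensional ℝ E] (hh : ∀ x, IsInnerProduct (h x)) (A A' : Connection P.onCircle)
    {x : M} {i : ι} (hx : x ∈ P.baseSet i) (t : ℝ) {w : E × ℝ} (hw : h x w.1 w.1 + w.2 ^ 2 ≤ 1) :
    ENNReal.ofReal ‖frobVec (A.lift.form i (x, t) w - A'.lift.form i (x, t) w)‖ ≤
      A.supDist (productMetric h) A' :=
  le_supDist (isInnerProduct_productMetric hh) A A' (x := wrap M (x, t)) (i := i) hx
    ((productMetric_wrap h x t w).trans_le hw)

lemma supDist_le_of_lift {h : ∀ x : M, TangentSpace I x → TangentSpace I x → ℝ}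
    {A A' : Connection P.onCircle} {K : ℝ≥0∞}
    (hA : ∀ i x t, x ∈ P.baseSet i → ∀ w : E × ℝ, h x w.1 w.1 + w.2 ^ 2 = 1 → ENNReal.ofReal
      ‖frobVec (A.lift.form i (x, t) w - A'.lift.form i (x, t) w)‖ ≤ K) :
    A.supDist (productMetric h) A' ≤
      Module.finrank ℝ (E × EuclideanSpace ℝ (Fin 1)) * K := by
  refine supDist_le fun p v hv => ?_
  obtain ⟨x, z⟩ := p
  obtain ⟨t, rfl, w, rfl⟩ := mfderiv_wrap_surjective x z v
  exact hA _ x t (P.mem_baseSet_at x) w ((productMetric_wrap h x t w).symm.trans hv)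

/-- Restriction to the slice `M × {0}` is Lipschitz continuous. -/
lemma supDist_atZero_le {h : ∀ x : M, TangentSpace I x → TangentSpace I x → ℝ}
    [FiniteDimensional ℝ E] (hh : ∀ x, IsInnerProduct (h x)) (A A' : Connection P.onCircle) :
    A.atZero.supDist h A'.atZero ≤ Module.finrank ℝ E * A.supDist (productMetric h) A' := by
  refine supDist_le fun x v hv => ?_
  have e : ∀ A : Connection P.onCircle, A.atZero.form (P.indexAt x) x v =
      A.lift.form (P.indexAt x) (x, 0) (((v : E), 0) : E × ℝ) := by
    intro A
    rw [← A.slice_lift (t := 0) (by simp)]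
    refine (A.lift.pullback_form_apply _ (contMDiff_sliceAt 0) _ x v).trans ?_
    rw [mfderiv_prod_left]
    rfl
  rw [e, e]
  refine le_supDist_lift hh A A' (P.mem_baseSet_at x) 0 (le_of_eq ?_)
  rw [zero_pow two_ne_zero, add_zero]
  exact hv

/-- The model connections depend continuously on `B` and on the second gauge, uniformly. The first
gauge is common to both connections, so that its logarithm, which is not a continuous function of
it, cancels. -/
lemma supDist_modelConnection_le {h : ∀ x : M, TangentSpace I x → TangentSpace I x → ℝ}
    [FiniteDimensional ℝ E] [I.Boundaryless] (hh : ∀ x, IsInnerProduct (h x))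
    {B B' : Connection P} {a : P.gaugeGroup} (ha : a ∈ B.stabilizer) (ha' : a ∈ B'.stabilizer)
    (c : B'.stabilizer) :
    (modelConnection B ⟨a, ha⟩ 1).supDist (productMetric h) (modelConnection B' ⟨a, ha'⟩ c) ≤
      Module.finrank ℝ (E × EuclideanSpace ℝ (Fin 1)) *
        (B.supDist h B' + ENNReal.ofReal (2 / bumpMass) * gaugeNorm 1 (c : P.gaugeGroup)) := by
  refine supDist_le_of_lift fun i x t hx w hw => ?_
  have h1 := lift_modelConnection (B := B) ⟨a, ha⟩ 1 hx t w
  have h2 := lift_modelConnection (B := B') ⟨a, ha'⟩ c hx t w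
  have h3 : P.rep i (logSection (1 : P.gaugeGroup)) x = 0 := by
    have : logSection (1 : P.gaugeGroup) x = 0 := unitaryLog_one
    rw [rep, this, mul_zero, zero_mul]
  have h4 : B.cyl.form i (x, t) w = B.form i x w.1 := by
    refine (B.pullback_form_apply _ contMDiff_fst i (x, t) w).trans ?_
    rw [mfderiv_fst]
    rfl
  have h5 : B'.cyl.form i (x, t) w = B'.form i x w.1 := by
    refine (B'.pullback_form_apply _ contMDiff_fst i (x, t) w).trans ?_
    rw [mfderiv_fst]
    rfl
  have e : (modelConnection B ⟨a, ha⟩ 1).lift.form i (x, t) w -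
      (modelConnection B' ⟨a, ha'⟩ c).lift.form i (x, t) w =
      (B.form i x w.1 - B'.form i x w.1) -
        (w.2 * rampDeriv (t - Real.pi)) • P.rep i (logSection (c : P.gaugeGroup)) x := by
    rw [h1, h2, h4, h5]
    simp only [Subgroup.coe_one, h3, smul_zero, add_zero]
    rw [smul_add, mul_smul, Complex.coe_smul, Complex.coe_smul]
    abel
  have h6 : ‖frobVec (P.rep i (logSection (c : P.gaugeGroup)) x)‖ ≤
      2 * √(frobSq (val (1 : P.gaugeGroup) x - val (c : P.gaugeGroup) x)) := by
    rw [norm_frobVec_rep hx, norm_frobVec]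
    refine Real.sqrt_le_iff.2 ⟨by positivity, ?_⟩
    rw [mul_pow, Real.sq_sqrt (frobSq_nonneg _)]
    refine (frobSq_unitaryLog_le (val_mem _ x)).trans_eq ?_
    norm_num
    rfl
  have h7 : |w.2 * rampDeriv (t - Real.pi)| ≤ 1 / bumpMass := by
    rw [abs_mul, ← circleBump_exp]
    have h8 : |w.2| ≤ 1 := by
      rw [← sq_le_one_iff_abs_le_one]
      linarith [(hh x).nonneg w.1]
    exact (mul_le_mul h8 (abs_circleBump_le _) (abs_nonneg _) zero_le_one).trans_eq (one_mul _)
  have h8 : ‖frobVec ((w.2 * rampDeriv (t - Real.pi)) • P.rep i (logSection (c : P.gaugeGroup)) x)‖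
      ≤ 2 / bumpMass * √(frobSq (val (1 : P.gaugeGroup) x - val (c : P.gaugeGroup) x)) := by
    rw [map_smul, norm_smul, Real.norm_eq_abs]
    refine (mul_le_mul h7 h6 (norm_nonneg _) (one_div_pos.2 bumpMass_pos).le).trans_eq (by ring)
  rw [e, map_sub]
  refine (ENNReal.ofReal_le_ofReal ((norm_sub_le _ _).trans (add_le_add le_rfl h8))).trans ?_
  rw [ENNReal.ofReal_add (norm_nonneg _) (by have := bumpMass_pos; positivity),
    ENNReal.ofReal_mul (by have := bumpMass_pos; positivity)]
  refine add_le_add (le_supDist hh B B' hx (by nlinarith [sq_nonneg w.2])) (mul_le_mul_right ?_ _)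
  exact le_iSup (fun x => ENNReal.ofReal
    √(frobSq (val (1 : P.gaugeGroup) x - val (c : P.gaugeGroup) x))) x

/-- The holonomy is a Lipschitz continuous function of the connection. -/
lemma gaugeNorm_hol_le {h : ∀ x : M, TangentSpace I x → TangentSpace I x → ℝ}
    [FiniteDimensional ℝ E] (hh : ∀ x, IsInnerProduct (h x)) {B B' : Connection P}
    {A A' : Connection P.onCircle} {u v : P.onLine.gaugeGroup} (hu : IsCover B A u)
    (hv : IsCover B' A' v) :
    gaugeNorm (hol u) (hol v) ≤
      ENNReal.ofReal (2 * Real.pi) * A.supDist (productMetric h) A' := by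
  refine iSup_le fun x => ?_
  by_cases htop : A.supDist (productMetric h) A' = ⊤
  · rw [htop, ENNReal.mul_top (by simpa using Real.pi_pos)]
    exact le_top
  set i := P.indexAt x
  have hx : x ∈ P.baseSet i := P.mem_baseSet_at x
  -- the derivatives in the direction of time
  have hder : ∀ {B : Connection P} {A : Connection P.onCircle} {u : P.onLine.gaugeGroup},
      IsCover B A u → ∀ t a b, HasDerivAt (fun t => lrep u i (x, t) a b)
        ((lrep u i (x, t) * A.lift.form i (x, t) ((0, 1) : E × ℝ)) a b) t := by
    intro B A u hu t a b
    have h1 := (lrep_mdiff u (i := i) (x := (x, t)) hx).hasDerivAt a b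
    have h2 : dMat (I.prod 𝓘(ℝ, ℝ)) (lrep u i) (x, t) ((0, 1) : E × ℝ) =
        lrep u i (x, t) * A.lift.form i (x, t) ((0, 1) : E × ℝ) :=
      (Connection.act_eq_iff.1 hu.act_eq i (x, t) hx ((0, 1) : E × ℝ)).trans (by
        rw [Connection.cyl_form_time, zero_mul, sub_zero])
    rwa [h2] at h1
  have h1 := norm_frobVec_sub_le_of_hasDerivAt (T := 2 * Real.pi)
    (K := (A.supDist (productMetric h) A').toReal) (hder hu) (hder hv)
    (fun t => mul_star_lrep (i := i) (x := (x, t)) hx u)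
    (fun t => star_mul_lrep (i := i) (x := (x, t)) hx v)
    (fun t => A'.lift.skew i (x, t) ((0, 1) : E × ℝ)) (fun t => ?_) ?_ Real.two_pi_pos.le
  · rw [← norm_frobVec]
    have e : ∀ u : P.onLine.gaugeGroup, lrep u i (x, 2 * Real.pi) = val (hol u) x := fun u =>
      lrep_indexAt u (x, 2 * Real.pi)
    rw [e, e] at h1
    refine (ENNReal.ofReal_le_ofReal h1).trans_eq ?_
    rw [ENNReal.ofReal_mul Real.two_pi_pos.le, ENNReal.ofReal_toReal htop]
  · refine (ENNReal.ofReal_le_iff_le_toReal htop).1 (le_supDist_lift hh A A' hx t (w := (0, 1)) ?_)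
    rw [show ((0, 1) : E × ℝ).1 = (0 : TangentSpace I x) from rfl, (hh x).zero_left]
    norm_num
  · have e : ∀ u : P.onLine.gaugeGroup, sliceGauge u 0 = 1 → lrep u i (x, 0) = 1 := fun u hu => by
      refine (lrep_indexAt u (x, 0)).trans ?_
      exact congrArg (fun φ : P.gaugeGroup => (φ.1 x : Mat m)) hu
    rw [e u hu.initial, e v hv.initial]

end FormNorms

end UnitaryBundle

/-! ### Local bounds for Riemannian metrics -/

section MetricBound

open Set Filter Topology
open scoped Bundle

attribute [local instance] normedAddCommGroupTangentSpaceVectorSpace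
  normedSpaceTangentSpaceVectorSpace

/-- Near each point, the norm of the inner products `h x` on the tangent spaces is bounded by a
multiple of the norm of the model space, in the preferred chart of the point. -/
def IsLocallyBoundedMetric {E H M : Type*} [NormedAddCommGroup E] [NormedSpace ℝ E]
    [TopologicalSpace H] [TopologicalSpace M] [ChartedSpace H M] {I : ModelWithCorners ℝ E H}
    (h : ∀ x : M, TangentSpace I x → TangentSpace I x → ℝ) : Prop :=
  ∀ x₀ : M, ∃ C : ℝ, 0 < C ∧ ∃ s : Set M, IsOpen s ∧ x₀ ∈ s ∧ ∀ z ∈ (extChartAt I x₀).target,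
    (extChartAt I x₀).symm z ∈ s → ∀ w : E,
    h ((extChartAt I x₀).symm z) (mfderiv 𝓘(ℝ, E) I (extChartAt I x₀).symm z w)
      (mfderiv 𝓘(ℝ, E) I (extChartAt I x₀).symm z w) ≤ (C * ‖w‖) ^ 2

lemma norm_apply_le_of_lt {V W : Type*} [SeminormedAddCommGroup V] [SeminormedAddCommGroup W]
    [NormedSpace ℝ V] [NormedSpace ℝ W] {L : V →L[ℝ] W} {C : ℝ} (h : ‖L‖ < C) (v : V) :
    ‖L v‖ ≤ C * ‖v‖ := L.le_of_opNorm_le h.le v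

variable {n : ℕ} {Y : Type*} [TopologicalSpace Y] [ChartedSpace (EuclideanSpace ℝ (Fin n)) Y]
  [IsManifold (𝓡 n) ∞ Y]
  (g : Bundle.ContMDiffRiemannianMetric (𝓡 n) ∞ (EuclideanSpace ℝ (Fin n))
    (fun y : Y => TangentSpace (𝓡 n) y))

/-- A Riemannian metric is continuous, and hence locally bounded. -/
lemma isLocallyBoundedMetric_inner :
    IsLocallyBoundedMetric (I := 𝓡 n) (fun (y : Y) v w => g.inner y v w) := by
  intro x₀
  let : Bundle.RiemannianBundle (fun y : Y => TangentSpace (𝓡 n) y) :=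
    ⟨g.toContinuousRiemannianMetric.toRiemannianMetric⟩
  have : IsManifold (𝓡 n) 1 Y := .of_le (n := ∞) (by simp)
  obtain ⟨C, hC, h⟩ := eventually_norm_mfderivWithin_symm_extChartAt_lt (𝓡 n) x₀
  rw [(𝓡 n).range_eq_univ, nhdsWithin_univ] at h
  obtain ⟨t, ht, hto, hxt⟩ := eventually_nhds_iff.1 h
  refine ⟨C, hC, (extChartAt (𝓡 n) x₀).source ∩ extChartAt (𝓡 n) x₀ ⁻¹' t,
    (continuousOn_extChartAt x₀).isOpen_inter_preimage (isOpen_extChartAt_source x₀) hto,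
    ⟨mem_extChartAt_source x₀, hxt⟩, fun z hz hzs w => ?_⟩
  have h1 := ht z (by simpa only [mem_preimage, (extChartAt (𝓡 n) x₀).right_inv hz] using hzs.2)
  rw [mfderivWithin_univ] at h1
  have h3 := norm_apply_le_of_lt h1 w
  have h4 := pow_le_pow_left₀ (norm_nonneg _) h3 2
  rw [← real_inner_self_eq_norm_sq] at h4
  exact h4

lemma isInnerProduct_inner (y : Y) :
    IsInnerProduct (V := TangentSpace (𝓡 n) y) (fun v w => g.inner y v w) where
  add_left u v w := by rw [map_add]; rfl
  smul_left c v w := by rw [map_smul]; rfl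
  symm v w := g.symm y v w
  pos v hv := g.pos y v hv

end MetricBound

/-! ### Gauges which almost fix a connection -/

namespace UnitaryBundle

section AlmostStabilizers

open Set Filter Topology

variable {E H M : Type*} [NormedAddCommGroup E] [NormedSpace ℝ E] [TopologicalSpace H]
  [TopologicalSpace M] [ChartedSpace H M] {I : ModelWithCorners ℝ E H} {m : ℕ} {ι : Type*}
  {P : UnitaryBundle I M m ι}

/-- The unitary group is compact, so that any family of unitary matrices converges along an
ultrafilter. -/
lemma exists_tendsto_unitary {κ : Type*} (l : Ultrafilter κ)
    (u : κ → Matrix.unitaryGroup (Fin m) ℂ) :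
    ∃ a : Matrix.unitaryGroup (Fin m) ℂ, Tendsto (fun k => (u k : Mat m)) l (𝓝 (a : Mat m)) := by
  have h1 : ∀ i j, ∃ z : ℂ, Tendsto (fun k => (u k : Mat m) i j) l (𝓝 z) := fun i j => by
    obtain ⟨z, -, hz⟩ := (isCompact_closedBall (0 : ℂ) 1).ultrafilter_le_nhds
      (l.map fun k => (u k : Mat m) i j) (tendsto_principal.2 (Eventually.of_forall fun k =>
        mem_closedBall_zero_iff.2 (entry_norm_bound_of_unitary (u k).2 i j)))
    exact ⟨z, hz⟩
  choose z hz using h1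
  have h2 : Tendsto (fun k => (u k : Mat m)) l (𝓝 (Matrix.of z)) :=
    tendsto_pi_nhds.2 fun i => tendsto_pi_nhds.2 fun j => hz i j
  have h3 : Matrix.of z ∈ Matrix.unitaryGroup (Fin m) ℂ := by
    rw [Matrix.mem_unitaryGroup_iff]
    have h4 := h2.mul h2.star
    simp only [Matrix.mem_unitaryGroup_iff.1 (u _).2] at h4
    exact tendsto_nhds_unique h4 tendsto_const_nhds
  exact ⟨⟨_, h3⟩, h2⟩

lemma norm_rep_le_one (φ : P.gaugeGroup) {i : ι} {x : M} (hx : x ∈ P.baseSet i) (a b : Fin m) :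
    ‖lrep φ i x a b‖ ≤ 1 :=
  entry_norm_bound_of_unitary (Matrix.mem_unitaryGroup_iff.2 (mul_star_lrep hx φ)) a b

lemma norm_apply_le_norm_frobVec (a : Mat m) (i j : Fin m) : ‖a i j‖ ≤ ‖frobVec a‖ := by
  rw [norm_frobVec]
  exact Real.le_sqrt_of_sq_le (norm_apply_sq_le a i j)

lemma norm_frobVec_le_of_forall {a : Mat m} {r : ℝ} (hr : 0 ≤ r) (h : ∀ i j, ‖a i j‖ ≤ r) :
    ‖frobVec a‖ ≤ m * r := by
  rw [norm_frobVec]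
  refine Real.sqrt_le_iff.2 ⟨by positivity, ?_⟩
  calc frobSq a ≤ ∑ _i : Fin m, ∑ _j : Fin m, r ^ 2 := Finset.sum_le_sum fun i _ =>
        Finset.sum_le_sum fun j _ => pow_le_pow_left₀ (norm_nonneg _) (h i j) 2
    _ = (m * r) ^ 2 := by simp; ring

variable [IsManifold I ∞ M]

/-- Homogeneity extends the bound on unit vectors to all vectors. -/
lemma norm_form_sub_le {h : ∀ x : M, TangentSpace I x → TangentSpace I x → ℝ}
    [FiniteDimensional ℝ E] (hh : ∀ x, IsInnerProduct (h x)) {A A' : Connection P} {ε : ℝ}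
    (hε : 0 ≤ ε) (hA : A.supDist h A' ≤ ENNReal.ofReal ε)
    {x : M} {i : ι} (hx : x ∈ P.baseSet i) {v : TangentSpace I x} {c : ℝ} (hc : 0 ≤ c)
    (hv : h x v v ≤ c ^ 2) : ‖frobVec (A.form i x v - A'.form i x v)‖ ≤ ε * c := by
  rcases hc.eq_or_lt with rfl | hc
  · have : v = 0 := by
      by_contra h0
      have := (hh x).pos v h0
      simp only [ne_eq, OfNat.ofNat_ne_zero, not_false_eq_true, zero_pow] at hv
      linarith
    rw [this, map_zero, map_zero, sub_zero, map_zero, norm_zero, mul_zero]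
  · have h1 : h x (c⁻¹ • v) (c⁻¹ • v) ≤ 1 := by
      rw [(hh x).smul_left, (hh x).symm, (hh x).smul_left, ← mul_assoc, ← sq, inv_pow,
        inv_mul_le_iff₀ (by positivity), mul_one]
      exact hv
    have h2 := (ENNReal.ofReal_le_ofReal_iff hε).1 ((le_supDist hh A A' hx h1).trans hA)
    rw [map_smul, map_smul, ← smul_sub, map_smul, norm_smul, norm_inv, Real.norm_of_nonneg hc.le,
      inv_mul_le_iff₀ hc, mul_comm] at h2
    exact h2

/-- If a gauge `ψ` almost fixes the connection `B`, then it is close to the stabilizer of `B`.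
Otherwise there would be gauges `ψ_k` which stay away from the stabilizer and move `B` by less than
`1 / (k + 1)`; a limit of these gauges fixes `B`. -/
theorem exists_mem_stabilizer_gaugeNorm_le [FiniteDimensional ℝ E] [I.Boundaryless]
    [CompactSpace M] {h : ∀ x : M, TangentSpace I x → TangentSpace I x → ℝ}
    (hh : ∀ x, IsInnerProduct (h x)) (hb : IsLocallyBoundedMetric h) (B : Connection P) {δ : ℝ}
    (hδ : 0 < δ) :
    ∃ ε : ℝ, 0 < ε ∧ ∀ ψ : P.gaugeGroup, B.supDist h (B.act ψ) ≤ ENNReal.ofReal ε →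
      ∃ a ∈ B.stabilizer, gaugeNorm ψ a ≤ ENNReal.ofReal δ := by
  by_contra! hcon
  choose ψ hψ hfar using fun k : ℕ => hcon (1 / ((k : ℝ) + 1)) Nat.one_div_pos_of_nat
  -- limits along an ultrafilter exist pointwise without passing to subsequences
  let l : Ultrafilter ℕ := hyperfilter ℕ
  have hl : (l : Filter ℕ) ≤ atTop := by
    rw [← Nat.cofinite_eq_atTop]; exact hyperfilter_le_cofinite
  choose φ hφ using fun x => exists_tendsto_unitary l fun k => (ψ k).1 x
  let f : ι → M → Mat m := fun i => P.rep i fun x => (φ x : Mat m)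
  have hf : ∀ i x a b, Tendsto (fun k => lrep (ψ k) i x a b) l (𝓝 (f i x a b)) := fun i x a b =>
    tendsto_pi_nhds.1 (tendsto_pi_nhds.1 ((tendsto_const_nhds.mul (hφ x)).mul
      tendsto_const_nhds) a) b
  -- the convergence is locally uniform, and the limit satisfies the equation of a parallel gauge
  have key : ∀ i, ∀ x₀ ∈ P.baseSet i, ∃ U ∈ 𝓝 x₀,
      (∀ x ∈ U, SolvesAt (f i) (B.form i) (B.form i) x) ∧
      ∀ a b, TendstoUniformlyOn (fun k x => lrep (ψ k) i x a b) (fun x => f i x a b) l U := by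
    intro i x₀ hx₀
    obtain ⟨C, hC, s, hs, hxs, hbd⟩ := hb x₀
    have hα : SmoothFormOn I (B.form i) (P.baseSet i ∩ s) := fun a b =>
      (B.smooth i a b).mono (preimage_mono inter_subset_left)
    have hlim : Tendsto (fun k : ℕ => C * (1 / ((k : ℝ) + 1))) l (𝓝 0) := by
      have := (tendsto_one_div_add_atTop_nhds_zero_nat (𝕜 := ℝ)).const_mul C
      rw [mul_zero] at this
      exact this.mono_left hl
    refine exists_nhds_tendstoUniformlyOn ((P.isOpen_baseSet i).inter hs) hα hα
      (F := fun k => lrep (ψ k) i) (fun k x hx => lrep_mdiff (ψ k) hx.1)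
      (fun k x hx => norm_rep_le_one (ψ k) hx.1) (fun x _ => hf i x) ⟨hx₀, hxs⟩
      (ε := fun k => C * (1 / ((k : ℝ) + 1))) (fun k => by positivity) hC.le (fun k => ?_) hlim
      fun k z hz hzs w a b => ?_
    · refine mul_le_of_le_one_right hC.le ?_
      rw [div_le_one (by positivity)]
      exact le_add_of_nonneg_left k.cast_nonneg
    · refine (norm_apply_le_norm_frobVec _ a b).trans ?_
      set x := (extChartAt I x₀).symm z
      set v : TangentSpace I x := mfderiv 𝓘(ℝ, E) I (extChartAt I x₀).symm z w
      have e : dMat I (lrep (ψ k) i) x v - commForm (lrep (ψ k) i) (B.form i) (B.form i) x v =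
          lrep (ψ k) i x * -(B.form i x v - (B.act (ψ k)).form i x v) := by
        rw [Connection.act_eq_iff.1 rfl i x hzs.1 v, commForm_apply]
        noncomm_ring
      refine (congrArg (fun a => ‖frobVec a‖) e).trans_le ?_
      rw [norm_frobVec_mul_left (star_mul_lrep hzs.1 _), map_neg, norm_neg]
      refine (norm_form_sub_le hh (by positivity) (hψ k) hzs.1 (by positivity)
        (hbd z hz hzs.2 w)).trans_eq (by ring)
  have hsol : ∀ i, ∀ x ∈ P.baseSet i, SolvesAt (f i) (B.form i) (B.form i) x := fun i x hx => by
    obtain ⟨U, hU, h1, -⟩ := key i x hx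
    exact h1 x (mem_of_mem_nhds hU)
  let φ' : P.gaugeGroup := ⟨φ, fun i => (smoothMatOn_of_dMat_eq (P.isOpen_baseSet i)
    (B.smooth i) (B.smooth i) (hsol i)).mono inter_subset_left⟩
  have hφ' : φ' ∈ B.stabilizer := Connection.mem_stabilizer_iff.2
    (Connection.act_eq_iff.2 fun i x hx v => (hsol i x hx).2 v)
  -- the Frobenius norm is at most `m` times the largest entry, and `m = 0` is allowed
  set η : ℝ := δ / (m + 1)
  have hη : 0 < η := by positivity
  have hclose : ∀ x₀ : M, ∃ U ∈ 𝓝 x₀, ∀ᶠ k in (l : Filter ℕ), ∀ x ∈ U,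
      ‖frobVec (val (ψ k) x - val φ' x)‖ ≤ δ := by
    intro x₀
    set i := P.indexAt x₀
    obtain ⟨U, hU, -, h1⟩ := key i x₀ (P.mem_baseSet_at x₀)
    refine ⟨U ∩ P.baseSet i, inter_mem hU ((P.isOpen_baseSet i).mem_nhds (P.mem_baseSet_at x₀)), ?_⟩
    have h2 : ∀ᶠ k in (l : Filter ℕ), ∀ a b, ∀ x ∈ U, dist (f i x a b) (lrep (ψ k) i x a b) < η :=
      eventually_all.2 fun a => eventually_all.2 fun b =>
        Metric.tendstoUniformlyOn_iff.1 (h1 a b) η hη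
    filter_upwards [h2] with k hk x hx
    rw [← norm_frobVec_rep hx.2 fun x => val (ψ k) x - val φ' x]
    have e : P.rep i (fun x => val (ψ k) x - val φ' x) x = lrep (ψ k) i x - f i x := by
      simp only [rep, mul_sub, sub_mul]; rfl
    rw [e]
    refine (norm_frobVec_le_of_forall hη.le fun a b => ?_).trans ?_
    · rw [← norm_neg, Matrix.sub_apply, neg_sub, ← dist_eq_norm]
      exact (hk a b x hx.1).le
    · rw [mul_div_assoc', div_le_iff₀ (by positivity)]
      nlinarith
  choose U hU hUk using hclose
  obtain ⟨t, ht⟩ := CompactSpace.elim_nhds_subcover U hU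
  obtain ⟨k, hk⟩ := ((Filter.eventually_all_finset t).2 fun x _ => hUk x).exists
  refine (hfar k φ' hφ').not_ge (iSup_le fun x => ENNReal.ofReal_le_ofReal ?_)
  obtain ⟨x₀, hx₀, hx⟩ := mem_iUnion₂.1 (ht.symm ▸ mem_univ x : x ∈ ⋃ x ∈ t, U x)
  rw [← norm_frobVec]
  exact hk x₀ hx₀ x hx

end AlmostStabilizers

end UnitaryBundle

/-! ### Homeomorphisms from relations -/

/-- A relation between topological spaces which is total, functional and continuous in both
directions is the graph of a homeomorphism. -/
lemma exists_homeomorph_of_relation {X Z : Type*} [TopologicalSpace X] [TopologicalSpace Z]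
    (R : X → Z → Prop) (hl : ∀ x, ∃ z, R x z) (hr : ∀ z, ∃ x, R x z)
    (hul : ∀ {x z z'}, R x z → R x z' → z = z') (hur : ∀ {x x' z}, R x z → R x' z → x = x')
    (hcl : ∀ x z, R x z → ∀ V ∈ nhds z, ∃ U ∈ nhds x, ∀ x' ∈ U, ∀ z', R x' z' → z' ∈ V)
    (hcr : ∀ x z, R x z → ∀ U ∈ nhds x, ∃ V ∈ nhds z, ∀ z' ∈ V, ∀ x', R x' z' → x' ∈ U) :
    ∃ e : X ≃ₜ Z, ∀ x z, R x z → e x = z := by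
  choose f hf using hl
  choose k hk using hr
  refine ⟨⟨⟨f, k, fun x => hur (hk (f x)) (hf x), fun z => hul (hf (k z)) (hk z)⟩, ?_, ?_⟩,
    fun x z h => hul (hf x) h⟩
  · change Continuous f
    refine continuous_iff_continuousAt.2 fun x V hV => ?_
    obtain ⟨U, hU, h⟩ := hcl x (f x) (hf x) V hV
    exact Filter.mem_map.2 (Filter.mem_of_superset hU fun x' hx' => h x' hx' (f x') (hf x'))
  · change Continuous k
    refine continuous_iff_continuousAt.2 fun z U hU => ?_
    obtain ⟨V, hV, h⟩ := hcr (k z) z (hk z) U hU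
    exact Filter.mem_map.2 (Filter.mem_of_superset hV fun z' hz' => h z' hz' (k z') (hk z'))

/-! ### Irreducibility -/

namespace UnitaryBundle

section Irreducibility

variable {E H M : Type*} [NormedAddCommGroup E] [NormedSpace ℝ E] [TopologicalSpace H]
  [TopologicalSpace M] [ChartedSpace H M] {I : ModelWithCorners ℝ E H} {m : ℕ} {ι : Type*}
  {P : UnitaryBundle I M m ι}

/-- The gauge `φ` is a constant central element of the unitary group. -/
def IsConstCentral (φ : P.gaugeGroup) : Prop :=
  ∃ c ∈ Subgroup.center (Matrix.unitaryGroup (Fin m) ℂ), ∀ x, φ.1 x = c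

lemma IsConstCentral.commute {φ : P.gaugeGroup} (h : IsConstCentral φ) (ψ : P.gaugeGroup) :
    ψ * φ = φ * ψ := by
  obtain ⟨c, hc, hφ⟩ := h
  refine gauge_ext fun x => ?_
  change ψ.1 x * φ.1 x = φ.1 x * ψ.1 x
  rw [hφ, Subgroup.mem_center_iff.1 hc]

/-- A central element of the unitary group as a constant gauge. It does not depend on the choice of
frames because it commutes with the transition functions. -/
def constGauge (P : UnitaryBundle I M m ι)
    (c : Subgroup.center (Matrix.unitaryGroup (Fin m) ℂ)) : P.gaugeGroup :=
  ⟨fun _ => c, fun i => (smoothMatOn_const ((c : Matrix.unitaryGroup (Fin m) ℂ) : Mat m) _).congr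
    fun x hx => by
      have h := congrArg (fun a : Matrix.unitaryGroup (Fin m) ℂ => (a : Mat m))
        (Subgroup.mem_center_iff.1 c.2 ⟨_, P.transition_unitary i (P.indexAt x) x
          ⟨hx.1, P.mem_baseSet_at x⟩⟩)
      change P.transition i (P.indexAt x) x * ((c : Matrix.unitaryGroup (Fin m) ℂ) : Mat m) =
        ((c : Matrix.unitaryGroup (Fin m) ℂ) : Mat m) * P.transition i (P.indexAt x) x at h
      change P.transition i (P.indexAt x) x * ((c : Matrix.unitaryGroup (Fin m) ℂ) : Mat m) *
        P.transition (P.indexAt x) i x = _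
      rw [h, mul_assoc, trans_mul hx.1 (P.mem_baseSet_at x), mul_one]⟩

variable [IsManifold I ∞ M]

lemma Connection.Irreducible.act {B : Connection P} (h : B.Irreducible) (ψ : P.gaugeGroup) :
    (B.act ψ).Irreducible := by
  intro φ
  have h1 : φ ∈ (B.act ψ).stabilizer ↔ ψ * φ * ψ⁻¹ ∈ B.stabilizer := by
    rw [mem_stabilizer_iff, mem_stabilizer_iff, act_act, ← act_act B (ψ * φ)]
    constructor
    · intro h; rw [h, act_act, mul_inv_cancel, act_one]
    · intro h
      conv_rhs => rw [← h]
      rw [act_act, act_act, inv_mul_cancel, mul_one]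
  rw [h1, h]
  change IsConstCentral (ψ * φ * ψ⁻¹) ↔ IsConstCentral φ
  constructor
  · intro h
    have h2 := h.commute ψ⁻¹
    rw [mul_assoc ψ, inv_mul_cancel_left, mul_left_inj, ← mul_assoc] at h2
    rwa [h2]
  · intro h
    rwa [h.commute, mul_inv_cancel_right]

namespace IsCover

variable {B : Connection P} {A : Connection P.onCircle} {u : P.onLine.gaugeGroup}

/-- The gauges fixing `A` are determined by their restrictions to the slice `M × {0}`. -/
lemma liftGauge_eq (h : IsCover B A u) {φ : P.onCircle.gaugeGroup} (hφ : φ ∈ A.stabilizer) :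
    liftGauge φ = u⁻¹ * cylGauge (gaugeAtZero φ) * u := by
  have hA := Connection.mem_stabilizer_iff.1 hφ
  have h1 := h.act φ
  rw [Connection.mem_stabilizer_iff.1 (h.gaugeAtZero_mem h hA.symm).1, hA] at h1
  have h2 := h.unique h1
  rw [cylGauge_inv, mul_assoc, eq_inv_mul_iff_mul_eq] at h2
  rw [mul_assoc, eq_inv_mul_iff_mul_eq, h2]

/-- A gauge fixing `B` and commuting with the holonomy extends to a gauge fixing `A`. -/
lemma exists_mem_stabilizer (h : IsCover B A u) {g : P.gaugeGroup} (hg : g ∈ B.stabilizer)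
    (hgu : hol u * g = g * hol u) : ∃ φ ∈ A.stabilizer, gaugeAtZero φ = g := by
  obtain ⟨φ, h1, h2, -⟩ := h.exists_act_eq h hg hgu
  exact ⟨φ, Connection.mem_stabilizer_iff.2 h1.symm, h2⟩

/-- The holonomy commutes with itself, and hence extends to a gauge fixing `A`. If `A` is
irreducible, this gauge is a central constant. -/
lemma isConstCentral_hol (h : IsCover B A u) (hA : A.Irreducible) : IsConstCentral (hol u) := by
  obtain ⟨φ, hφ, h1⟩ := h.exists_mem_stabilizer h.hol_mem_shift.1 rfl
  obtain ⟨c, hc, h2⟩ := (hA φ).1 hφ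
  exact ⟨c, hc, fun x => by rw [← h1]; exact h2 (x, 1)⟩

lemma irreducible_left (h : IsCover B A u) (hA : A.Irreducible) : B.Irreducible := by
  refine fun g => ⟨fun hg => ?_, ?_⟩
  · obtain ⟨φ, hφ, rfl⟩ := h.exists_mem_stabilizer hg
      ((h.isConstCentral_hol hA).commute g).symm
    obtain ⟨c, hc, h2⟩ := (hA φ).1 hφ
    exact ⟨c, hc, fun x => h2 (x, 1)⟩
  · rintro ⟨c, hc, hg⟩
    have h1 : circGauge g ∈ A.stabilizer := (hA _).2 ⟨c, hc, fun p => hg p.1⟩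
    exact (h.gaugeAtZero_mem h (Connection.mem_stabilizer_iff.1 h1).symm).1

lemma irreducible_of_left (h : IsCover B A u) (hB : B.Irreducible) (hu : IsConstCentral (hol u)) :
    A.Irreducible := by
  have key : ∀ φ ∈ A.stabilizer, ∀ c ∈ Subgroup.center (Matrix.unitaryGroup (Fin m) ℂ),
      (∀ x, (gaugeAtZero φ).1 x = c) → ∀ p, φ.1 p = c := by
    rintro φ hφ c hc h0 ⟨x, z⟩
    have h1 : IsConstCentral (cylGauge (gaugeAtZero φ)) := ⟨c, hc, fun p => h0 p.1⟩
    have h2 := h.liftGauge_eq hφ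
    rw [h1.commute, inv_mul_cancel_right] at h2
    rw [← Circle.exp_arg z, ← h0 x]
    exact congrArg (fun w : P.onLine.gaugeGroup => w.1 (x, Complex.arg z)) h2
  refine fun φ => ⟨fun hφ => ?_, ?_⟩
  · have h1 := (h.gaugeAtZero_mem h (Connection.mem_stabilizer_iff.1 hφ).symm).1
    obtain ⟨c, hc, h2⟩ := (hB _).1 h1
    exact ⟨c, hc, key φ hφ c hc h2⟩
  · rintro ⟨c, hc, hφ⟩
    have h1 : gaugeAtZero φ ∈ B.stabilizer := (hB _).2 ⟨c, hc, fun x => hφ (x, 1)⟩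
    obtain ⟨φ', hφ', h2⟩ := h.exists_mem_stabilizer h1 (hu.commute _).symm
    have h3 : φ' = φ := gauge_ext fun p => by
      rw [hφ, key φ' hφ' c hc fun x => by rw [h2]; exact hφ (x, 1)]
    rwa [← h3]

/-- The connection `B` may be replaced by a gauge equivalent one. -/
lemma act_circGauge (h : IsCover B A u) (ψ : P.gaugeGroup) :
    ∃ v, IsCover (B.act ψ) (A.act (circGauge ψ)) v ∧ hol v = ψ⁻¹ * hol u * ψ :=
  ⟨_, h.act (circGauge ψ), hol_act u (circGauge ψ)⟩

end IsCover

end Irreducibility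

end UnitaryBundle

/-! ### Distances between gauge classes -/

namespace UnitaryBundle

section Estimates

open Set Filter Topology

variable {E H M : Type*} [NormedAddCommGroup E] [NormedSpace ℝ E] [TopologicalSpace H]
  [TopologicalSpace M] [ChartedSpace H M] {I : ModelWithCorners ℝ E H} {m : ℕ} {ι : Type*}
  {P : UnitaryBundle I M m ι}

lemma val_mul (a b : P.gaugeGroup) (x : M) : val (a * b) x = val a x * val b x := rfl

variable [IsManifold I ∞ M]

lemma gaugeNorm_mul_left (a b c : P.gaugeGroup) : gaugeNorm (c * a) (c * b) = gaugeNorm a b := by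
  refine iSup_congr fun x => ?_
  rw [← norm_frobVec, ← norm_frobVec, val_mul, val_mul, ← mul_sub,
    norm_frobVec_mul_left (w := val c x) (Matrix.mem_unitaryGroup_iff'.1 (c.1 x).2)]

lemma gaugeNorm_mul_right (a b c : P.gaugeGroup) : gaugeNorm (a * c) (b * c) = gaugeNorm a b := by
  refine iSup_congr fun x => ?_
  rw [← norm_frobVec, ← norm_frobVec, val_mul, val_mul, ← sub_mul,
    norm_frobVec_mul_right (w := val c x) (Matrix.mem_unitaryGroup_iff.1 (c.1 x).2)]

lemma gaugeNorm_inv_mul_mul_le (a c b : P.gaugeGroup) :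
    gaugeNorm (a⁻¹ * b * a) (c⁻¹ * b * c) ≤ gaugeNorm a c + gaugeNorm a c := by
  refine (gaugeNorm_triangle _ (a⁻¹ * b * c) _).trans (add_le_add ?_ ?_)
  · rw [gaugeNorm_mul_left]
  · rw [gaugeNorm_mul_right, gaugeNorm_mul_right, ← gaugeNorm_mul_left _ _ a,
      ← gaugeNorm_mul_right _ _ c, mul_inv_cancel, one_mul, inv_mul_cancel_right, gaugeNorm_comm]

lemma mem_nhds_mat_iff {a : Mat m} {V : Set (Mat m)} :
    V ∈ 𝓝 a ↔ ∃ η : ℝ, 0 < η ∧ ∀ b, ‖frobVec (a - b)‖ < η → b ∈ V := by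
  constructor
  · intro hV
    obtain ⟨η, hη, h⟩ := (Metric.mem_nhds_iff (α := Fin m → Fin m → ℂ)).1 hV
    refine ⟨η, hη, fun b hb => h ?_⟩
    refine (dist_pi_lt_iff hη).2 fun i => (dist_pi_lt_iff hη).2 fun j => ?_
    rw [dist_comm, dist_eq_norm]
    exact (norm_apply_le_norm_frobVec (a - b) i j).trans_lt hb
  · rintro ⟨η, hη, h⟩
    have hc : Continuous fun b : Mat m => ‖frobVec (a - b)‖ := by
      simp only [norm_frobVec, frobSq]
      fun_prop
    refine mem_of_superset ((isOpen_Iio.preimage hc).mem_nhds ?_) h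
    simpa using hη

/-- Every product of elements of the stabilizer is the holonomy of a model connection. -/
lemma exists_isCover_modelConnection [FiniteDimensional ℝ E] [I.Boundaryless] {B : Connection P}
    (a c : B.stabilizer) : ∃ v, IsCover B (modelConnection B a c) v ∧
      hol v = (a : P.gaugeGroup) * c := by
  obtain ⟨v, hv, h⟩ := (modelGauge_yields a c).exists_isCover
  refine ⟨v, hv, gauge_ext fun x => (h x _ ⟨Real.two_pi_pos.le, le_rfl⟩).trans ?_⟩
  exact ((modelGauge B a c).final_eq x).symm

/-- The connections `A` over the circle depend continuously on the connection `B` and the holonomy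
of `u`, up to gauge equivalence. The connection `A` is gauge equivalent to the model connection of
`B` and the pair `(a, 1)` with `a` its holonomy, and `A'` to the model connection of `B'` and a pair
`(a, c)`, provided that `a` fixes `B'`. -/
lemma IsCover.gaugeDist_le {h : ∀ x : M, TangentSpace I x → TangentSpace I x → ℝ}
    [FiniteDimensional ℝ E] [I.Boundaryless] (hh : ∀ x, IsInnerProduct (h x))
    {B B' : Connection P} {A A' : Connection P.onCircle} {u u' : P.onLine.gaugeGroup}
    (hu : IsCover B A u) (hu' : IsCover B' A' u') (ha : hol u ∈ B'.stabilizer)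
    {g : P.gaugeGroup} (hg : g ∈ B'.stabilizer) :
    Connection.gaugeDist (productMetric h) A A' ≤
      Module.finrank ℝ (E × EuclideanSpace ℝ (Fin 1)) * (B.supDist h B' +
        ENNReal.ofReal (2 / bumpMass) * gaugeNorm (hol u) (g * hol u' * g⁻¹)) := by
  set b : P.gaugeGroup := g * hol u' * g⁻¹ with hb
  have hbB : b ∈ B'.stabilizer := mul_mem (mul_mem hg hu'.hol_mem_shift.1) (inv_mem hg)
  let a₁ : B.stabilizer := ⟨hol u, hu.hol_mem_shift.1⟩
  let a₂ : B'.stabilizer := ⟨hol u, ha⟩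
  let c : B'.stabilizer := a₂⁻¹ * ⟨b, hbB⟩
  obtain ⟨v, hv, hvh⟩ := exists_isCover_modelConnection a₁ 1
  obtain ⟨v', hv', hvh'⟩ := exists_isCover_modelConnection a₂ c
  have h1 : hol v' = b := hvh'.trans (mul_inv_cancel_left (hol u) b)
  obtain ⟨φ, hφ, -⟩ := hu.exists_act_eq hv (one_mem _)
    (by rw [hvh, mul_one, one_mul]; exact (mul_one _).symm)
  obtain ⟨φ', hφ', -⟩ := hu'.exists_act_eq hv' (inv_mem hg)
    (by rw [h1, hb, ← mul_assoc, ← mul_assoc, inv_mul_cancel, one_mul])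
  have h2 := supDist_modelConnection_le hh hu.hol_mem_shift.1 ha c
  have h3 : gaugeNorm 1 (c : P.gaugeGroup) = gaugeNorm (hol u) b := by
    rw [← gaugeNorm_mul_left _ _ (hol u), mul_one]
    exact congrArg _ (mul_inv_cancel_left (hol u) b)
  rw [h3] at h2
  rw [← Connection.gaugeDist_act_right _ _ A' φ', Connection.gaugeDist_comm,
    ← Connection.gaugeDist_act_right _ _ A φ, Connection.gaugeDist_comm, ← hφ, ← hφ']
  refine (iInf_le _ 1).trans ?_
  rw [Connection.act_one]
  exact h2

/-- Conversely, `B` and the holonomy of `u` are controlled by `A`, up to a common gauge. -/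
lemma IsCover.exists_gauge_le {h : ∀ x : M, TangentSpace I x → TangentSpace I x → ℝ}
    [FiniteDimensional ℝ E] (hh : ∀ x, IsInnerProduct (h x))
    {B B' : Connection P} {A A' : Connection P.onCircle} {u u' : P.onLine.gaugeGroup}
    (hu : IsCover B A u) (hu' : IsCover B' A' u') {δ : ℝ≥0∞}
    (hd : Connection.gaugeDist (productMetric h) A A' < δ) :
    ∃ ψ : P.gaugeGroup, B.supDist h (B'.act ψ) ≤ Module.finrank ℝ E * δ ∧
      gaugeNorm (hol u) (ψ⁻¹ * hol u' * ψ) ≤ ENNReal.ofReal (2 * Real.pi) * δ := by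
  obtain ⟨φ, hφ⟩ := iInf_lt_iff.1 hd
  have h1 := hu'.act φ
  refine ⟨gaugeAtZero φ, ?_, ?_⟩
  · have h2 := supDist_atZero_le hh A (A'.act φ)
    rw [hu.atZero_eq, h1.atZero_eq] at h2
    exact h2.trans (by gcongr)
  · rw [← hol_act]
    exact (gaugeNorm_hol_le hh hu h1).trans (by gcongr)

end Estimates

end UnitaryBundle

/-! ### The fibres of the restriction map -/

namespace UnitaryBundle

section Classification

open Set Filter Topology

variable {E H M : Type*} [NormedAddCommGroup E] [NormedSpace ℝ E] [TopologicalSpace H]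
  [TopologicalSpace M] [ChartedSpace H M] {I : ModelWithCorners ℝ E H} {m : ℕ} {ι : Type*}
  {P : UnitaryBundle I M m ι} [IsManifold I ∞ M]

/-- The holonomy as an element of the stabilizer of `B`. -/
def IsCover.monodromy {B : Connection P} {A : Connection P.onCircle} {u : P.onLine.gaugeGroup}
    (h : IsCover B A u) : B.stabilizer := ⟨hol u, h.hol_mem_shift.1⟩

lemma AdmissibleGauge.Yields.exists_monodromy_eq [FiniteDimensional ℝ E] [I.Boundaryless]
    {B : Connection P} {u : AdmissibleGauge B} {A : Connection P.onCircle} (h : u.Yields A) :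
    ∃ v, ∃ hv : IsCover B A v, hv.monodromy = u.final := by
  obtain ⟨v, hv, hvu⟩ := h.exists_isCover
  exact ⟨v, hv, Subtype.ext (gauge_ext fun x =>
    (hvu x _ ⟨Real.two_pi_pos.le, le_rfl⟩).trans (u.final_eq x).symm)⟩

variable {h : ∀ x : M, TangentSpace I x → TangentSpace I x → ℝ}

lemma Connection.cls_eq_iff {A A' : Connection P} :
    A.cls h = A'.cls h ↔ ∃ φ : P.gaugeGroup, A' = A.act φ := Quotient.eq

lemma Connection.cls_act (A : Connection P) (φ : P.gaugeGroup) : (A.act φ).cls h = A.cls h :=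
  (Connection.cls_eq_iff.2 ⟨φ, rfl⟩).symm

lemma Con.mk_eq_mk_iff {G : Subgroup P.gaugeGroup} {a b : G} :
    Con.mk a = Con.mk b ↔ ∃ g : G, g * a * g⁻¹ = b :=
  ConjClasses.mk_eq_mk_iff_isConj.trans isConj_iff

variable [FiniteDimensional ℝ E] [I.Boundaryless]

/-- The conjugacy class of the monodromy depends continuously on the class of `A`. The point is that
the gauge bringing two connections close to each other almost fixes `B`, and hence is close to the
stabilizer of `B`. -/
lemma exists_conjDist_lt [CompactSpace M] (hh : ∀ x, IsInnerProduct (h x))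
    (hb : IsLocallyBoundedMetric h) (B : Connection P) {ε : ℝ≥0∞} (hε : 0 < ε) :
    ∃ d : ℝ≥0∞, 0 < d ∧ ∀ {A A' : Connection P.onCircle} {u u' : P.onLine.gaugeGroup}
      (hu : IsCover B A u) (hu' : IsCover B A' u'),
      Connection.gaugeDist (productMetric h) A A' < d →
        conjDist hu.monodromy hu'.monodromy < ε := by
  obtain ⟨δ, hδ, hδε⟩ := ENNReal.exists_nnreal_pos_mul_lt (a := 3) (by simp) hε.ne'
  obtain ⟨ε₁, hε₁, hstab⟩ := exists_mem_stabilizer_gaugeNorm_le hh hb B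
    (show (0 : ℝ) < δ from hδ)
  obtain ⟨d₁, hd₁, h1⟩ := ENNReal.exists_pos_mul_lt (a := (Module.finrank ℝ E : ℝ≥0∞))
    (ENNReal.natCast_ne_top _) (ENNReal.ofReal_pos.2 hε₁).ne'
  obtain ⟨d₂, hd₂, h2⟩ := ENNReal.exists_pos_mul_lt (a := ENNReal.ofReal (2 * Real.pi))
    ENNReal.ofReal_ne_top (b := δ) (by exact_mod_cast hδ.ne')
  refine ⟨min d₁ d₂, lt_min hd₁ hd₂, fun {A A' u u'} hu hu' hd => ?_⟩
  obtain ⟨ψ, hψ, hhol⟩ := hu.exists_gauge_le hh hu' hd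
  obtain ⟨a, ha, hψa⟩ := hstab ψ (hψ.trans (le_trans (by
    rw [mul_comm]; gcongr; exact min_le_left _ _) h1.le))
  rw [ENNReal.ofReal_coe_nnreal] at hψa
  let a' : B.stabilizer := ⟨a, ha⟩
  calc conjDist hu.monodromy hu'.monodromy
      ≤ gaugeNorm (hol u) ((a'⁻¹ * hu'.monodromy * a'⁻¹⁻¹ : B.stabilizer) : P.gaugeGroup) :=
        iInf_le _ a'⁻¹
    _ = gaugeNorm (hol u) (a⁻¹ * hol u' * a) := by rw [inv_inv]; rfl
    _ ≤ gaugeNorm (hol u) (ψ⁻¹ * hol u' * ψ) + (gaugeNorm ψ a + gaugeNorm ψ a) :=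
        (gaugeNorm_triangle _ _ _).trans (by gcongr; exact gaugeNorm_inv_mul_mul_le _ _ _)
    _ ≤ δ + (δ + δ) := by
        gcongr
        refine hhol.trans (le_trans ?_ h2.le)
        rw [mul_comm]; gcongr; exact min_le_right _ _
    _ = δ * 3 := by ring
    _ < ε := hδε

/-- The class of the connection `A` depends continuously on the conjugacy class of the
monodromy. -/
lemma exists_gaugeDist_lt (hh : ∀ x, IsInnerProduct (h x)) {ε : ℝ≥0∞} (hε : 0 < ε) :
    ∃ d : ℝ≥0∞, 0 < d ∧ ∀ {B B' : Connection P} {A A' : Connection P.onCircle}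
      {u u' : P.onLine.gaugeGroup}, IsCover B A u → IsCover B' A' u' →
      hol u ∈ B'.stabilizer → B.supDist h B' < d → ∀ g ∈ B'.stabilizer,
      gaugeNorm (hol u) (g * hol u' * g⁻¹) < d →
        Connection.gaugeDist (productMetric h) A A' < ε := by
  set N : ℝ≥0∞ := ((Module.finrank ℝ (E × EuclideanSpace ℝ (Fin 1)) : ℕ) : ℝ≥0∞)
  set K : ℝ≥0∞ := ENNReal.ofReal (2 / bumpMass)
  obtain ⟨d, hd, h1⟩ := ENNReal.exists_pos_mul_lt (a := N * (1 + K))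
    (ENNReal.mul_ne_top (ENNReal.natCast_ne_top _)
      (ENNReal.add_ne_top.2 ⟨ENNReal.one_ne_top, ENNReal.ofReal_ne_top⟩)) hε.ne'
  refine ⟨d, hd, fun {B B' A A' u u'} hu hu' ha hB g hg hgd => ?_⟩
  calc Connection.gaugeDist (productMetric h) A A'
      ≤ N * (B.supDist h B' + K * gaugeNorm (hol u) (g * hol u' * g⁻¹)) :=
        hu.gaugeDist_le hh hu' ha hg
    _ ≤ N * (d + K * d) := by gcongr
    _ = d * (N * (1 + K)) := by ring
    _ < ε := h1

/-- A class in the fibre over `[B]` arises from some connection gauge equivalent to `B`; applying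
this gauge gives a representative arising from `B` itself. -/
lemma exists_isCover_of_mem_rhoFibre {B : Connection P}
    {x : Moduli P.onCircle (productMetric h)} (hx : x ∈ rhoFibre h B) :
    ∃ A u, IsCover B A u ∧ A.cls _ = x := by
  obtain ⟨⟨A, ⟨B', u, hu⟩, rfl⟩, hB⟩ := hx
  obtain ⟨v, hv, -⟩ := hu.exists_isCover
  have h1 : B'.cls h = B.cls h := by
    rw [← hv.atZero_eq]
    exact hB
  obtain ⟨ψ, rfl⟩ := Connection.cls_eq_iff.1 h1
  obtain ⟨w, hw, -⟩ := hv.act_circGauge ψ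
  exact ⟨_, w, hw, Connection.cls_act A _⟩

lemma cls_mem_rhoFibre {B : Connection P} {u : AdmissibleGauge B} {A : Connection P.onCircle}
    (hu : u.Yields A) : A.cls _ ∈ rhoFibre h B := by
  obtain ⟨v, hv, -⟩ := hu.exists_isCover
  refine ⟨⟨A, ⟨B, u, hu⟩, rfl⟩, ?_⟩
  change A.atZero.cls h = _
  rw [hv.atZero_eq]

/-- Connections arising from `B` are gauge equivalent if and only if their monodromies are conjugate
in the stabilizer of `B`. -/
lemma IsCover.cls_eq_iff {B : Connection P} {A A' : Connection P.onCircle}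
    {u u' : P.onLine.gaugeGroup} (hu : IsCover B A u) (hu' : IsCover B A' u') :
    A.cls (productMetric h) = A'.cls _ ↔ Con.mk hu.monodromy = Con.mk hu'.monodromy := by
  rw [Connection.cls_eq_iff, Con.mk_eq_mk_iff]
  constructor
  · rintro ⟨φ, hφ⟩
    obtain ⟨h1, h2⟩ := hu.gaugeAtZero_mem hu' hφ
    refine ⟨⟨_, inv_mem h1⟩, Subtype.ext ?_⟩
    change (gaugeAtZero φ)⁻¹ * hol u * (gaugeAtZero φ)⁻¹⁻¹ = hol u'
    rw [inv_inv, mul_assoc, h2, inv_mul_cancel_left]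
  · rintro ⟨g, hg⟩
    have h1 : (g : P.gaugeGroup) * hol u * (g : P.gaugeGroup)⁻¹ = hol u' := congrArg Subtype.val hg
    obtain ⟨φ, hφ, -⟩ := hu.exists_act_eq hu' (inv_mem g.2) (by
      rw [← h1, mul_assoc (g : P.gaugeGroup), inv_mul_cancel_left])
    exact ⟨φ, hφ⟩

/-- Every class in the fibre over `[B]` is represented by a model connection. -/
lemma exists_cls_modelConnection_eq {B : Connection P}
    {x : Moduli P.onCircle (productMetric h)} (hx : x ∈ rhoFibre h B) :
    ∃ a, (modelConnection B a 1).cls _ = x := by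
  obtain ⟨A, u, hu, rfl⟩ := exists_isCover_of_mem_rhoFibre hx
  obtain ⟨v, hv, h1⟩ := exists_isCover_modelConnection hu.monodromy 1
  refine ⟨_, (hv.cls_eq_iff hu).2 (congrArg Con.mk (Subtype.ext (h1.trans ?_)))⟩
  exact mul_one (hol u)

/-- The fibre of `ρ` over `[B]` is homeomorphic to the set of conjugacy classes of the stabilizer of
`B`. -/
theorem exists_homeomorph_con [CompactSpace M] (hh : ∀ x, IsInnerProduct (h x))
    (hb : IsLocallyBoundedMetric h) (B : Connection P) :
    ∃ e : rhoFibre h B ≃ₜ Con B.stabilizer, ∀ (A : Connection P.onCircle)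
      (u : P.onLine.gaugeGroup) (hu : IsCover B A u) (hA : A.cls _ ∈ rhoFibre h B),
      e ⟨A.cls _, hA⟩ = Con.mk hu.monodromy := by
  refine Exists.imp (fun e he A u hu hA => he _ _ ⟨A, u, hu, rfl, rfl⟩)
    (exists_homeomorph_of_relation (fun (x : rhoFibre h B) (k : Con B.stabilizer) =>
      ∃ A u, ∃ hu : IsCover B A u, A.cls _ = x.1 ∧ Con.mk hu.monodromy = k) ?_ ?_ ?_ ?_ ?_ ?_)
  · rintro ⟨x, hx⟩
    obtain ⟨A, u, hu, h1⟩ := exists_isCover_of_mem_rhoFibre hx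
    exact ⟨_, A, u, hu, h1, rfl⟩
  · rintro ⟨a⟩
    obtain ⟨v, hv, h1⟩ := exists_isCover_modelConnection a 1
    refine ⟨⟨_, cls_mem_rhoFibre (modelGauge_yields a 1)⟩, _, v, hv, rfl, ?_⟩
    exact congrArg Con.mk (Subtype.ext (h1.trans (mul_one (a : P.gaugeGroup))))
  · rintro ⟨x, hx⟩ _ _ ⟨A, u, hu, rfl, rfl⟩ ⟨A', u', hu', h1, rfl⟩
    exact (hu.cls_eq_iff hu').1 h1.symm
  · rintro ⟨_, _⟩ ⟨_, _⟩ _ ⟨A, u, hu, rfl, rfl⟩ ⟨A', u', hu', rfl, h1⟩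
    exact Subtype.ext ((hu.cls_eq_iff hu').2 h1.symm)
  · rintro ⟨_, _⟩ _ ⟨A, u, hu, rfl, rfl⟩ V hV
    obtain ⟨ε, hε, hV⟩ := EMetric.mem_nhds_iff.1 hV
    obtain ⟨d, hd, h1⟩ := exists_conjDist_lt hh hb B hε
    refine ⟨_, Metric.eball_mem_nhds _ hd, ?_⟩
    rintro ⟨_, _⟩ hx' _ ⟨A', u', hu', rfl, rfl⟩
    refine hV (Metric.mem_eball'.2 ?_)
    exact h1 hu hu' (Metric.mem_eball'.1 hx')
  · rintro ⟨_, _⟩ _ ⟨A, u, hu, rfl, rfl⟩ U hU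
    obtain ⟨ε, hε, hU⟩ := EMetric.mem_nhds_iff.1 hU
    obtain ⟨d, hd, h1⟩ := exists_gaugeDist_lt (P := P) hh hε
    refine ⟨_, Metric.eball_mem_nhds _ hd, ?_⟩
    rintro _ hz ⟨_, _⟩ ⟨A', u', hu', rfl, rfl⟩
    refine hU (Metric.mem_eball'.2 ?_)
    obtain ⟨g, hg⟩ := iInf_lt_iff.1 (show conjDist hu.monodromy hu'.monodromy < d from
      Metric.mem_eball'.1 hz)
    exact h1 hu hu' hu.hol_mem_shift.1 (by rwa [Connection.supDist_self]) g g.2 hg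

end Classification

end UnitaryBundle

/-! ### Irreducible classes -/

namespace UnitaryBundle

section IrreducibleClasses

open Set Filter Topology

variable {E H M : Type*} [NormedAddCommGroup E] [NormedSpace ℝ E] [TopologicalSpace H]
  [TopologicalSpace M] [ChartedSpace H M] {I : ModelWithCorners ℝ E H} {m : ℕ} {ι : Type*}
  {P : UnitaryBundle I M m ι}

/-- The matrix underlying a central element of the unitary group. -/
def centralMatrix (c : Subgroup.center (Matrix.unitaryGroup (Fin m) ℂ)) : Mat m :=
  (c : Matrix.unitaryGroup (Fin m) ℂ)

lemma mem_nhds_center_iff {c : Subgroup.center (Matrix.unitaryGroup (Fin m) ℂ)}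
    {V : Set (Subgroup.center (Matrix.unitaryGroup (Fin m) ℂ))} :
    V ∈ 𝓝 c ↔ ∃ η : ℝ, 0 < η ∧ ∀ c' : Subgroup.center (Matrix.unitaryGroup (Fin m) ℂ),
      ‖frobVec (centralMatrix c - centralMatrix c')‖ < η → c' ∈ V := by
  rw [nhds_subtype_eq_comap, nhds_subtype_eq_comap, comap_comap, mem_comap]
  constructor
  · rintro ⟨W, hW, h⟩
    obtain ⟨η, hη, h1⟩ := mem_nhds_mat_iff.1 hW
    exact ⟨η, hη, fun c' hc' => h (h1 _ hc')⟩
  · rintro ⟨η, hη, h⟩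
    exact ⟨_, mem_nhds_mat_iff.2 ⟨η, hη, fun b hb => hb⟩, fun c' hc' => h c' hc'⟩

lemma isConstCentral_constGauge (c : Subgroup.center (Matrix.unitaryGroup (Fin m) ℂ)) :
    IsConstCentral (constGauge P c) := ⟨c, c.2, fun _ => rfl⟩

lemma IsConstCentral.exists_eq {φ : P.gaugeGroup} (h : IsConstCentral φ) :
    ∃ c, φ = constGauge P c := by
  obtain ⟨c, hc, hφ⟩ := h
  exact ⟨⟨c, hc⟩, gauge_ext hφ⟩

lemma constGauge_injective [Nonempty M] : Function.Injective (constGauge P) := fun _ _ h =>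
  Subtype.ext (congrArg (fun φ : P.gaugeGroup => φ.1 (Classical.arbitrary M)) h)

lemma gaugeNorm_constGauge [Nonempty M] (c c' : Subgroup.center (Matrix.unitaryGroup (Fin m) ℂ)) :
    gaugeNorm (constGauge P c) (constGauge P c') =
      ENNReal.ofReal ‖frobVec (centralMatrix c - centralMatrix c')‖ := by
  rw [norm_frobVec, gaugeNorm]
  exact iSup_const (ι := M) (a := ENNReal.ofReal √(frobSq (centralMatrix c - centralMatrix c')))

variable [IsManifold I ∞ M] [FiniteDimensional ℝ E]
  {h : ∀ x : M, TangentSpace I x → TangentSpace I x → ℝ}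

lemma inv_mul_constGauge_mul (ψ : P.gaugeGroup)
    (c : Subgroup.center (Matrix.unitaryGroup (Fin m) ℂ)) :
    ψ⁻¹ * constGauge P c * ψ = constGauge P c := by
  rw [(isConstCentral_constGauge c).commute, inv_mul_cancel_right]

/-- Irreducible iso-trivial classes are classified by an irreducible class on `M` and a central
element of the unitary group, homeomorphically. -/
theorem exists_homeomorph_center [I.Boundaryless] [Nonempty M] (hh : ∀ x, IsInnerProduct (h x)) :
    ∃ e : irredIsoModuli P h ≃ₜ
        Subgroup.center (Matrix.unitaryGroup (Fin m) ℂ) × irredModuli P h,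
      ∀ (B : Connection P) (A : Connection P.onCircle) (u : P.onLine.gaugeGroup), IsCover B A u →
        A.Irreducible → ∀ hA : A.cls _ ∈ irredIsoModuli P h,
          hol u = constGauge P (e ⟨A.cls _, hA⟩).1 ∧ (e ⟨A.cls _, hA⟩).2 = B.cls h := by
  have hex : ∀ {B : Connection P} {A : Connection P.onCircle} {u : P.onLine.gaugeGroup},
      IsCover B A u → A.Irreducible →
      ∃ p : Subgroup.center (Matrix.unitaryGroup (Fin m) ℂ) × irredModuli P h,
        hol u = constGauge P p.1 ∧ p.2.1 = B.cls h := fun hu hirr => by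
    obtain ⟨c, hc⟩ := (hu.isConstCentral_hol hirr).exists_eq
    exact ⟨(c, ⟨_, _, hu.irreducible_left hirr, rfl⟩), hc, rfl⟩
  refine Exists.imp (fun e he B A u hu hirr hA => ?_)
    (exists_homeomorph_of_relation (fun (x : irredIsoModuli P h)
      (p : Subgroup.center (Matrix.unitaryGroup (Fin m) ℂ) × irredModuli P h) =>
      ∃ B A u, IsCover B A u ∧ A.Irreducible ∧ A.cls _ = x.1 ∧
        hol u = constGauge P p.1 ∧ p.2.1 = B.cls h) ?_ ?_ ?_ ?_ ?_ ?_)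
  · obtain ⟨p, hp⟩ := hex hu hirr
    rw [he _ p ⟨B, A, u, hu, hirr, rfl, hp⟩]
    exact hp
  · rintro ⟨_, A, ⟨B, u, hu⟩, hirr, rfl⟩
    obtain ⟨v, hv, -⟩ := hu.exists_isCover
    obtain ⟨p, hp⟩ := hex hv hirr
    exact ⟨p, B, A, v, hv, hirr, rfl, hp⟩
  · rintro ⟨c, _, B, hB, rfl⟩
    let a : B.stabilizer := ⟨constGauge P c, (hB _).2 (isConstCentral_constGauge c)⟩
    obtain ⟨v, hv, h1⟩ := exists_isCover_modelConnection a 1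
    have h2 : hol v = constGauge P c := h1.trans (mul_one _)
    have hirr := hv.irreducible_of_left hB (by rw [h2]; exact isConstCentral_constGauge c)
    exact ⟨⟨_, _, ⟨B, _, modelGauge_yields a 1⟩, hirr, rfl⟩, B, _, v, hv, hirr, rfl, h2, rfl⟩
  · rintro ⟨_, _⟩ ⟨c, y⟩ ⟨c', y'⟩ ⟨B, A, u, hu, -, rfl, hc, hy⟩ ⟨B', A', u', hu', -, h1, hc', hy'⟩
    obtain ⟨φ, rfl⟩ := Connection.cls_eq_iff.1 h1.symm
    have h2 := hu.act φ
    obtain rfl : B.act (gaugeAtZero φ) = B' := by rw [← h2.atZero_eq, hu'.atZero_eq]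
    have h3 : hol u' = hol u := by
      rw [hu'.unique h2, IsCover.hol_act, hc, inv_mul_constGauge_mul]
    refine Prod.ext (constGauge_injective (P := P) ?_) (Subtype.ext ?_)
    · exact hc.symm.trans (h3.symm.trans hc')
    · exact hy.trans ((Connection.cls_act B _).symm.trans hy'.symm)
  · rintro ⟨_, _⟩ ⟨_, _⟩ ⟨c, y⟩ ⟨B, A, u, hu, -, rfl, hc, hy⟩ ⟨B', A', u', hu', -, rfl, hc', hy'⟩
    obtain ⟨ψ, rfl⟩ := Connection.cls_eq_iff.1 (hy.symm.trans hy')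
    obtain ⟨v, hv, h1⟩ := hu.act_circGauge ψ
    rw [hc, inv_mul_constGauge_mul, ← hc'] at h1
    obtain ⟨φ, hφ, -⟩ := hv.exists_act_eq hu' (one_mem _) (by rw [h1, mul_one, one_mul])
    refine Subtype.ext ((Connection.cls_act A (circGauge ψ)).symm.trans ?_)
    exact Connection.cls_eq_iff.2 ⟨φ, hφ⟩
  · rintro ⟨_, _⟩ ⟨c, y, hyi⟩ ⟨B, A, u, hu, -, rfl, hc, rfl⟩ V hV
    obtain ⟨V₁, hV₁, V₂, hV₂, hV⟩ := mem_nhds_prod_iff.1 hV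
    obtain ⟨η, hη, hV₁⟩ := mem_nhds_center_iff.1 hV₁
    obtain ⟨ε, hε, hV₂⟩ := EMetric.mem_nhds_iff.1 hV₂
    obtain ⟨d₁, hd₁, h1⟩ := ENNReal.exists_pos_mul_lt (a := (Module.finrank ℝ E : ℝ≥0∞))
      (ENNReal.natCast_ne_top _) hε.ne'
    obtain ⟨d₂, hd₂, h2⟩ := ENNReal.exists_pos_mul_lt (a := ENNReal.ofReal (2 * Real.pi))
      ENNReal.ofReal_ne_top (ENNReal.ofReal_pos.2 hη).ne'
    refine ⟨_, Metric.eball_mem_nhds _ (lt_min hd₁ hd₂), ?_⟩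
    rintro ⟨_, _⟩ hx' ⟨c', y', hyi'⟩ ⟨B', A', u', hu', -, rfl, hc', rfl⟩
    obtain ⟨ψ, hψ, hhol⟩ := hu.exists_gauge_le hh hu' (Metric.mem_eball'.1 hx')
    rw [hc, hc', inv_mul_constGauge_mul, gaugeNorm_constGauge] at hhol
    refine hV ⟨hV₁ _ ((ENNReal.ofReal_lt_ofReal_iff hη).1 (hhol.trans_lt (lt_of_le_of_lt ?_ h2))),
      hV₂ (Metric.mem_eball'.2 (lt_of_le_of_lt (iInf_le _ ψ) (hψ.trans_lt
        (lt_of_le_of_lt ?_ h1))))⟩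
    · rw [mul_comm]; gcongr; exact min_le_right _ _
    · rw [mul_comm]; gcongr; exact min_le_left _ _
  · rintro ⟨_, _⟩ ⟨c, y, hyi⟩ ⟨B, A, u, hu, -, rfl, hc, rfl⟩ U hU
    obtain ⟨ε, hε, hU⟩ := EMetric.mem_nhds_iff.1 hU
    obtain ⟨d, hd, h1⟩ := exists_gaugeDist_lt (P := P) hh hε
    obtain ⟨r, hr, hrd⟩ := ENNReal.lt_iff_exists_nnreal_btwn.1 hd
    refine ⟨_, prod_mem_nhds (mem_nhds_center_iff.2 ⟨r, by exact_mod_cast hr, fun _ h => h⟩)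
      (Metric.eball_mem_nhds _ hd), ?_⟩
    rintro ⟨c', y', hyi'⟩ ⟨hcc, hyy⟩ ⟨_, _⟩ ⟨B', A', u', hu', hirr', rfl, hc', rfl⟩
    obtain ⟨ψ, hψ⟩ := iInf_lt_iff.1 (show Connection.gaugeDist h B B' < d from
      Metric.mem_eball'.1 hyy)
    obtain ⟨v, hv, h2⟩ := hu'.act_circGauge ψ
    rw [hc', inv_mul_constGauge_mul] at h2
    refine hU (Metric.mem_eball'.2 ?_)
    refine (Connection.gaugeDist_act_right _ A A' (circGauge ψ)).symm.trans_lt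
      (h1 hu hv ?_ hψ 1 (one_mem _) ?_)
    · rw [hc]
      exact ((hu'.irreducible_left hirr').act ψ _).2 (isConstCentral_constGauge c)
    · rw [one_mul, inv_one, mul_one, hc, h2, gaugeNorm_constGauge]
      refine lt_of_le_of_lt ?_ hrd
      rw [← ENNReal.ofReal_coe_nnreal]
      exact ENNReal.ofReal_le_ofReal (le_of_lt hcc)

end IrreducibleClasses

end UnitaryBundle

/-! ### The classification -/

theorem proposition3p1 {n m : ℕ} {Y : Type*} [TopologicalSpace Y]
    [ChartedSpace (EuclideanSpace ℝ (Fin n)) Y] [IsManifold (𝓡 n) ∞ Y] [T2Space Y]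
    [CompactSpace Y] [Nonempty Y]
    (g : Bundle.ContMDiffRiemannianMetric (𝓡 n) ∞ (EuclideanSpace ℝ (Fin n))
      (fun y : Y => TangentSpace (𝓡 n) y))
    {ι : Type*} (P : UnitaryBundle (𝓡 n) Y m ι) :
    (∀ B : P.Connection,
      (∀ x ∈ UnitaryBundle.rhoFibre (fun y v w => g.inner y v w) B,
        ∃ (u : UnitaryBundle.AdmissibleGauge B) (A : P.onCircle.Connection),
          u.Yields A ∧ A.cls _ = x) ∧
      ∃ τB : UnitaryBundle.rhoFibre (fun y v w => g.inner y v w) B ≃ₜ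
          UnitaryBundle.Con B.stabilizer,
        ∀ (u : UnitaryBundle.AdmissibleGauge B) (A : P.onCircle.Connection), u.Yields A →
          ∃ hA : A.cls _ ∈ UnitaryBundle.rhoFibre (fun y v w => g.inner y v w) B,
            τB ⟨A.cls _, hA⟩ = UnitaryBundle.Con.mk u.final) ∧
    ∃ τ : UnitaryBundle.irredIsoModuli P (fun y v w => g.inner y v w) ≃ₜ
        Subgroup.center (Matrix.unitaryGroup (Fin m) ℂ) ×
          UnitaryBundle.irredModuli P (fun y v w => g.inner y v w),
      ∀ (B : P.Connection) (u : UnitaryBundle.AdmissibleGauge B) (A : P.onCircle.Connection),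
        u.Yields A → A.Irreducible →
          ∃ hA : A.cls _ ∈ UnitaryBundle.irredIsoModuli P (fun y v w => g.inner y v w),
            (∀ y, u.toFun (y, 2 * Real.pi) =
              ((τ ⟨A.cls _, hA⟩).1 : Matrix.unitaryGroup (Fin m) ℂ)) ∧
            ((τ ⟨A.cls _, hA⟩).2 : UnitaryBundle.Moduli P (fun y v w => g.inner y v w)) =
              B.cls _ := by
  have hh : ∀ y : Y, IsInnerProduct (V := TangentSpace (𝓡 n) y) (fun v w => g.inner y v w) :=
    isInnerProduct_inner g
  refine ⟨fun B => ⟨fun x hx => ?_, ?_⟩, ?_⟩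
  · obtain ⟨a, ha⟩ := UnitaryBundle.exists_cls_modelConnection_eq hx
    exact ⟨_, _, UnitaryBundle.modelGauge_yields a 1, ha⟩
  · obtain ⟨e, he⟩ :=
      UnitaryBundle.exists_homeomorph_con hh (isLocallyBoundedMetric_inner g) B
    refine ⟨e, fun u A hu => ⟨UnitaryBundle.cls_mem_rhoFibre hu, ?_⟩⟩
    obtain ⟨v, hv, h1⟩ := hu.exists_monodromy_eq
    rw [he A v hv, h1]
  · obtain ⟨e, he⟩ := UnitaryBundle.exists_homeomorph_center (P := P) hh
    refine ⟨e, fun B u A hu hirr => ⟨⟨A, ⟨B, u, hu⟩, hirr, rfl⟩, ?_⟩⟩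
    obtain ⟨v, hv, h1⟩ := hu.exists_monodromy_eq
    obtain ⟨h2, h3⟩ := he B A v hv hirr ⟨A, ⟨B, u, hu⟩, hirr, rfl⟩
    refine ⟨fun y => ?_, h3⟩
    have h4 : u.final.1 = UnitaryBundle.hol v := congrArg Subtype.val h1.symm
    rw [← u.final_eq, h4]
    exact congrArg (fun φ : P.gaugeGroup => φ.1 y) h2


end
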